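/- Conventions. A complex variety is a reduced separated scheme of finite type over $\mathbb C$ (not necessarily irreducible). $X$ is S2 if $\operatorname{depth}\mathcal O_{X,x}\ge \min(2,\dim\mathcal O_{X,x})$ for all $x\in X$. A divisor in $X$ is a closed subscheme all of whose irreducible components have codimension one. For a closed subscheme $Y$ of a normal scheme $Z$ containing no component of $Z$, $Y_{\mathrm{div}}\subset Y$ is the largest closed subscheme of $Y$ of pure codimension one in $Z$ (without embedded points). Let $X$ be a complex S2 variety with normalization $\nu\colon X^\nu\to X$. For a divisor $F_i\subset X$ put $D_i:=\nu^{-1}(F_i)_{\mathrm{div}}\subset X^\nu$. For $k>0$ let $kD_i\subset X^\nu$ be the closed subscheme with ideal sheaf $\mathcal O_{X^\nu}(-kD_i)$, i.e. of the functions that lie in the $k$-th power of the ideal of $D_i$ at every codimension one point of $X^\nu$, and let $kF_i\subset X$ be the scheme-theoretic image of $kD_i$. (1) Let $F_1,\dots,F_\ell$ be divisors in $X$ such that $F_1\cup\dots\cup F_\ell$ contains (set-theoretically) the non-normal locus of $X$, and assume that $D_1,\dots,D_\ell$ are pairwise disjoint. Write $kD=kD_1\sqcup\dots\sqcup kD_\ell$.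 Then for every $k>0$ the pushout $$X_k:=X^\nu\sqcup_{kD}(kF_1\sqcup\dots\sqcup kF_\ell)$$ of $X^\nu\leftarrow kD\to kF_1\sqcup\dots\sqcup kF_\ell$ exists in the category of schemes, there is a morphism $\nu_k\colon X_k\to X$ restricting to $\nu$ on $X^\nu$ and to the inclusions on the $kF_i$, and for all sufficiently large $k$ the morphism $\nu_k$ is an isomorphism. (2) Let $F_1,F_2$ be divisors in $X$ such that $F_1\cup F_2$ contains the non-normal locus of $X$. If $x\in F_1\cap F_2$, then $x\in\nu(D_1\cap D_2)$. (3) Let $F$ be a divisor in $X$ containing the non-normal locus of $X$ and let $x\in F$. Let $I$ be the set of analytic branches of $F$ at $x$, i.e. of irreducible components of the preimage of $F$ in $\operatorname{Spec}\widehat{\mathcal O}_{X,x}$. The codimension one preimage of a branch $B$ is the closure of the set of codimension one points of $X^\nu\times_X\operatorname{Spec}\widehat{\mathcal O}_{X,x}$ lying over $B$. Then there is no partition $I=I_1\sqcup I_2$ with $I_1,I_2$ nonempty such that the codimension one preimages of the branches in $I_1$ do not meet the codimension one preimages of the branches in $I_2$. -/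

import Mathlib

open CategoryTheory Limits AlgebraicGeometry

noncomputable section

namespace DivGluing

/-- A complex variety: a reduced, separated scheme of finite type over `Spec ℂ`.
It need not be irreducible, so integral schemes are a special case. -/
structure ComplexVariety where
  /-- the underlying scheme -/
  X : Scheme.{0}
  /-- the structure morphism -/
  str : X ⟶ Spec (CommRingCat.of ℂ)
  isReduced : IsReduced X
  isSeparated : IsSeparated str
  locallyOfFiniteType : LocallyOfFiniteType str
  quasiCompact : QuasiCompact str

attribute [instance] ComplexVariety.isReduced ComplexVariety.isSeparated
  ComplexVariety.locallyOfFiniteType ComplexVariety.quasiCompact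

instance (V : ComplexVariety) : IsNoetherian V.X where
  toIsLocallyNoetherian := LocallyOfFiniteType.isLocallyNoetherian V.str
  toCompactSpace := QuasiCompact.compactSpace_of_compactSpace V.str

section Normalization

variable (X : Scheme.{0})

/-- The disjoint union of the spectra of the residue fields at the generic points of the
irreducible components, with its map to the scheme. -/
def fromGenericPoints :
    (∐ fun η : genericPoints X => Spec (X.residueField η.1)) ⟶ X :=
  Sigma.desc fun η => X.fromSpecResidueField η.1

instance [IsNoetherian X] : Finite (genericPoints X) :=
  (genericPoints.finite (finite_irreducibleComponents_of_isNoetherian (X := X))).to_subtype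

instance [IsNoetherian X] : QuasiCompact (fromGenericPoints X) := by
  infer_instance

instance [IsNoetherian X] : QuasiSeparated (fromGenericPoints X) := by
  infer_instance

/-- The normalization of a (reduced, noetherian) scheme: its relative normalization in the
disjoint union of its generic points. -/
def normalization [IsNoetherian X] : Scheme.{0} := (fromGenericPoints X).normalization

/-- The normalization map. -/
def normalizationMap [IsNoetherian X] : normalization X ⟶ X :=
  (fromGenericPoints X).fromNormalization

end Normalization

section LocalProperties

/-- The local ring `R` has depth at least `n`: its maximal ideal contains a regular sequence
of length `n`. -/
def DepthGE (R : Type) [CommRing R] [IsLocalRing R] (n : ℕ) : Prop :=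
  ∃ rs : List R, rs.length = n ∧ (∀ r ∈ rs, r ∈ IsLocalRing.maximalIdeal R) ∧
    RingTheory.Sequence.IsRegular R rs

/-- Serre's condition `S2`: `depth 𝒪_{X,x} ≥ min (2, dim 𝒪_{X,x})` for every point `x`. -/
def IsS2 (X : Scheme.{0}) : Prop :=
  ∀ (x : X) (n : ℕ), n ≤ 2 → (n : WithBot ℕ∞) ≤ ringKrullDim (X.presheaf.stalk x) →
    DepthGE (X.presheaf.stalk x) n

/-- The points at which the local ring is not a normal domain. -/
def nonNormalLocus (X : Scheme.{0}) : Set X :=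
  {x | ¬ (IsDomain (X.presheaf.stalk x) ∧ IsIntegrallyClosed (X.presheaf.stalk x))}

/-- A point has codimension one when its local ring has dimension one. -/
def IsCodimOne (X : Scheme.{0}) (x : X) : Prop :=
  ringKrullDim (X.presheaf.stalk x) = 1

/-- The closed subscheme of `X` defined by `I` is a divisor: every generic point of (an
irreducible component of) its support has codimension one in `X`. -/
def IsDivisor {X : Scheme.{0}} (I : X.IdealSheafData) : Prop :=
  ∀ x ∈ I.support, (∀ y ∈ I.support, y ⤳ x → y = x) → IsCodimOne X x

end LocalProperties

section CodimensionOne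

variable {Z : Scheme.{0}}

/-- The ideal sheaf of the codimension one part of the closed subscheme defined by `I`:
the sections lying in the stalk of `I` at each codimension one point. On a noetherian scheme
without components inside `V(I)` this cuts out the largest closed subscheme of `V(I)` of pure
codimension one (without embedded points). -/
def codimOnePart (I : Z.IdealSheafData) : Z.IdealSheafData :=
  Scheme.IdealSheafData.ofIdeals fun U =>
    ⨅ (z : Z) (hz : z ∈ U.1) (_ : IsCodimOne Z z),
      ((I.ideal U).map (Z.presheaf.germ U.1 z hz).hom).comap (Z.presheaf.germ U.1 z hz).hom

/-- The ideal sheaf `𝒪(-kD)` of the multiple `kD` of a divisor `D` on a normal scheme: the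
sections which lie in the `k`-th power of the ideal of `D` at each codimension one point. -/
def multiple (k : ℕ) (I : Z.IdealSheafData) : Z.IdealSheafData :=
  codimOnePart (I ^ k)

end CodimensionOne

section SetUp

variable {X : Scheme.{0}} [IsNoetherian X] (F : X.IdealSheafData)

/-- `D = ν⁻¹(F)_div`, the codimension one part of the preimage of `F` in the normalization. -/
def divPreimage : (normalization X).IdealSheafData :=
  codimOnePart (F.comap (normalizationMap X))

/-- The subscheme `kD` of the normalization. -/
def kD (k : ℕ) : (normalization X).IdealSheafData :=
  multiple k (divPreimage F)

/-- `kF`, the scheme theoretic image of `kD` in `X`. -/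
def kF (k : ℕ) : X.IdealSheafData :=
  (kD F k).map (normalizationMap X)

/-- The map `kD ⟶ kF` induced by the normalization. -/
def kDTokF (k : ℕ) : (kD F k).subscheme ⟶ (kF F k).subscheme :=
  Scheme.IdealSheafData.subschemeMap _ _ (normalizationMap X) le_rfl

variable {ℓ : ℕ} (G : Fin ℓ → X.IdealSheafData)

/-- The map `kD = kD₁ ⊔ ⋯ ⊔ kD_ℓ ⟶ X^ν`. -/
def sigmaKDTo (k : ℕ) : (∐ fun i => (kD (G i) k).subscheme) ⟶ normalization X :=
  Sigma.desc fun i => (kD (G i) k).subschemeι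

/-- The map `kD = kD₁ ⊔ ⋯ ⊔ kD_ℓ ⟶ kF₁ ⊔ ⋯ ⊔ kF_ℓ`. -/
def sigmaKDToKF (k : ℕ) :
    (∐ fun i => (kD (G i) k).subscheme) ⟶ (∐ fun i => (kF (G i) k).subscheme) :=
  Limits.Sigma.map fun i => kDTokF (G i) k

/-- The map `kF₁ ⊔ ⋯ ⊔ kF_ℓ ⟶ X` given by the inclusions. -/
def sigmaKFTo (k : ℕ) : (∐ fun i => (kF (G i) k).subscheme) ⟶ X :=
  Sigma.desc fun i => (kF (G i) k).subschemeι

end SetUp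

section Branches

variable (X : Scheme.{0}) (x : X)

/-- The formal germ `Spec 𝒪̂_{X,x}` of `X` at `x`. -/
def formalGerm : Scheme.{0} :=
  Spec (CommRingCat.of (AdicCompletion (IsLocalRing.maximalIdeal (X.presheaf.stalk x))
    (X.presheaf.stalk x)))

/-- The map `Spec 𝒪̂_{X,x} ⟶ X`. -/
def formalGermMap : formalGerm X x ⟶ X :=
  Spec.map (CommRingCat.ofHom (algebraMap (X.presheaf.stalk x)
    (AdicCompletion (IsLocalRing.maximalIdeal (X.presheaf.stalk x)) (X.presheaf.stalk x)))) ≫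
  X.fromSpecStalk x

variable {X}

/-- The analytic branches of `F` at `x`: the irreducible components of the germ of `F` in the
formal germ of `X` at `x`, i.e. the closed sets defined by the minimal primes of
`𝒪̂_{F,x}`. -/
def branches (F : X.IdealSheafData) : Set (Set (formalGerm X x)) :=
  {B | Maximal (fun T => IsIrreducible T ∧ T ⊆ formalGermMap X x ⁻¹' (F.support : Set X)) B}

/-- The formal germ of the normalization along the fibre over `x`. -/
def normalizationGerm [IsNoetherian X] : Scheme.{0} :=
  pullback (normalizationMap X) (formalGermMap X x)

/-- The codimension one preimage of (the union of the branches in) a closed subset `B` of the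
formal germ: the closure, in the formal germ of the normalization, of the codimension one points
lying over `B`. -/
def codimOnePreimage [IsNoetherian X] (B : Set (formalGerm X x)) :
    Set (normalizationGerm x) :=
  closure {y | IsCodimOne (normalizationGerm x) y ∧
    (pullback.snd (normalizationMap X) (formalGermMap X x) : normalizationGerm x ⟶ _) y ∈ B}

end Branches

end DivGluing

end

open DivGluing

/-!
The theorem compares a reduced `S2` scheme `X` with its normalization `X^ν` through the quotient
sheaf `𝒪_{X^ν} / 𝒪_X`, and everything rests on one consequence of `S2`: this quotient has only
associated points of codimension one (`height_eq_one_of_mem_associatedPrimes`). They are non-normal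
points, so each lies on one of the given divisors `F_i`, and then all points of `X^ν` over it lie
on `D_i`. On an affine open `X^ν ⟶ X` is a finite birational extension `A ⊆ B`
(`normalization_finite_and_isBirationalExtension`), and an element of `B` belongs to `A` as soon as
it does so locally at the finitely many associated primes of `B / A`. Near such a prime a power of
it multiplies `B` into `A`, and generates an ideal of `B` containing a power of the ideal of `D_i`.
Hence, for large `k`, a function on `X^ν` which is congruent modulo `kD_i` to a function on `X`, for
each `i`, is itself a function on `X` (`exists_forall_mem_range_of_congruent`).

Gluing. For integral `y : Y ⟶ X`, affine `w : W ⟶ X`, a closed immersion `a : Z ⟶ Y` and a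
surjective, scheme-theoretically dominant `b : Z ⟶ W` over `X`, the relative spectrum of
`y_* 𝒪_Y ×_{z_* 𝒪_Z} w_* 𝒪_W` is the pushout of `a` and `b` in the category of all schemes
(`exists_isPushout_over`): `Y` is integral over it, so it carries the quotient topology, the fibres
of `Y` over it are those of the gluing, and a section over any open is a pair of compatible
sections. With `Z = kD` and `W = kF_1 ⊔ ⋯ ⊔ kF_ℓ` this gives `X_k`, and the congruence statement
says that `𝒪_X` and the structure sheaf of `X_k` agree for large `k`.

Intersections. If `D_1` and `D_2` had no common point over `x ∈ F_1 ∩ F_2`, the ideals of `kD_1`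
and `kD_2` would be comaximal near the fibre over `x`. An element congruent to `0` modulo one and
to `1` modulo the other would then descend to the local ring at `x`. There it and its complement to
`1` both lie in the maximal ideal, which is absurd (`not_exists_primes_of_comaximal`).

Branches. The same argument is run over the completion `C` of the local ring, where the points over
one associated point of `B / A` can belong to several branches. The extension is now tested on the
product `A'` of the thickenings `A_p / p ^ N` of the associated points, on which `B / A` is
detected (`exists_detecting_algebra`). After the flat base change to `C` a pair of comaximal ideals
of `C ⊗ B` that separates the fibres over the associated points gives an idempotent of
`C ⊗ A' ⊗ B` which is constant along the fibres of an integral map, and so descends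
(`exists_forall_mem_range_of_fibers`). The fibres of `C ⊗ B` over points of `C` above an associated
point are controlled by the generic points of the branches, by going down for the flat map
`C ⊗ κ(p) ⟶ C ⊗ B ⊗ κ(p)` (`exists_le_comap_eq_of_comap_eq`). The resulting element of the local
ring `C` would be a non-unit together with its complement to `1`.
-/

/-! ### Finite birational extensions of rings satisfying `S2` -/

namespace DivGluing

/-- The ring extension `A ⊆ B` is birational: `B` is contained in the total ring of fractions
of `A`. -/
structure IsBirationalExtension (A B : Type*) [CommRing A] [CommRing B] [Algebra A B] : Prop where
  injective : Function.Injective (algebraMap A B)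
  map_mem_nonZeroDivisors : ∀ s ∈ nonZeroDivisors A, algebraMap A B s ∈ nonZeroDivisors B
  exists_mul_eq : ∀ b : B, ∃ s ∈ nonZeroDivisors A, ∃ a : A,
    algebraMap A B s * b = algebraMap A B a

/-- The part of Serre's condition `S2` that concerns primes of height at least two: the local ring
at such a prime contains a regular sequence of length two. -/
def HasRegularPairs (A : Type*) [CommRing A] : Prop :=
  ∀ (p : Ideal A) [p.IsPrime], 2 ≤ p.height →
    ∃ f ∈ IsLocalRing.maximalIdeal (Localization.AtPrime p),
    ∃ g ∈ IsLocalRing.maximalIdeal (Localization.AtPrime p),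
      f ∈ nonZeroDivisors (Localization.AtPrime p) ∧ ∀ u v, g * u = f * v → f ∣ u

/-- The cokernel `B / A` of a ring extension `A ⊆ B`, as an `A`-module. -/
abbrev ExtensionQuotient (A B : Type*) [CommRing A] [CommRing B] [Algebra A B] : Type _ :=
  B ⧸ LinearMap.range (Algebra.linearMap A B)

section

variable {A B : Type*} [CommRing A] [CommRing B] [Algebra A B]

lemma mk_extensionQuotient_eq_zero {b : B} :
    (Submodule.Quotient.mk b : ExtensionQuotient A B) = 0 ↔ b ∈ (algebraMap A B).range := by
  rw [Submodule.Quotient.mk_eq_zero]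
  simp

lemma smul_mk_extensionQuotient_eq_zero {a : A} {b : B} :
    a • (Submodule.Quotient.mk b : ExtensionQuotient A B) = 0 ↔
      algebraMap A B a * b ∈ (algebraMap A B).range := by
  rw [← Submodule.Quotient.mk_smul, mk_extensionQuotient_eq_zero, Algebra.smul_def]

/-- An element of `B` belongs to `A` as soon as it does so locally at the associated primes of
`B / A`. -/
lemma mem_range_of_forall_associatedPrimes [IsNoetherianRing A] {b : B}
    (h : ∀ p ∈ associatedPrimes A (ExtensionQuotient A B), ∃ t ∉ p,
      algebraMap A B t * b ∈ (algebraMap A B).range) :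
    b ∈ (algebraMap A B).range := by
  by_contra hb
  obtain ⟨p, hp, hle⟩ := exists_le_isAssociatedPrime_of_isNoetherianRing A
    (Submodule.Quotient.mk b : ExtensionQuotient A B) (mt mk_extensionQuotient_eq_zero.mp hb)
  obtain ⟨t, ht, htb⟩ := h p hp
  refine ht (hle ?_)
  rw [Submodule.mem_colon_singleton, Submodule.mem_bot]
  exact smul_mk_extensionQuotient_eq_zero.mpr htb

/-- An associated prime of `B / A` is the ideal of denominators of an element of `B`. -/
lemma exists_mem_iff_of_mem_associatedPrimes [IsNoetherianRing A] {p : Ideal A}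
    (hp : p ∈ associatedPrimes A (ExtensionQuotient A B)) :
    ∃ b : B, ∀ a, a ∈ p ↔ algebraMap A B a * b ∈ (algebraMap A B).range := by
  obtain ⟨-, x, rfl⟩ := isAssociatedPrime_iff.mp hp
  obtain ⟨b, rfl⟩ := Submodule.Quotient.mk_surjective _ x
  refine ⟨b, fun a ↦ ?_⟩
  rw [Submodule.mem_colon_singleton, Submodule.mem_bot, smul_mk_extensionQuotient_eq_zero]

lemma one_le_height_of_mem_nonZeroDivisors {R : Type*} [CommRing R] {p : Ideal R}
    {s : R} (hs : s ∈ nonZeroDivisors R) (hsp : s ∈ p) : 1 ≤ p.height :=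
  (Ideal.one_le_height_span_singleton_of_mem_nonZeroDivisors hs).trans
    (Ideal.height_mono ((Ideal.span_singleton_le_iff_mem _).mpr hsp))

/-- In a reduced noetherian ring a prime of positive height contains a nonzerodivisor. -/
lemma exists_mem_nonZeroDivisors_of_one_le_height {R : Type*} [CommRing R] [IsReduced R]
    [IsNoetherianRing R] {p : Ideal R} [p.IsPrime] (hp : 1 ≤ p.height) :
    ∃ s ∈ nonZeroDivisors R, s ∈ p := by
  have hfin := minimalPrimes.finite_of_isNoetherianRing R
  have : ¬ (p : Set R) ⊆ ⋃ q ∈ minimalPrimes R, (q : Set R) := by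
    intro h
    obtain ⟨q, hq, hpq⟩ := (Ideal.subset_union_prime_finite hfin (f := fun q : Ideal R ↦ q) ⊥ ⊥
      fun q hq _ _ ↦ hq.1.1).mp h
    have := hq.1.1
    have h0 := Ideal.height_eq_zero_iff.mpr hq
    have := hp.trans ((Ideal.height_mono hpq).trans h0.le)
    simp at this
  obtain ⟨s, hsp, hs⟩ := Set.not_subset.mp this
  refine ⟨s, ?_, hsp⟩
  simp only [Set.mem_iUnion, not_exists] at hs
  rw [mem_nonZeroDivisors_iff_right]
  intro x hx
  have : x ∈ nilradical R := by
    rw [nilradical, ← Ideal.sInf_minimalPrimes, Ideal.mem_sInf]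
    intro q hq
    have hqp := hq.1.1
    refine (hqp.mem_or_mem (x := x) (y := s) (hx ▸ q.zero_mem)).resolve_right ?_
    exact hs q hq
  simpa using this

/-- Serre's condition `S2` for `A` in terms of a finite birational extension: `B / A` has no
associated primes of height other than one. -/
lemma height_eq_one_of_mem_associatedPrimes [IsNoetherianRing A] (hAB : IsBirationalExtension A B)
    (hA : HasRegularPairs A) {p : Ideal A}
    (hp : p ∈ associatedPrimes A (ExtensionQuotient A B)) : p.height = 1 := by
  have := hp.1
  obtain ⟨b, hb⟩ := exists_mem_iff_of_mem_associatedPrimes hp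
  obtain ⟨s, hs, a, hsa⟩ := hAB.exists_mul_eq b
  have hsp : s ∈ p := (hb s).mpr ⟨a, hsa.symm⟩
  refine le_antisymm ?_ (one_le_height_of_mem_nonZeroDivisors hs hsp)
  by_contra hlt
  have h2 : 2 ≤ p.height := by
    have := Order.add_one_le_of_lt (not_le.mp hlt)
    simpa [one_add_one_eq_two] using this
  obtain ⟨f, hf, g, hg, hf0, hfg⟩ := hA p h2
  -- multiplying `f` and `g` by units, they come from elements of `p`
  obtain ⟨f', tf, rfl⟩ := IsLocalization.exists_mk'_eq p.primeCompl f
  obtain ⟨g', tg, rfl⟩ := IsLocalization.exists_mk'_eq p.primeCompl g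
  rw [IsLocalization.AtPrime.mk'_mem_maximal_iff _ p] at hf hg
  have hf' : f' ∈ p := hf
  have hg' : g' ∈ p := hg
  obtain ⟨u, hu⟩ := (hb f').mp hf'
  obtain ⟨v, hv⟩ := (hb g').mp hg'
  have huv : g' * u = f' * v := by
    apply hAB.injective
    simp only [map_mul, hu, hv]; ring
  set φ := algebraMap A (Localization.AtPrime p)
  have hφf : φ f' = IsLocalization.mk' _ f' tf * φ tf := by
    rw [IsLocalization.mk'_spec]
  have hφg : φ g' = IsLocalization.mk' _ g' tg * φ tg := by
    rw [IsLocalization.mk'_spec]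
  have h1 : IsLocalization.mk' (Localization.AtPrime p) g' tg * (φ tg * φ u) =
      IsLocalization.mk' (Localization.AtPrime p) f' tf * (φ tf * φ v) := by
    rw [← mul_assoc, ← mul_assoc, ← hφf, ← hφg, ← map_mul, ← map_mul, huv]
  have hutg : IsUnit (φ tg) := IsLocalization.map_units _ tg
  have hutf : IsUnit (φ tf) := IsLocalization.map_units _ tf
  obtain ⟨w, hw⟩ := hfg _ _ h1
  have hdvd : φ f' ∣ φ u := by
    have : φ f' ∣ φ tg * φ u := by
      rw [hφf]
      obtain ⟨c, hc⟩ := hutf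
      refine ⟨↑c⁻¹ * w, ?_⟩
      rw [hw, ← hc]
      simp [mul_assoc]
    exact (hutg.dvd_mul_left).mp this
  obtain ⟨w, hw⟩ := hdvd
  -- clear denominators in `φ u = φ f' * w`
  obtain ⟨w', tw, rfl⟩ := IsLocalization.exists_mk'_eq p.primeCompl w
  have h3 : φ (u * tw) = φ (f' * w') := by
    rw [map_mul, hw, mul_assoc, IsLocalization.mk'_spec, map_mul]
  obtain ⟨t, ht⟩ := (IsLocalization.eq_iff_exists p.primeCompl _).mp h3
  -- multiply `t f' (tw b - w') = 0` by `s`, use `s b = a`, and cancel `f'` locally at `p`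
  have hf0' : φ f' ∈ nonZeroDivisors (Localization.AtPrime p) := by
    rw [hφf]
    exact mul_mem hf0 hutf.mem_nonZeroDivisors
  have h4 : φ f' * φ (t * (tw * a - s * w')) = 0 := by
    rw [← map_mul]
    have : f' * (t * (tw * a - s * w')) = 0 := by
      apply hAB.injective
      have e1 := congrArg (algebraMap A B) ht
      simp only [map_mul, map_sub, map_zero] at e1 ⊢
      rw [← hsa]
      rw [hu] at e1
      linear_combination (algebraMap A B s) * e1
    rw [this, map_zero]
  have h5 : φ (t * (tw * a - s * w')) = 0 :=
    (mem_nonZeroDivisors_iff_left.mp hf0') _ h4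
  obtain ⟨t', ht'⟩ := (IsLocalization.map_eq_zero_iff p.primeCompl _ _).mp h5
  -- since `s` is a nonzerodivisor, `t' t tw b = t' t w'` lies in `A`
  have h6 : algebraMap A B (t' * t * tw) * b = algebraMap A B (t' * t * w') := by
    have e2 := congrArg (algebraMap A B) ht'
    have := hAB.map_mem_nonZeroDivisors s hs
    rw [mem_nonZeroDivisors_iff_left] at this
    refine sub_eq_zero.mp (this _ ?_)
    simp only [map_mul, map_sub, map_zero] at e2 ⊢
    rw [← hsa] at e2
    linear_combination e2
  have h7 : (t' * t * tw : A) ∈ p := (hb _).mpr ⟨_, h6.symm⟩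
  exact (mul_mem (mul_mem t'.2 t.2) tw.2 : (t' * t * tw : A) ∈ p.primeCompl) h7

/-- `B / A` is supported in the locus where `A` is not normal, when `B` is integral over `A`. -/
lemma not_isIntegrallyClosed_of_mem_associatedPrimes [IsNoetherianRing A]
    [Algebra.IsIntegral A B] (hAB : IsBirationalExtension A B) {p : Ideal A} [p.IsPrime]
    (hp : p ∈ associatedPrimes A (ExtensionQuotient A B))
    (h : IsDomain (Localization.AtPrime p)) (h' : IsIntegrallyClosed (Localization.AtPrime p)) :
    False := by
  obtain ⟨b, hb⟩ := exists_mem_iff_of_mem_associatedPrimes hp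
  obtain ⟨s, hs, a, hsa⟩ := hAB.exists_mul_eq b
  set φ := algebraMap A (Localization.AtPrime p)
  set K := FractionRing (Localization.AtPrime p)
  set ψ : A →+* K := (algebraMap (Localization.AtPrime p) K).comp φ with hψ
  have hφs : φ s ≠ 0 := by
    have : φ s ∈ nonZeroDivisors (Localization.AtPrime p) :=
      IsLocalization.map_nonZeroDivisors_le p.primeCompl _ ⟨s, hs, rfl⟩
    exact nonZeroDivisors.ne_zero this
  have hψs : ψ s ≠ 0 := by
    simpa [hψ] using hφs
  -- the element `a / s` of the fraction field of `A_p` is integral over `A_p`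
  have hint : IsIntegral (Localization.AtPrime p) (ψ a / ψ s) := by
    obtain ⟨P, hP, hPb⟩ := Algebra.IsIntegral.isIntegral (R := A) b
    have key : ∀ Q : Polynomial A, ∃ c : A, algebraMap A B c =
        algebraMap A B s ^ Q.natDegree * Q.eval₂ (algebraMap A B) b ∧
        ψ c = ψ s ^ Q.natDegree * Q.eval₂ ψ (ψ a / ψ s) := by
      intro Q
      refine ⟨∑ i ∈ Finset.range (Q.natDegree + 1), s ^ (Q.natDegree - i) * Q.coeff i * a ^ i,
        ?_, ?_⟩
      · rw [Polynomial.eval₂_eq_sum_range, map_sum, Finset.mul_sum]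
        refine Finset.sum_congr rfl fun i hi ↦ ?_
        obtain ⟨j, hj⟩ := Nat.exists_eq_add_of_le (Nat.lt_succ_iff.mp (Finset.mem_range.mp hi))
        rw [hj, Nat.add_sub_cancel_left]
        simp only [map_mul, map_pow, ← hsa]
        ring
      · rw [Polynomial.eval₂_eq_sum_range, map_sum, Finset.mul_sum]
        refine Finset.sum_congr rfl fun i hi ↦ ?_
        obtain ⟨j, hj⟩ := Nat.exists_eq_add_of_le (Nat.lt_succ_iff.mp (Finset.mem_range.mp hi))
        rw [hj, Nat.add_sub_cancel_left]
        simp only [map_mul, map_pow]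
        have hx : ψ a = ψ a / ψ s * ψ s := (div_mul_cancel₀ _ hψs).symm
        generalize ψ a / ψ s = x at hx
        rw [hx]
        ring
    obtain ⟨c, hc1, hc2⟩ := key P
    rw [hPb, mul_zero] at hc1
    have hc0 : c = 0 := hAB.injective (by rw [hc1, map_zero])
    rw [hc0, map_zero] at hc2
    have h0 : P.eval₂ ψ (ψ a / ψ s) = 0 :=
      (mul_eq_zero.mp hc2.symm).resolve_left (pow_ne_zero _ hψs)
    refine ⟨P.map φ, hP.map φ, ?_⟩
    rw [Polynomial.eval₂_map]
    exact h0
  obtain ⟨c, hc⟩ := IsIntegrallyClosed.algebraMap_eq_of_integral hint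
  obtain ⟨c', t, rfl⟩ := IsLocalization.exists_mk'_eq p.primeCompl c
  have h1 : φ (a * t) = φ (s * c') := by
    apply IsFractionRing.injective (Localization.AtPrime p) K
    have : ψ a = ψ s * algebraMap (Localization.AtPrime p) K (IsLocalization.mk' _ c' t) := by
      rw [hc, mul_div_cancel₀ _ hψs]
    have e := IsLocalization.mk'_spec (Localization.AtPrime p) c' t
    rw [map_mul, map_mul, map_mul, map_mul, ← e, map_mul]
    change ψ a * _ = ψ s * _
    rw [this]; ring
  obtain ⟨t', ht'⟩ := (IsLocalization.eq_iff_exists p.primeCompl _).mp h1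
  have h2 : algebraMap A B (t' * t) * b = algebraMap A B (t' * c') := by
    have e2 := congrArg (algebraMap A B) ht'
    have := hAB.map_mem_nonZeroDivisors s hs
    rw [mem_nonZeroDivisors_iff_left] at this
    refine sub_eq_zero.mp (this _ ?_)
    simp only [map_mul, ← hsa] at e2 ⊢
    linear_combination e2
  exact (mul_mem t'.2 t.2 : (t' * t : A) ∈ p.primeCompl) ((hb _).mpr ⟨_, h2.symm⟩)

/-- Some power of an associated prime `p` of height one multiplies `B` into `A`, locally at `p`:
a power of `p` lies in the conductor. -/
lemma exists_pow_mul_mem_range [IsNoetherianRing A] [Module.Finite A B]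
    (hAB : IsBirationalExtension A B) {p : Ideal A} [p.IsPrime] (hp : p.height = 1) :
    ∃ N : ℕ, ∀ r ∈ p ^ N, ∀ b : B, ∃ t ∉ p,
      algebraMap A B (t * r) * b ∈ (algebraMap A B).range := by
  -- a common denominator of generators of `B`
  obtain ⟨s, hs, hsB⟩ : ∃ s ∈ nonZeroDivisors A, ∀ b : B,
      algebraMap A B s * b ∈ (algebraMap A B).range := by
    obtain ⟨S, hS⟩ := Module.Finite.fg_top (R := A) (M := B)
    choose den hden num hnum using hAB.exists_mul_eq
    refine ⟨∏ b ∈ S, den b, prod_mem fun b _ ↦ hden b, fun b ↦ ?_⟩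
    have hb : b ∈ Submodule.span A (S : Set B) := hS ▸ Submodule.mem_top
    induction hb using Submodule.span_induction with
    | mem b hb =>
      obtain ⟨c, hc⟩ := Finset.dvd_prod_of_mem den hb
      refine ⟨c * num b, ?_⟩
      rw [hc, map_mul, map_mul, ← hnum]; ring
    | zero => exact ⟨0, by simp⟩
    | add x y _ _ hx hy => rw [mul_add]; exact add_mem hx hy
    | smul a x _ hx =>
      rw [Algebra.smul_def, mul_left_comm]
      exact mul_mem ⟨a, rfl⟩ hx
  by_cases hsp : s ∈ p
  swap
  · exact ⟨0, fun r _ b ↦ ⟨s, hsp, by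
      rw [map_mul, mul_comm (algebraMap A B s), mul_assoc]
      exact mul_mem ⟨r, rfl⟩ (hsB b)⟩⟩
  have hmin : p ∈ (Ideal.span {s}).minimalPrimes := by
    have : p.FiniteHeight := ⟨Or.inr (by rw [hp]; exact ENat.natCast_ne_top 1)⟩
    refine Ideal.mem_minimalPrimes_of_height_le ((Ideal.span_singleton_le_iff_mem _).mpr hsp) ?_
    rw [hp]
    exact Ideal.one_le_height_span_singleton_of_mem_nonZeroDivisors hs
  -- `p` is contained in the radical of the saturation of `(s)` at `p`
  let J : Ideal A := ((Ideal.span {s}).map (algebraMap A (Localization.AtPrime p))).comap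
    (algebraMap A (Localization.AtPrime p))
  have hJ : p ≤ J.radical := by
    rw [Ideal.radical_eq_sInf]
    refine le_sInf fun q hq ↦ ?_
    obtain ⟨hJq, hqp⟩ := hq
    by_contra hpq
    have hrad : (Ideal.map (algebraMap A (Localization.AtPrime p)) (Ideal.span {s})).radical =
        p.map (algebraMap A (Localization.AtPrime p)) :=
      IsLocalization.AtPrime.radical_map_of_mem_minimalPrimes (Localization.AtPrime p) _ _ hmin
    obtain ⟨r, hr, hrq⟩ := Set.not_subset.mp hpq
    have : algebraMap A (Localization.AtPrime p) r ∈
        (Ideal.map (algebraMap A (Localization.AtPrime p)) (Ideal.span {s})).radical := by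
      rw [hrad]
      exact Ideal.mem_map_of_mem _ hr
    obtain ⟨n, hn⟩ := this
    refine hrq (hqp.mem_of_pow_mem n (hJq ?_))
    rw [Ideal.mem_comap, map_pow]
    exact hn
  obtain ⟨N, hN⟩ := Ideal.exists_pow_le_of_le_radical_of_fg hJ (IsNoetherian.noetherian p)
  refine ⟨N, fun r hr b ↦ ?_⟩
  have hrJ := hN hr
  obtain ⟨⟨⟨a, ha⟩, t⟩, hx⟩ :=
    (IsLocalization.mem_map_algebraMap_iff p.primeCompl (Localization.AtPrime p)).mp hrJ
  rw [← map_mul] at hx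
  obtain ⟨t', ht'⟩ := (IsLocalization.eq_iff_exists p.primeCompl _).mp hx
  obtain ⟨c, rfl⟩ := Ideal.mem_span_singleton'.mp ha
  refine ⟨t' * t, (mul_mem t'.2 t.2 : (t' * t : A) ∈ p.primeCompl), ?_⟩
  have : (t' * t * r : A) = (t' * c) * s := by
    linear_combination ht'
  rw [this, map_mul, mul_assoc]
  exact mul_mem ⟨_, rfl⟩ (hsB b)

end

end DivGluing

/-! ### Gluing modulo powers of ideals -/

namespace DivGluing

section

variable {A B : Type*} [CommRing A] [CommRing B] [Algebra A B]

/-- The saturation of an ideal `I` of the `A`-algebra `B` at a prime `p` of `A`: the elements that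
lie in `I` locally at `p`. -/
def saturationAt (p : Ideal A) [p.IsPrime] (I : Ideal B) : Ideal B where
  carrier := {b | ∃ t ∉ p, algebraMap A B t * b ∈ I}
  zero_mem' := ⟨1, p.one_notMem, by simp⟩
  add_mem' := by
    rintro x y ⟨t, ht, hx⟩ ⟨u, hu, hy⟩
    refine ⟨t * u, (mul_mem ht hu : t * u ∈ p.primeCompl), ?_⟩
    have : algebraMap A B (t * u) * (x + y) =
        algebraMap A B u * (algebraMap A B t * x) + algebraMap A B t * (algebraMap A B u * y) := by
      rw [map_mul]; ring
    rw [this]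
    exact I.add_mem (I.mul_mem_left _ hx) (I.mul_mem_left _ hy)
  smul_mem' := by
    rintro c x ⟨t, ht, hx⟩
    exact ⟨t, ht, by rw [smul_eq_mul, mul_left_comm]; exact I.mul_mem_left _ hx⟩

lemma le_saturationAt (p : Ideal A) [p.IsPrime] (I : Ideal B) : I ≤ saturationAt p I :=
  fun b hb ↦ ⟨1, p.one_notMem, by simpa using hb⟩

/-- An ideal that contains a power of `p` and avoids a multiplicative set containing the image of
the complement of `p` is contained in a prime over `p` with the same property. -/
lemma exists_prime_comap_eq_of_disjoint {p : Ideal A} [p.IsPrime] {N : ℕ} {I : Ideal B}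
    (hI : (p ^ N).map (algebraMap A B) ≤ I) (T : Submonoid B)
    (hT : ∀ t ∉ p, algebraMap A B t ∈ T) (hd : Disjoint (I : Set B) T) :
    ∃ Q : Ideal B, Q.IsPrime ∧ Q.comap (algebraMap A B) = p ∧ I ≤ Q ∧ Disjoint (Q : Set B) T := by
  obtain ⟨Q, hQ, hIQ, hQT⟩ := Ideal.exists_le_prime_disjoint I T hd
  refine ⟨Q, hQ, le_antisymm (fun a ha ↦ ?_) (fun a ha ↦ ?_), hIQ, hQT⟩
  · by_contra hap
    exact Set.disjoint_left.mp hQT ha (hT a hap)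
  · refine hQ.mem_of_pow_mem N ?_
    rw [← map_pow]
    exact hIQ (hI (Ideal.mem_map_of_mem _ (Ideal.pow_mem_pow ha N)))

/-- Let `J` be an ideal of `B` contained in all primes over `p`. High powers of `J`, localized at
the primes over `p`, lie in any given power of `p`. -/
lemma exists_forall_mem_saturationAt [IsNoetherianRing B] (p : Ideal A) [p.IsPrime] (J : Ideal B)
    (hJ : ∀ Q : Ideal B, Q.IsPrime → Q.comap (algebraMap A B) = p → J ≤ Q) (N : ℕ) :
    ∃ k₀ : ℕ, ∀ k, k₀ ≤ k → ∀ b : B,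
      (∀ Q : Ideal B, Q.IsPrime → Q.comap (algebraMap A B) = p → ∃ u ∉ Q, u * b ∈ J ^ k) →
      b ∈ saturationAt p ((p ^ N).map (algebraMap A B)) := by
  set q := saturationAt p ((p ^ N).map (algebraMap A B)) with hq
  have hle : (p ^ N).map (algebraMap A B) ≤ q := le_saturationAt _ _
  have hrad : J ≤ q.radical := by
    intro j hj
    by_contra hjq
    -- otherwise some prime over `p` avoids `j`
    let T : Submonoid B := p.primeCompl.map (algebraMap A B) ⊔ Submonoid.powers j
    have hd : Disjoint (q : Set B) T := by
      rw [Set.disjoint_left]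
      intro x hx hxT
      obtain ⟨y, ⟨t, ht, rfl⟩, z, ⟨n, rfl⟩, rfl⟩ := Submonoid.mem_sup.mp hxT
      obtain ⟨u, hu, hux⟩ := hx
      refine hjq ⟨n, u * t, (mul_mem hu ht : u * t ∈ p.primeCompl), ?_⟩
      rw [map_mul, mul_assoc]
      exact hux
    obtain ⟨Q, hQ, hQp, -, hQT⟩ := exists_prime_comap_eq_of_disjoint hle T
      (fun t ht ↦ Submonoid.mem_sup_left ⟨t, ht, rfl⟩) hd
    exact Set.disjoint_left.mp hQT (hJ Q hQ hQp hj)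
      (Submonoid.mem_sup_right (Submonoid.mem_powers j))
  obtain ⟨k₀, hk₀⟩ := Ideal.exists_pow_le_of_le_radical_of_fg hrad (IsNoetherian.noetherian J)
  refine ⟨k₀, fun k hk b hb ↦ ?_⟩
  by_contra hbq
  -- otherwise some prime over `p` contains all elements that multiply `b` into `q`
  let I : Ideal B := q.colon {b}
  have hd : Disjoint (I : Set B) (p.primeCompl.map (algebraMap A B)) := by
    rw [Set.disjoint_left]
    rintro _ hx ⟨t, ht, rfl⟩
    obtain ⟨u, hu, hux⟩ := Submodule.mem_colon_singleton.mp hx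
    refine hbq ⟨u * t, (mul_mem hu ht : u * t ∈ p.primeCompl), ?_⟩
    rw [map_mul, mul_assoc]
    exact hux
  obtain ⟨Q, hQ, hQp, hIQ, -⟩ := exists_prime_comap_eq_of_disjoint (I := I) (N := N)
    (fun x hx ↦ Submodule.mem_colon_singleton.mpr (q.mul_mem_right _ (hle hx)))
    (p.primeCompl.map (algebraMap A B)) (fun t ht ↦ ⟨t, ht, rfl⟩) hd
  obtain ⟨u, hu, hub⟩ := hb Q hQ hQp
  exact hu (hIQ (Submodule.mem_colon_singleton.mpr (hk₀ (Ideal.pow_le_pow_right hk hub))))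

/-- The algebraic core of divisorial gluing. Suppose every associated prime `p` of `B / A` has an
index `i` such that the ideal `J i` is contained in all primes over `p`. If `k` is large, then an
element of `B` which is congruent to an element of `A` modulo `J i ^ k` at the primes over `p`, for
all `i`, belongs to `A`. -/
lemma exists_forall_mem_range_of_congruent [IsNoetherianRing A] [Module.Finite A B]
    (hAB : IsBirationalExtension A B) (hA : HasRegularPairs A) {ι : Type*} (J : ι → Ideal B)
    (hJ : ∀ p ∈ associatedPrimes A (ExtensionQuotient A B), ∃ i, ∀ Q : Ideal B, Q.IsPrime →
      Q.comap (algebraMap A B) = p → J i ≤ Q) :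
    ∃ k₀ : ℕ, ∀ k, k₀ ≤ k → ∀ b : B,
      (∀ i, ∃ a : A, ∀ p ∈ associatedPrimes A (ExtensionQuotient A B), ∀ Q : Ideal B, Q.IsPrime →
        Q.comap (algebraMap A B) = p → ∃ u ∉ Q, u * (b - algebraMap A B a) ∈ J i ^ k) →
      b ∈ (algebraMap A B).range := by
  have hBN : IsNoetherianRing B := IsNoetherianRing.of_finite A B
  have hex : ∀ p ∈ associatedPrimes A (ExtensionQuotient A B), ∃ k₀ : ℕ, ∀ k, k₀ ≤ k → ∀ b : B,
      (∀ i, ∃ a : A, ∀ p ∈ associatedPrimes A (ExtensionQuotient A B), ∀ Q : Ideal B, Q.IsPrime →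
        Q.comap (algebraMap A B) = p → ∃ u ∉ Q, u * (b - algebraMap A B a) ∈ J i ^ k) →
      ∃ t ∉ p, algebraMap A B t * b ∈ (algebraMap A B).range := by
    intro p hp
    have := hp.1
    obtain ⟨N, hN⟩ := exists_pow_mul_mem_range hAB (height_eq_one_of_mem_associatedPrimes hAB hA hp)
    obtain ⟨i, hi⟩ := hJ p hp
    obtain ⟨k₀, hk₀⟩ := exists_forall_mem_saturationAt p (J i) hi N
    refine ⟨k₀, fun k hk b hb ↦ ?_⟩
    obtain ⟨a, ha⟩ := hb i
    obtain ⟨t, ht, hmem⟩ := hk₀ k hk _ (ha p hp)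
    -- elements of `p ^ N B` belong to `A` locally at `p`
    have hloc : ∀ x ∈ (p ^ N).map (algebraMap A B), ∃ t ∉ p,
        algebraMap A B t * x ∈ (algebraMap A B).range := by
      intro x hx
      induction hx using Submodule.span_induction with
      | mem x hx =>
        obtain ⟨r, hr, rfl⟩ := hx
        exact ⟨1, p.one_notMem, r, by simp⟩
      | zero => exact ⟨1, p.one_notMem, 0, by simp⟩
      | add x y _ _ hx hy =>
        obtain ⟨t, ht, hx⟩ := hx
        obtain ⟨u, hu, hy⟩ := hy
        refine ⟨t * u, (mul_mem ht hu : t * u ∈ p.primeCompl), ?_⟩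
        have : algebraMap A B (t * u) * (x + y) = algebraMap A B u * (algebraMap A B t * x) +
            algebraMap A B t * (algebraMap A B u * y) := by
          rw [map_mul]; ring
        rw [this]
        exact add_mem (mul_mem ⟨u, rfl⟩ hx) (mul_mem ⟨t, rfl⟩ hy)
      | smul c x hx' hx =>
        clear hx
        induction hx' using Submodule.span_induction generalizing c with
        | mem x hx =>
          obtain ⟨r, hr, rfl⟩ := hx
          obtain ⟨t, ht, h⟩ := hN r hr c
          refine ⟨t, ht, ?_⟩
          rw [map_mul, mul_assoc] at h
          rw [smul_eq_mul, mul_comm c]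
          exact h
        | zero => exact ⟨1, p.one_notMem, 0, by simp⟩
        | add x y _ _ hx hy =>
          obtain ⟨t, ht, hx⟩ := hx c
          obtain ⟨u, hu, hy⟩ := hy c
          refine ⟨t * u, (mul_mem ht hu : t * u ∈ p.primeCompl), ?_⟩
          have : algebraMap A B (t * u) * (c • (x + y)) =
              algebraMap A B u * (algebraMap A B t * (c • x)) +
              algebraMap A B t * (algebraMap A B u * (c • y)) := by
            rw [map_mul, smul_add]; ring
          rw [this]
          exact add_mem (mul_mem ⟨u, rfl⟩ hx) (mul_mem ⟨t, rfl⟩ hy)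
        | smul d x _ hx =>
          rw [smul_smul]
          exact hx _
    obtain ⟨u, hu, hmem'⟩ := hloc _ hmem
    refine ⟨u * t, (mul_mem hu ht : u * t ∈ p.primeCompl), ?_⟩
    have : algebraMap A B (u * t) * b = algebraMap A B u * (algebraMap A B t *
        (b - algebraMap A B a)) + algebraMap A B (u * t * a) := by
      simp only [map_mul]; ring
    rw [this]
    exact add_mem hmem' ⟨_, rfl⟩
  choose! k₀ hk₀ using hex
  obtain ⟨K, hK⟩ := ((associatedPrimes.finite A (ExtensionQuotient A B)).image k₀).bddAbove
  exact ⟨K, fun k hk b hb ↦ mem_range_of_forall_associatedPrimes fun p hp ↦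
    hk₀ p hp k ((hK ⟨p, hp, rfl⟩).trans hk) b hb⟩

/-- Suppose that, for every associated prime of `B / A`, all primes over it lie in the zero locus of
one of two ideals of `B`. If both zero loci contain a point over `m`, they have a common point
over `m`: otherwise some `s ∉ m` is a sum of elements of high powers of the two ideals, and these
summands belong to `A`. -/
lemma not_exists_primes_of_comaximal [IsNoetherianRing A] [Module.Finite A B]
    (hAB : IsBirationalExtension A B) (hA : HasRegularPairs A) (J₁ J₂ : Ideal B)
    (hJ : ∀ p ∈ associatedPrimes A (ExtensionQuotient A B),
      (∀ Q : Ideal B, Q.IsPrime → Q.comap (algebraMap A B) = p → J₁ ≤ Q) ∨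
      (∀ Q : Ideal B, Q.IsPrime → Q.comap (algebraMap A B) = p → J₂ ≤ Q))
    (m : Ideal A) [m.IsPrime]
    (h₁ : ∃ Q : Ideal B, Q.IsPrime ∧ Q.comap (algebraMap A B) = m ∧ J₁ ≤ Q)
    (h₂ : ∃ Q : Ideal B, Q.IsPrime ∧ Q.comap (algebraMap A B) = m ∧ J₂ ≤ Q) :
    ∃ Q : Ideal B, Q.IsPrime ∧ Q.comap (algebraMap A B) = m ∧ J₁ ≤ Q ∧ J₂ ≤ Q := by
  by_contra hne
  obtain ⟨k₀, hk₀⟩ := exists_forall_mem_range_of_congruent hAB hA ![J₁, J₂] fun p hp ↦ by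
    rcases hJ p hp with h | h
    · exact ⟨0, h⟩
    · exact ⟨1, h⟩
  set k := k₀ + 1
  have hk := hk₀ k (by omega)
  -- some `s ∉ m` is a sum of elements of `J₁ ^ k` and `J₂ ^ k`
  have hd : ¬ Disjoint ((J₁ ^ k ⊔ J₂ ^ k : Ideal B) : Set B)
      (m.primeCompl.map (algebraMap A B)) := by
    intro hd
    obtain ⟨Q, hQ, hIQ, hQT⟩ := Ideal.exists_le_prime_disjoint _ _ hd
    have hQm : Q.comap (algebraMap A B) ≤ m := by
      intro a ha
      by_contra ham
      exact Set.disjoint_left.mp hQT ha ⟨a, ham, rfl⟩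
    obtain ⟨Q', hQ'1, hQ'2, hQ'3⟩ := Ideal.exists_ideal_over_prime_of_isIntegral m Q hQm
    refine hne ⟨Q', hQ'2, hQ'3, ?_, ?_⟩
    · exact (hQ.le_of_pow_le (le_sup_left.trans hIQ)).trans hQ'1
    · exact (hQ.le_of_pow_le (le_sup_right.trans hIQ)).trans hQ'1
  rw [Set.not_disjoint_iff] at hd
  obtain ⟨_, hs, s, hsm, rfl⟩ := hd
  obtain ⟨e₁, he₁, e₂, he₂, he⟩ := Submodule.mem_sup.mp hs
  obtain ⟨c, hc⟩ := hk e₁ fun i ↦ by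
    fin_cases i
    · exact ⟨0, fun p _ Q hQ _ ↦ ⟨1, hQ.one_notMem, by simpa using he₁⟩⟩
    · refine ⟨s, fun p _ Q hQ _ ↦ ⟨1, hQ.one_notMem, ?_⟩⟩
      rw [← he, one_mul, sub_add_cancel_left]
      exact (Ideal.neg_mem_iff _).mpr he₂
  obtain ⟨Q₁, hQ₁, hQ₁m, hJQ₁⟩ := h₁
  obtain ⟨Q₂, hQ₂, hQ₂m, hJQ₂⟩ := h₂
  have hcm : c ∈ m := by
    rw [← hQ₁m, Ideal.mem_comap, hc]
    exact hJQ₁ (Ideal.pow_le_self (by omega) he₁)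
  have hcm' : s - c ∈ m := by
    rw [← hQ₂m, Ideal.mem_comap, map_sub, hc, ← he, add_sub_cancel_left]
    exact hJQ₂ (Ideal.pow_le_self (by omega) he₂)
  exact hsm (by simpa using m.add_mem hcm' hcm)

end

end DivGluing

/-! ### Descent of idempotents after a flat base change -/

namespace DivGluing

open TensorProduct

section

/-- Idempotents descend along an integral ring map when every fibre lies in one of the two pieces:
if `K₁` and `K₂` are comaximal ideals such that each fibre of `Spec S ⟶ Spec R` is contained in the
zero locus of one of them, there is an element of `R` whose image in `S` agrees with all elements
`e` that are highly divisible by `K₁` and congruent to `1` modulo a high power of `K₂`. -/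
lemma exists_forall_mem_range_of_fibers {R S : Type*} [CommRing R] [CommRing S] [Algebra R S]
    [Algebra.IsIntegral R S] (K₁ K₂ : Ideal S) (hK₁ : K₁.FG) (hK₂ : K₂.FG) (hK : K₁ ⊔ K₂ = ⊤)
    (h : ∀ P : Ideal R, P.IsPrime →
      (∀ Q : Ideal S, Q.IsPrime → Q.comap (algebraMap R S) = P → K₁ ≤ Q) ∨
      (∀ Q : Ideal S, Q.IsPrime → Q.comap (algebraMap R S) = P → K₂ ≤ Q)) :
    ∃ N : ℕ, ∀ k, N ≤ k → ∀ e ∈ K₁ ^ k, 1 - e ∈ K₂ ^ k → e ∈ (algebraMap R S).range := by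
  have hcases : ∀ Q : PrimeSpectrum S, K₁ ≤ Q.asIdeal ∨ K₂ ≤ Q.asIdeal := fun Q ↦
    (h _ (Q.2.comap (algebraMap R S))).imp (fun h ↦ h _ Q.2 rfl) (fun h ↦ h _ Q.2 rfl)
  have hnot : ∀ Q : PrimeSpectrum S, K₁ ≤ Q.asIdeal → K₂ ≤ Q.asIdeal → False := fun Q h₁ h₂ ↦
    Q.2.ne_top (top_le_iff.mp (hK ▸ sup_le h₁ h₂))
  have hnil : K₁ * K₂ ≤ (⊥ : Ideal S).radical := by
    rw [show (⊥ : Ideal S).radical = nilradical S from rfl, nilradical_eq_sInf]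
    refine le_sInf fun Q hQ ↦ ?_
    rcases hcases ⟨Q, hQ⟩ with h | h
    · exact Ideal.mul_le_left.trans h
    · exact Ideal.mul_le_right.trans h
  obtain ⟨N, hN⟩ := Ideal.exists_pow_le_of_le_radical_of_fg hnil (hK₁.mul hK₂)
  -- replace `R` by its image in `S`
  let R' := (algebraMap R S).range
  have hint : Algebra.IsIntegral R' S :=
    ⟨fun x ↦ by
      obtain ⟨f, hf, hfx⟩ := Algebra.IsIntegral.isIntegral (R := R) x
      exact ⟨f.map (algebraMap R S).rangeRestrict, hf.map _,
        by rw [Polynomial.eval₂_map]; exact hfx⟩⟩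
  let φ := PrimeSpectrum.comap (algebraMap R' S)
  have hsurj : Function.Surjective φ :=
    have : FaithfulSMul R' S := (faithfulSMul_iff_algebraMap_injective R' S).mpr
      Subtype.val_injective
    Algebra.IsIntegral.comap_surjective R' S
  have hclosed : IsClosedMap φ := PrimeSpectrum.isClosedMap_comap_of_isIntegral _
    (algebraMap_isIntegral_iff.mpr hint)
  have hR' : ∀ Q Q' : PrimeSpectrum S, φ Q = φ Q' →
      Q.asIdeal.comap (algebraMap R S) = Q'.asIdeal.comap (algebraMap R S) := fun Q Q' he ↦ by
    ext r
    have := congrArg (fun P : PrimeSpectrum R' ↦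
      (⟨algebraMap R S r, r, rfl⟩ : R') ∈ P.asIdeal) he
    exact this.to_iff
  have hfib : ∀ Q Q' : PrimeSpectrum S, φ Q = φ Q' → (K₁ ≤ Q.asIdeal ↔ K₁ ≤ Q'.asIdeal) := by
    intro Q Q' he
    rcases h _ (Q.2.comap (algebraMap R S)) with h | h
    · exact ⟨fun _ ↦ h _ Q'.2 (hR' Q Q' he).symm, fun _ ↦ h _ Q.2 rfl⟩
    · exact ⟨fun h₁ ↦ (hnot Q h₁ (h _ Q.2 rfl)).elim,
        fun h₁ ↦ (hnot Q' h₁ (h _ Q'.2 (hR' Q Q' he).symm)).elim⟩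
  -- the image of the zero locus of `K₂` is open and closed
  let Z : Set (PrimeSpectrum R') := φ '' PrimeSpectrum.zeroLocus (K₂ : Set S)
  have hZ : IsClopen Z := by
    refine ⟨hclosed _ (PrimeSpectrum.isClosed_zeroLocus _), ?_⟩
    have : Zᶜ = φ '' PrimeSpectrum.zeroLocus (K₁ : Set S) := by
      ext P
      constructor
      · intro hP
        obtain ⟨Q, rfl⟩ := hsurj P
        exact ⟨Q, (hcases Q).resolve_right fun h ↦ hP ⟨Q, h, rfl⟩, rfl⟩
      · rintro ⟨Q, hQ, rfl⟩ ⟨Q', hQ', he⟩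
        exact hnot Q' ((hfib Q' Q he).mpr hQ) hQ'
    rw [← isClosed_compl_iff, this]
    exact hclosed _ (PrimeSpectrum.isClosed_zeroLocus _)
  obtain ⟨δ, hδ, hδZ⟩ := PrimeSpectrum.exists_idempotent_basicOpen_eq_of_isClopen hZ
  refine ⟨N, fun k hk e he₁ he₂ ↦ ?_⟩
  rcases Nat.eq_zero_or_pos k with rfl | hkpos
  · -- here `K₁ * K₂` has vanishing zeroth power, so `S` is trivial
    have : (1 : S) ∈ (⊥ : Ideal S) := hN (by simp [Nat.le_zero.mp hk])
    have h10 : (1 : S) = 0 := this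
    exact ⟨0, by rw [map_zero, ← mul_one e, h10, mul_zero]⟩
  have hidem : IsIdempotentElem e := by
    have : e * (1 - e) ∈ (⊥ : Ideal S) := by
      refine hN (Ideal.pow_le_pow_right hk ?_)
      rw [mul_pow]
      exact Ideal.mul_mem_mul he₁ he₂
    have h0 : e * (1 - e) = 0 := this
    exact (sub_eq_zero.mp (by rw [← h0]; ring : e - e * e = 0)).symm
  have hbasic : ∀ Q : PrimeSpectrum S, e ∉ Q.asIdeal ↔ K₂ ≤ Q.asIdeal := by
    intro Q
    constructor
    · intro heQ
      refine (hcases Q).resolve_left fun h₁ ↦ heQ (h₁ (Ideal.pow_le_self hkpos.ne' he₁))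
    · intro h₂ heQ
      refine Q.2.one_notMem ?_
      have := Q.asIdeal.add_mem (h₂ (Ideal.pow_le_self hkpos.ne' he₂)) heQ
      simpa using this
  have heq : e = algebraMap R' S δ := by
    refine PrimeSpectrum.basicOpen_injOn_isIdempotentElem hidem (hδ.map _) ?_
    ext Q
    change e ∉ Q.asIdeal ↔ algebraMap R' S δ ∉ Q.asIdeal
    have : algebraMap R' S δ ∉ Q.asIdeal ↔ φ Q ∈ Z := by
      rw [hδZ]; rfl
    rw [hbasic, this]
    constructor
    · exact fun h ↦ ⟨Q, h, rfl⟩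
    · rintro ⟨Q', hQ', he⟩
      exact (hcases Q).resolve_left fun h₁ ↦ hnot Q' ((hfib Q' Q he).mpr h₁) hQ'
  rw [heq]
  exact δ.2

end

section

universe u v
variable {A : Type u} {B : Type v} [CommRing A] [CommRing B] [Algebra A B]

/-- The `p`-primary thickening `A_p / p ^ N A_p` of the point `p` of `Spec A`. -/
abbrev Thickening (p : Ideal A) [p.IsPrime] (N : ℕ) : Type u :=
  Localization.AtPrime p ⧸ (p ^ N).map (algebraMap A (Localization.AtPrime p))

/-- If `p ^ N` kills `M` locally at `p`, then an element of `M` that vanishes on the thickening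
`A_p / p ^ N A_p` vanishes locally at `p`. -/
lemma exists_smul_eq_zero_of_tmul_thickening_eq_zero {M : Type*} [AddCommGroup M] [Module A M]
    (p : Ideal A) [p.IsPrime] (N : ℕ) (hN : ∀ r ∈ p ^ N, ∀ m : M, ∃ t ∉ p, t • r • m = 0) (x : M)
    (hx : (1 : Thickening p N) ⊗ₜ[A] x = 0) : ∃ t ∉ p, t • x = 0 := by
  set L := Localization.AtPrime p
  set I := (p ^ N).map (algebraMap A L)
  -- exactness of `I ⊗ M ⟶ L ⊗ M ⟶ L / I ⊗ M`
  let i : I →ₗ[A] L := I.subtype.restrictScalars A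
  let π : L →ₗ[A] L ⧸ I := (Ideal.Quotient.mkₐ A I).toLinearMap
  have hex : Function.Exact i π := by
    intro y
    change Ideal.Quotient.mk I y = 0 ↔ _
    rw [Ideal.Quotient.eq_zero_iff_mem]
    exact ⟨fun h ↦ ⟨⟨y, h⟩, rfl⟩, by rintro ⟨y, rfl⟩; exact y.2⟩
  have hexM := rTensor_exact M hex Ideal.Quotient.mk_surjective
  have h1 : π.rTensor M ((1 : L) ⊗ₜ x) = 0 := by
    rw [LinearMap.rTensor_tmul]
    exact hx
  obtain ⟨z, hz⟩ := (hexM _).mp h1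
  -- every element of `I ⊗ M` maps to zero in `L ⊗ M`
  have hI : ∀ y ∈ I, ∀ m : M, y ⊗ₜ[A] m = 0 := by
    intro y hy m
    induction hy using Submodule.span_induction generalizing m with
    | mem y hy =>
      obtain ⟨r, hr, rfl⟩ := hy
      obtain ⟨t, ht, h⟩ := hN r hr m
      rw [Algebra.algebraMap_eq_smul_one, TensorProduct.smul_tmul]
      obtain ⟨u, hu⟩ := (IsLocalization.map_units L (⟨t, ht⟩ : p.primeCompl)).exists_right_inv
      rw [← hu]
      change (algebraMap A L t * u) ⊗ₜ _ = _
      rw [← Algebra.smul_def, TensorProduct.smul_tmul, h, TensorProduct.tmul_zero]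
    | zero => exact TensorProduct.zero_tmul _ _
    | add y y' _ _ h h' => rw [TensorProduct.add_tmul, h, h', add_zero]
    | smul c y _ h =>
      have := congrArg (LinearMap.rTensor M ((LinearMap.mul A L) c)) (h m)
      simpa using this
  have hz0 : ∀ z, i.rTensor M z = 0 := by
    intro z
    induction z using TensorProduct.induction_on with
    | zero => simp
    | tmul y m => exact hI y y.2 m
    | add z z' h h' =>
      rw [map_add, h, h', add_zero]
  rw [hz0 z] at hz
  have := (IsLocalizedModule.eq_zero_iff p.primeCompl (TensorProduct.mk A L M 1)).mp hz.symm
  obtain ⟨t, ht⟩ := this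
  exact ⟨t, t.2, ht⟩

/-- A finite birational extension `A ⊆ B` of a ring satisfying `S2` is detected on an `A`-algebra
`A'` all of whose primes lie over associated primes of `B / A`: the product of sufficiently large
thickenings of these primes. -/
lemma exists_detecting_algebra [IsNoetherianRing A] [Module.Finite A B]
    (hAB : IsBirationalExtension A B) (hA : HasRegularPairs A) :
    ∃ (A' : Type u) (_ : CommRing A') (_ : Algebra A A'),
      (∀ x : ExtensionQuotient A B, (1 : A') ⊗ₜ[A] x = 0 → x = 0) ∧
      ∀ P : Ideal A', P.IsPrime →
        P.comap (algebraMap A A') ∈ associatedPrimes A (ExtensionQuotient A B) := by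
  classical
  have hfin := associatedPrimes.finite A (ExtensionQuotient A B)
  have := hfin.fintype
  have hprime (p : associatedPrimes A (ExtensionQuotient A B)) : p.1.IsPrime := p.2.1
  have hp (p : associatedPrimes A (ExtensionQuotient A B)) : p.1.height = 1 :=
    height_eq_one_of_mem_associatedPrimes hAB hA p.2
  choose N hN using fun p : associatedPrimes A (ExtensionQuotient A B) ↦
    exists_pow_mul_mem_range hAB (hp p)
  let A' := ∀ p : associatedPrimes A (ExtensionQuotient A B), Thickening p.1 (N p)
  refine ⟨A', inferInstance, inferInstance, fun x hx ↦ ?_, fun P hP ↦ ?_⟩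
  · by_contra hx0
    obtain ⟨p, hpa, hle⟩ := exists_le_isAssociatedPrime_of_isNoetherianRing A x hx0
    have := hpa.1
    have hx' : (1 : Thickening p (N ⟨p, hpa⟩)) ⊗ₜ[A] x = 0 := by
      have := congrArg (LinearMap.rTensor (ExtensionQuotient A B)
        (LinearMap.proj (R := A) (φ := fun p : associatedPrimes A (ExtensionQuotient A B) ↦
          Thickening p.1 (N p)) ⟨p, hpa⟩)) hx
      rw [LinearMap.rTensor_tmul, map_zero] at this
      exact this
    obtain ⟨t, ht, htx⟩ := exists_smul_eq_zero_of_tmul_thickening_eq_zero p (N ⟨p, hpa⟩) (by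
      intro r hr m
      obtain ⟨b, rfl⟩ := Submodule.Quotient.mk_surjective _ m
      obtain ⟨t, ht, h⟩ := hN ⟨p, hpa⟩ r hr b
      refine ⟨t, ht, ?_⟩
      rw [smul_smul]
      exact smul_mk_extensionQuotient_eq_zero.mpr h) x hx'
    refine ht (hle ?_)
    rw [Submodule.mem_colon_singleton, Submodule.mem_bot]
    exact htx
  · -- some component idempotent is not in `P`
    obtain ⟨p, hpP⟩ : ∃ p, (Pi.single p 1 : A') ∉ P := by
      by_contra! h
      refine hP.one_notMem ?_
      have : (1 : A') = ∑ p, Pi.single p 1 := by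
        rw [Finset.univ_sum_single]; rfl
      rw [this]
      exact sum_mem fun p _ ↦ h p
    have : P.comap (algebraMap A A') = p.1 := by
      ext r
      rw [Ideal.mem_comap]
      constructor
      · intro hr
        by_contra hrp
        obtain ⟨u, hu⟩ := (IsLocalization.map_units (Localization.AtPrime p.1)
          (⟨r, hrp⟩ : p.1.primeCompl)).exists_right_inv
        have : (Pi.single p 1 : A') = algebraMap A A' r * Pi.single p (Ideal.Quotient.mk _ u) := by
          rw [← Pi.single_mul_right]
          congr 1
          exact (congrArg (Ideal.Quotient.mk _) hu).symm
        rw [this] at hpP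
        exact hpP (P.mul_mem_right _ hr)
      · intro hr
        refine hP.mem_of_pow_mem (N p) ((hP.mem_or_mem (y := Pi.single p 1) ?_).resolve_right hpP)
        convert P.zero_mem
        rw [← Pi.single_mul_right, mul_one]
        convert Pi.single_zero p
        change Ideal.Quotient.mk _ (algebraMap A (Localization.AtPrime p.1) r) ^ (N p) = 0
        rw [← map_pow, ← map_pow, Ideal.Quotient.eq_zero_iff_mem]
        exact Ideal.mem_map_of_mem _ (Ideal.pow_mem_pow hr _)
    rw [this]
    exact p.2

/-- Descent along a flat base change `A ⟶ C`. Let `K₁` and `K₂` be comaximal ideals of `C ⊗ B` such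
that each fibre of `Spec (C ⊗ B) ⟶ Spec C` over a point mapping to an associated prime of `B / A`
lies in the zero locus of one of them. Then an element of `C` vanishes on the zero locus of `K₁` and
is equal to one on the zero locus of `K₂`. -/
lemma exists_algebraMap_mem_of_fibers [IsNoetherianRing A] [Module.Finite A B]
    (hAB : IsBirationalExtension A B) (hA : HasRegularPairs A) {C : Type*} [CommRing C]
    [Algebra A C] [Module.Flat A C] [IsNoetherianRing C] (K₁ K₂ : Ideal (C ⊗[A] B))
    (hK : K₁ ⊔ K₂ = ⊤)
    (h : ∀ P : Ideal C, P.IsPrime →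
      P.comap (algebraMap A C) ∈ associatedPrimes A (ExtensionQuotient A B) →
      (∀ Q : Ideal (C ⊗[A] B), Q.IsPrime → Q.comap (algebraMap C _) = P → K₁ ≤ Q) ∨
      (∀ Q : Ideal (C ⊗[A] B), Q.IsPrime → Q.comap (algebraMap C _) = P → K₂ ≤ Q)) :
    ∃ c : C, algebraMap C (C ⊗[A] B) c ∈ K₁ ∧ 1 - algebraMap C (C ⊗[A] B) c ∈ K₂ := by
  obtain ⟨A', _, _, hinj, hprimes⟩ := exists_detecting_algebra hAB hA
  have hN : IsNoetherianRing (C ⊗[A] B) := IsNoetherianRing.of_finite C _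
  let C' := C ⊗[A] A'
  let ψ : C ⊗[A] B →ₐ[C] C' ⊗[A] B :=
    Algebra.TensorProduct.map (Algebra.TensorProduct.includeLeft : C →ₐ[C] C') (AlgHom.id A B)
  have hψC (c : C) : ψ (algebraMap C _ c) = algebraMap C' _ (algebraMap C C' c) := by
    simp [ψ, Algebra.TensorProduct.algebraMap_apply]
    rfl
  obtain ⟨N, hN⟩ := exists_forall_mem_range_of_fibers (R := C') (S := C' ⊗[A] B)
    (K₁.map ψ) (K₂.map ψ) (Ideal.FG.map (IsNoetherian.noetherian K₁) _)
    (Ideal.FG.map (IsNoetherian.noetherian K₂) _)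
    (by rw [← Ideal.map_sup, hK, Ideal.map_top]) fun P hP ↦ by
      have hPA : (P.comap (algebraMap C C')).comap (algebraMap A C) ∈
          associatedPrimes A (ExtensionQuotient A B) := by
        have := hprimes _ (hP.comap (Algebra.TensorProduct.includeRight : A' →ₐ[A] C'))
        convert this using 1
        ext a
        simp only [Ideal.mem_comap]
        rw [AlgHom.commutes, ← IsScalarTower.algebraMap_apply A C C']
      have hQ (Q : Ideal (C' ⊗[A] B)) (hQ : Q.comap (algebraMap C' _) = P) :
          (Q.comap ψ).comap (algebraMap C _) = P.comap (algebraMap C C') := by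
        ext c
        simp only [Ideal.mem_comap]
        rw [hψC, ← hQ, Ideal.mem_comap]
      rcases h _ (hP.comap _) hPA with h | h
      · exact Or.inl fun Q hQ₁ hQ₂ ↦ Ideal.map_le_iff_le_comap.mpr (h _ (hQ₁.comap _) (hQ Q hQ₂))
      · exact Or.inr fun Q hQ₁ hQ₂ ↦ Ideal.map_le_iff_le_comap.mpr (h _ (hQ₁.comap _) (hQ Q hQ₂))
  obtain ⟨e, he₁, f, hf₂, hef⟩ : ∃ e ∈ K₁ ^ (N + 1), ∃ f ∈ K₂ ^ (N + 1), e + f = 1 := by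
    have : IsCoprime (K₁ ^ (N + 1)) (K₂ ^ (N + 1)) := (Ideal.isCoprime_iff_sup_eq.mpr hK).pow
    exact Ideal.isCoprime_iff_exists.mp this
  have hfe : f = 1 - e := by rw [← hef]; ring
  obtain ⟨c', hc'⟩ := hN (N + 1) (by omega) (ψ e)
    (by rw [← Ideal.map_pow]; exact Ideal.mem_map_of_mem _ he₁)
    (by
      rw [← Ideal.map_pow, ← map_one ψ, ← map_sub, ← hfe]
      exact Ideal.mem_map_of_mem _ hf₂)
  -- hence `e` vanishes in `C ⊗ B / A`
  let π : B →ₗ[A] ExtensionQuotient A B := Submodule.mkQ _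
  have hπ : Function.Exact (Algebra.linearMap A B) π := LinearMap.exact_map_mkQ_range _
  let j : C ⊗[A] ExtensionQuotient A B →ₗ[A] C' ⊗[A] ExtensionQuotient A B :=
    LinearMap.rTensor _ (TensorProduct.mk A C A' |>.flip 1)
  have hj : Function.Injective j := by
    have hinj' : Function.Injective (TensorProduct.mk A A' (ExtensionQuotient A B) 1) := by
      rw [injective_iff_map_eq_zero]
      exact hinj
    have h1 := Module.Flat.lTensor_preserves_injective_linearMap (M := C) _ hinj'
    have h2 : LinearMap.lTensor C (TensorProduct.mk A A' (ExtensionQuotient A B) 1) =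
        (TensorProduct.assoc A C A' (ExtensionQuotient A B)).toLinearMap ∘ₗ j := by
      ext c x; rfl
    rw [h2, LinearMap.coe_comp] at h1
    exact Function.Injective.of_comp h1
  have hcomm (z : C ⊗[A] B) : j (LinearMap.lTensor C π z) = LinearMap.lTensor C' π (ψ z) := by
    induction z using TensorProduct.induction_on with
    | zero => simp
    | tmul c b => rfl
    | add x y hx hy => rw [map_add, map_add, hx, hy, map_add, map_add]
  have hπ1 : π 1 = 0 := mk_extensionQuotient_eq_zero.mpr ⟨1, map_one _⟩
  have h0 : LinearMap.lTensor C π e = 0 := by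
    apply hj
    rw [hcomm, map_zero, ← hc', Algebra.TensorProduct.algebraMap_apply, LinearMap.lTensor_tmul, hπ1,
      TensorProduct.tmul_zero]
  obtain ⟨z, hz⟩ := (lTensor_exact C hπ (Submodule.mkQ_surjective _) e).mp h0
  obtain ⟨c, hc⟩ : ∃ c : C, algebraMap C (C ⊗[A] B) c = e := by
    rw [← hz]
    clear hz
    induction z using TensorProduct.induction_on with
    | zero => exact ⟨0, by simp⟩
    | tmul c a =>
      refine ⟨a • c, ?_⟩
      rw [Algebra.TensorProduct.algebraMap_apply, LinearMap.lTensor_tmul,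
        Algebra.linearMap_apply, Algebra.algebraMap_eq_smul_one a, ← TensorProduct.smul_tmul]
      rfl
    | add x y hx hy =>
      obtain ⟨c, hc⟩ := hx
      obtain ⟨d, hd⟩ := hy
      exact ⟨c + d, by rw [map_add, map_add, hc, hd]⟩
  refine ⟨c, ?_, ?_⟩
  · rw [hc]
    exact Ideal.pow_le_self (by omega) he₁
  · rw [hc, ← hfe]
    exact Ideal.pow_le_self (by omega) hf₂

end

end DivGluing

/-! ### Completions, heights and going down in fibres -/

namespace DivGluing

open TensorProduct

section Completion

/-- A ring which is complete for the adic topology of a finitely generated ideal `K` is noetherian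
as soon as every element is congruent modulo `K` to one coming from a noetherian ring: it is a
quotient of a power series ring over the latter. -/
lemma isNoetherianRing_of_isAdicComplete {R S : Type*} [CommRing R] [CommRing S] [Algebra R S]
    [IsNoetherianRing R] (K : Ideal S) [IsAdicComplete K S] (hK : K.FG)
    (h : ∀ s : S, ∃ r : R, s - algebraMap R S r ∈ K) : IsNoetherianRing S := by
  obtain ⟨m, x, hx⟩ := Submodule.fg_iff_exists_fin_generating_family.mp hK
  replace hx : Ideal.span (Set.range x) = K := hx
  let φ : MvPolynomial (Fin m) R →ₐ[R] S := MvPolynomial.aeval x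
  set J := MvPolynomial.idealOfVars (Fin m) R
  have hJ : J ≤ K.comap φ.toRingHom := by
    refine Ideal.span_le.mpr ?_
    rintro _ ⟨i, rfl⟩
    have : x i ∈ K := hx ▸ Ideal.subset_span ⟨i, rfl⟩
    simpa [φ] using this
  have hJn (n : ℕ) : J ^ n ≤ (K ^ n).comap φ.toRingHom :=
    (Ideal.pow_right_mono hJ n).trans (Ideal.le_comap_pow _ n)
  let f (n : ℕ) : MvPowerSeries (Fin m) R →+* S ⧸ K ^ n :=
    (Ideal.quotientMap (K ^ n) φ.toRingHom (hJn n)).comp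
      ((AdicCompletion.evalₐ J n).toRingHom.comp
        (MvPowerSeries.toAdicCompletion (Fin m) R).toRingHom)
  have hf {m n : ℕ} (hle : m ≤ n) : (Ideal.Quotient.factorPow K hle).comp (f n) = f m := by
    ext p
    obtain ⟨a, ha⟩ := AdicCompletion.mk_surjective J _ (MvPowerSeries.toAdicCompletion _ R p)
    change Ideal.Quotient.factorPow K hle (Ideal.quotientMap (K ^ n) φ.toRingHom (hJn n)
      (AdicCompletion.evalₐ J n (MvPowerSeries.toAdicCompletion _ R p))) =
      Ideal.quotientMap (K ^ m) φ.toRingHom (hJn m)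
      (AdicCompletion.evalₐ J m (MvPowerSeries.toAdicCompletion _ R p))
    rw [← ha, AdicCompletion.evalₐ_mk, AdicCompletion.evalₐ_mk]
    have h1 : Ideal.Quotient.mk (J ^ m) (a.1 m) = Ideal.Quotient.mk (J ^ m) (a.1 n) := by
      have := a.2 hle
      rw [SModEq.sub_mem, smul_eq_mul, Ideal.mul_top] at this
      exact Ideal.Quotient.eq.mpr this
    rw [h1]
    rfl
  let g := IsAdicComplete.liftRingHom K f hf
  have hg (p : MvPolynomial (Fin m) R) : g p = φ p := by
    refine (IsHausdorff.eq_iff_smodEq (I := K)).mpr fun n ↦ ?_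
    have h1 : Ideal.Quotient.mk (K ^ n) (g p) = f n p := IsAdicComplete.mk_liftRingHom K f hf n _
    have h2 : f n p = Ideal.Quotient.mk (K ^ n) (φ p) := by
      change Ideal.quotientMap (K ^ n) φ.toRingHom (hJn n)
        (AdicCompletion.evalₐ J n (MvPowerSeries.toAdicCompletion _ R p)) = _
      rw [MvPowerSeries.toAdicCompletion_coe, AdicCompletion.evalₐ_of]
      rfl
    rw [SModEq.sub_mem, smul_eq_mul, Ideal.mul_top]
    exact Ideal.Quotient.eq.mp (h1.trans h2)
  have hmap : (Ideal.span (Set.range MvPowerSeries.X)).map g = K := by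
    rw [Ideal.map_span, ← Set.range_comp, ← hx]
    congr 2
    ext i
    have := hg (MvPolynomial.X i)
    simpa [φ] using this
  have hH : IsHausdorff ((Ideal.span (Set.range MvPowerSeries.X)).map g) S := by
    rw [hmap]; infer_instance
  refine isNoetherianRing_of_surjective _ _ g
    (surjective_of_mk_map_comp_surjective (I := Ideal.span (Set.range MvPowerSeries.X)) g ?_)
  intro y
  obtain ⟨s, rfl⟩ := Ideal.Quotient.mk_surjective y
  obtain ⟨r, hr⟩ := h s
  refine ⟨((MvPolynomial.C r : MvPolynomial (Fin m) R) : MvPowerSeries (Fin m) R), ?_⟩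
  rw [RingHom.comp_apply, hg, Ideal.Quotient.eq, hmap]
  have : φ (MvPolynomial.C r) = algebraMap R S r := by simp [φ]
  rw [this, ← neg_mem_iff, neg_sub]
  exact hr

instance isNoetherianRing_adicCompletion (R : Type*) [CommRing R] [IsNoetherianRing R]
    (I : Ideal R) : IsNoetherianRing (AdicCompletion I R) := by
  have hI := I.fg_of_isNoetherianRing
  have := AdicCompletion.isAdicComplete_self I hI
  refine isNoetherianRing_of_isAdicComplete (R := R)
    (I.map (algebraMap R (AdicCompletion I R))) (hI.map _) fun s ↦ ?_
  obtain ⟨r, hr⟩ := Ideal.Quotient.mk_surjective (AdicCompletion.evalOneₐ I s)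
  refine ⟨r, ?_⟩
  rw [← AdicCompletion.ker_evalOneₐ_eq_map I hI, RingHom.mem_ker]
  change AdicCompletion.evalOneₐ I _ = 0
  rw [map_sub, ← hr, sub_eq_zero, AlgHom.commutes]
  rfl

end Completion

section Heights

variable {R S : Type*} [CommRing R] [CommRing S] [Algebra R S]

/-- If `Q` is minimal among the primes containing the extension of its trace `p`, its height is at
most that of `p`. -/
lemma height_le_of_forall_le [IsNoetherianRing R] [IsNoetherianRing S] (p : Ideal R) [p.IsPrime]
    (Q : Ideal S) [Q.IsPrime] (hQ : Q.comap (algebraMap R S) = p)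
    (h : ∀ Q' : Ideal S, Q'.IsPrime → p ≤ Q'.comap (algebraMap R S) → Q' ≤ Q → Q ≤ Q') :
    Q.height ≤ p.height := by
  have : Q.LiesOver p := ⟨hQ.symm⟩
  refine (Ideal.height_le_height_add_of_liesOver p Q).trans ?_
  set I := p.map (algebraMap R S)
  have hI : I ≤ Q := Ideal.map_le_iff_le_comap.mpr hQ.ge
  have hprime : (Q.map (Ideal.Quotient.mk I)).IsPrime :=
    Ideal.map_isPrime_of_surjective Ideal.Quotient.mk_surjective (by rwa [Ideal.mk_ker])
  have hcomap : (Q.map (Ideal.Quotient.mk I)).comap (Ideal.Quotient.mk I) = Q := by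
    rw [Ideal.comap_map_of_surjective' _ Ideal.Quotient.mk_surjective, Ideal.mk_ker,
      sup_eq_left.mpr hI]
  have : (Q.map (Ideal.Quotient.mk I)).height = 0 := by
    rw [Ideal.height_eq_zero_iff]
    refine ⟨⟨hprime, bot_le⟩, fun P hP hPQ ↦ ?_⟩
    have := hP.1
    rw [Ideal.map_le_iff_le_comap]
    refine h _ (this.comap _) ?_ ?_
    · rw [← Ideal.map_le_iff_le_comap]
      intro x hx
      have : Ideal.Quotient.mk I x = 0 := Ideal.Quotient.eq_zero_iff_mem.mpr hx
      rw [Ideal.mem_comap, this]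
      exact zero_mem _
    · exact (Ideal.comap_mono hPQ).trans hcomap.le
  rw [this, add_zero]

/-- Heights do not increase along integral extensions of noetherian rings. -/
lemma height_le_height_comap [IsNoetherianRing R] [IsNoetherianRing S] [Algebra.IsIntegral R S]
    (Q : Ideal S) [Q.IsPrime] : Q.height ≤ (Q.comap (algebraMap R S)).height := by
  refine height_le_of_forall_le _ Q rfl fun Q' hQ' hle hQQ' ↦ ?_
  by_contra hnot
  have := Ideal.IsIntegral.comap_lt_comap (R := R) (hQQ'.lt_of_not_ge hnot)
  exact this.not_ge hle

/-- Going down inside a fibre: for an algebra `B` over `A` and any algebra `C`, a specialisation of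
primes of `C` lying over the same prime of `A` lifts to `C ⊗ B`, because the fibre of `C ⊗ B` is
flat over the fibre of `C`. -/
lemma exists_le_comap_eq_of_comap_eq {A B C : Type*} [CommRing A] [CommRing B] [CommRing C]
    [Algebra A B] [Algebra A C] (P₀ P : Ideal C) [P₀.IsPrime] [P.IsPrime] (hle : P₀ ≤ P)
    (hP : P₀.comap (algebraMap A C) = P.comap (algebraMap A C))
    (Q : Ideal (C ⊗[A] B)) [Q.IsPrime] (hQ : Q.comap (algebraMap C (C ⊗[A] B)) = P) :
    ∃ Q₀ ≤ Q, Q₀.IsPrime ∧ Q₀.comap (algebraMap C (C ⊗[A] B)) = P₀ := by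
  set p := P.comap (algebraMap A C) with hp
  have hpp : p.IsPrime := inferInstance
  let T := p.ResidueField
  -- primes of `T ⊗ C` are the primes of `C` over `p`
  let e := PrimeSpectrum.preimageOrderIsoFiber A C ⟨p, hpp⟩
  let a₀ : PrimeSpectrum.comap (algebraMap A C) ⁻¹' {⟨p, hpp⟩} :=
    ⟨⟨P₀, ‹_›⟩, PrimeSpectrum.ext (by simpa using hP)⟩
  let a₁ : PrimeSpectrum.comap (algebraMap A C) ⁻¹' {⟨p, hpp⟩} :=
    ⟨⟨P, ‹_›⟩, PrimeSpectrum.ext (by simp [hp])⟩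
  have he₀ : (e a₀).asIdeal.comap (Algebra.TensorProduct.includeRight : C →ₐ[A] T ⊗[A] C) = P₀ :=
    congrArg (fun z ↦ z.1.asIdeal) (e.symm_apply_apply a₀)
  have he₁ : (e a₁).asIdeal.comap (Algebra.TensorProduct.includeRight : C →ₐ[A] T ⊗[A] C) = P :=
    congrArg (fun z ↦ z.1.asIdeal) (e.symm_apply_apply a₁)
  have hea : (e a₀).asIdeal ≤ (e a₁).asIdeal := e.monotone (show a₀ ≤ a₁ from hle)
  let E := (T ⊗[A] C) ⊗[T] (T ⊗[A] B)
  -- the residue map of `Q` factors through the canonical map to `E`, so `Q` lifts to a prime of `E`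
  let κ := Q.ResidueField
  let q : (C ⊗[A] B) →ₐ[A] κ := IsScalarTower.toAlgHom A (C ⊗[A] B) κ
  have hq (x) : q x = 0 ↔ x ∈ Q := Ideal.algebraMap_residueField_eq_zero
  have hQp (x : A) : algebraMap A (C ⊗[A] B) x ∈ Q ↔ x ∈ p := by
    rw [hp, ← hQ]; rfl
  let τ : T →ₐ[A] κ := Ideal.ResidueField.liftₐ p (Algebra.ofId A κ)
    (fun x hx ↦ by
      rw [RingHom.mem_ker]
      exact (q.commutes x).symm.trans ((hq _).mpr ((hQp x).mpr hx)))
    (fun x hx ↦ by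
      refine IsUnit.mk0 _ fun h0 ↦ hx ((hQp x).mp ((hq _).mp ((q.commutes x).trans h0))))
  let _ : Algebra T κ := τ.toRingHom.toAlgebra
  have : IsScalarTower A T κ := IsScalarTower.of_algebraMap_eq fun x ↦ (τ.commutes x).symm
  have hρ : ∃ ρ : E →ₐ[T] κ, ∀ c b,
      ρ (((1 : T) ⊗ₜ[A] c) ⊗ₜ[T] ((1 : T) ⊗ₜ[A] b)) = q (c ⊗ₜ b) := by
    refine ⟨Algebra.TensorProduct.lift
      (Algebra.TensorProduct.lift (Algebra.ofId T κ)
        (q.comp Algebra.TensorProduct.includeLeft) fun _ _ ↦ Commute.all _ _)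
      (Algebra.TensorProduct.lift (Algebra.ofId T κ)
        (q.comp Algebra.TensorProduct.includeRight) fun _ _ ↦ Commute.all _ _)
      fun _ _ ↦ Commute.all _ _, fun c b ↦ ?_⟩
    rw [Algebra.TensorProduct.lift_tmul, Algebra.TensorProduct.lift_tmul,
      Algebra.TensorProduct.lift_tmul, map_one, one_mul, one_mul, AlgHom.comp_apply,
      AlgHom.comp_apply, ← map_mul]
    simp
  have hφ : ∃ φ : (C ⊗[A] B) →ₐ[A] E, ∀ c b,
      φ (c ⊗ₜ b) = ((1 : T) ⊗ₜ[A] c) ⊗ₜ[T] ((1 : T) ⊗ₜ[A] b) := by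
    refine ⟨Algebra.TensorProduct.lift
      (((Algebra.TensorProduct.includeLeft : T ⊗[A] C →ₐ[T] E).restrictScalars A).comp
        Algebra.TensorProduct.includeRight)
      (((Algebra.TensorProduct.includeRight : T ⊗[A] B →ₐ[T] E).restrictScalars A).comp
        Algebra.TensorProduct.includeRight) fun _ _ ↦ Commute.all _ _, fun c b ↦ ?_⟩
    rw [Algebra.TensorProduct.lift_tmul, AlgHom.comp_apply, AlgHom.comp_apply]
    refine (Algebra.TensorProduct.tmul_mul_tmul (R := T) (A := T ⊗[A] C) (B := T ⊗[A] B)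
      _ _ _ _).trans ?_
    rw [mul_one, one_mul]
    rfl
  obtain ⟨ρ, hρ⟩ := hρ
  obtain ⟨φ, hφ⟩ := hφ
  have hρφ (x) : ρ (φ x) = q x := by
    induction x with
    | zero => simp only [map_zero]
    | add x y hx hy => simp only [map_add, hx, hy]
    | tmul c b => rw [hφ, hρ]
  have hφC (c : C) : φ (algebraMap C _ c) = algebraMap (T ⊗[A] C) E (1 ⊗ₜ c) :=
    hφ c 1
  let QE : Ideal E := RingHom.ker ρ
  have hQE : QE.IsPrime := RingHom.ker_isPrime _
  have hQE' : QE.comap φ = Q := by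
    ext x
    rw [Ideal.mem_comap, RingHom.mem_ker, ← hq x, ← hρφ]
  have hQC : QE.comap (algebraMap (T ⊗[A] C) E) = (e a₁).asIdeal := by
    have h1 : e.symm ⟨QE.comap (algebraMap (T ⊗[A] C) E), inferInstance⟩ = a₁ := by
      refine Subtype.ext (PrimeSpectrum.ext ?_)
      change (QE.comap (algebraMap (T ⊗[A] C) E)).comap
        (Algebra.TensorProduct.includeRight : C →ₐ[A] T ⊗[A] C) = P
      rw [← hQ, ← hQE']
      ext c
      simp only [Ideal.mem_comap]
      rw [hφC]
      rfl
    rw [← h1, e.apply_symm_apply]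
  have : QE.LiesOver (e a₁).asIdeal := ⟨hQC.symm⟩
  have : Algebra.HasGoingDown (T ⊗[A] C) E := inferInstance
  obtain ⟨Q₀, hQ₀, hQ₀p, hQ₀'⟩ := Ideal.exists_ideal_le_liesOver_of_le QE hea
  refine ⟨Q₀.comap φ, (Ideal.comap_mono hQ₀).trans hQE'.le, inferInstance, ?_⟩
  rw [← he₀, hQ₀'.over]
  ext c
  simp only [Ideal.mem_comap]
  rw [hφC]
  rfl

end Heights

end DivGluing

/-! ### Branches: the algebraic statement -/

namespace DivGluing

open TensorProduct nonZeroDivisors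

section Branches

universe u

variable {A B : Type u} [CommRing A] [CommRing B] [Algebra A B]
  {C : Type*} [CommRing C] [Algebra A C]

/-- The generic points of the branches of `F` lie over generic points of `F`, by going down. -/
lemma height_comap_eq_one_of_mem_minimalPrimes_map [Module.Flat A C] {F : Ideal A}
    (hF : ∀ p ∈ F.minimalPrimes, p.height = 1) {P : Ideal C}
    (hP : P ∈ (F.map (algebraMap A C)).minimalPrimes) :
    (P.comap (algebraMap A C)).height = 1 := by
  have := hP.1.1
  obtain ⟨p, hp, hpP⟩ := Ideal.exists_minimalPrimes_le (Ideal.map_le_iff_le_comap.mp hP.1.2)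
  have := hp.1.1
  have : P.LiesOver (P.comap (algebraMap A C)) := ⟨rfl⟩
  obtain ⟨P', hle, hP', hP'p⟩ := Ideal.exists_ideal_le_liesOver_of_le P hpP
  have hFP' : F.map (algebraMap A C) ≤ P' := by
    rw [Ideal.map_le_iff_le_comap]
    exact hp.1.2.trans hP'p.over.le
  have : P = P' := le_antisymm (hP.2 ⟨hP', hFP'⟩ hle) hle
  rw [this]
  exact (congrArg Ideal.height hP'p.over).symm.trans (hF p hp)

variable [IsNoetherianRing A] [IsReduced A] [Module.Finite A B] [Module.Flat A C]
  [IsNoetherianRing C]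

/-- Over the generic points of the branches, all points of `C ⊗ B` have codimension one. -/
lemma height_eq_one_of_comap_mem_minimalPrimes_map (hAB : IsBirationalExtension A B) {F : Ideal A}
    (hF : ∀ p ∈ F.minimalPrimes, p.height = 1) {P : Ideal C}
    (hP : P ∈ (F.map (algebraMap A C)).minimalPrimes) (Q : Ideal (C ⊗[A] B)) [Q.IsPrime]
    (hQ : Q.comap (algebraMap C (C ⊗[A] B)) = P) : Q.height = 1 := by
  have := hP.1.1
  have hp := height_comap_eq_one_of_mem_minimalPrimes_map hF hP
  set p := P.comap (algebraMap A C) with hpdef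
  have : IsNoetherianRing (C ⊗[A] B) := IsNoetherianRing.of_finite C _
  refine le_antisymm ?_ ?_
  · refine (height_le_height_comap (R := C) Q).trans ?_
    rw [hQ, ← hp]
    refine height_le_of_forall_le p P rfl fun P' hP' hpP' hle ↦ hP.2 ⟨hP', ?_⟩ hle
    rw [Ideal.map_le_iff_le_comap]
    exact (Ideal.map_le_iff_le_comap.mp hP.1.2).trans hpP'
  · obtain ⟨s, hs, hsp⟩ := exists_mem_nonZeroDivisors_of_one_le_height hp.ge
    have hsB := hAB.map_mem_nonZeroDivisors s hs
    have hinj : Function.Injective (LinearMap.lsmul A B s) := by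
      rw [injective_iff_map_eq_zero]
      intro b hb
      rw [LinearMap.lsmul_apply, Algebra.smul_def] at hb
      exact (mem_nonZeroDivisors_iff.mp hsB).1 b hb
    have hinj' := Module.Flat.lTensor_preserves_injective_linearMap (M := C) _ hinj
    have hlin : (LinearMap.lsmul A B s).lTensor C = LinearMap.lsmul A (C ⊗[A] B) s := by
      ext c b; simp
    rw [hlin] at hinj'
    have hsC : algebraMap A (C ⊗[A] B) s ∈ (C ⊗[A] B)⁰ := by
      rw [mem_nonZeroDivisors_iff_right]
      intro x hx
      refine (injective_iff_map_eq_zero _).mp hinj' x ?_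
      rw [LinearMap.lsmul_apply, Algebra.smul_def, mul_comm, hx]
    refine one_le_height_of_mem_nonZeroDivisors hsC ?_
    rw [IsScalarTower.algebraMap_apply A C (C ⊗[A] B)]
    change s ∈ (Q.comap (algebraMap C (C ⊗[A] B))).comap (algebraMap A C)
    rwa [hQ]

/-- The minimal primes of the extension of `F` to a local flat algebra cannot be separated by the
codimension one points of `C ⊗ B` lying over them. -/
lemma false_of_separated_minimalPrimes (hAB : IsBirationalExtension A B) (hA : HasRegularPairs A)
    [IsLocalRing C] {F : Ideal A} (hF : ∀ p ∈ F.minimalPrimes, p.height = 1)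
    (hFA : ∀ p ∈ associatedPrimes A (ExtensionQuotient A B), F ≤ p)
    (I₁ I₂ : Set (Ideal C)) (h₁ : I₁.Nonempty) (h₂ : I₂.Nonempty)
    (hI : I₁ ∪ I₂ = (F.map (algebraMap A C)).minimalPrimes)
    (K₁ K₂ : Ideal (C ⊗[A] B)) (hK : K₁ ⊔ K₂ = ⊤)
    (hK₁ : ∀ P ∈ I₁, ∀ Q : Ideal (C ⊗[A] B), Q.IsPrime → Q.height = 1 →
      P ≤ Q.comap (algebraMap C (C ⊗[A] B)) → K₁ ≤ Q)
    (hK₂ : ∀ P ∈ I₂, ∀ Q : Ideal (C ⊗[A] B), Q.IsPrime → Q.height = 1 →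
      P ≤ Q.comap (algebraMap C (C ⊗[A] B)) → K₂ ≤ Q) : False := by
  have hle₁ : I₁ ⊆ (F.map (algebraMap A C)).minimalPrimes := hI ▸ Set.subset_union_left
  have hle₂ : I₂ ⊆ (F.map (algebraMap A C)).minimalPrimes := hI ▸ Set.subset_union_right
  -- the fibre over a prime `P` is controlled by the generic point of any branch through `P`
  have key {I : Set (Ideal C)} {K : Ideal (C ⊗[A] B)}
      (hIF : I ⊆ (F.map (algebraMap A C)).minimalPrimes)
      (hKI : ∀ P ∈ I, ∀ Q : Ideal (C ⊗[A] B), Q.IsPrime → Q.height = 1 →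
        P ≤ Q.comap (algebraMap C (C ⊗[A] B)) → K ≤ Q)
      (P : Ideal C) (hP : P.IsPrime)
      (hPA : P.comap (algebraMap A C) ∈ associatedPrimes A (ExtensionQuotient A B))
      (P₀ : Ideal C) (hP₀ : P₀ ∈ I) (hP₀P : P₀ ≤ P)
      (Q : Ideal (C ⊗[A] B)) (hQ : Q.IsPrime) (hQP : Q.comap (algebraMap C _) = P) : K ≤ Q := by
    have hmin := hIF hP₀
    have := hmin.1.1
    have h1 := height_comap_eq_one_of_mem_minimalPrimes_map hF hmin
    have h2 := height_eq_one_of_mem_associatedPrimes hAB hA hPA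
    have heq : P₀.comap (algebraMap A C) = P.comap (algebraMap A C) :=
      Ideal.eq_of_le_of_height_le _ (Ideal.comap_mono hP₀P) (h2.trans h1.symm).le
    obtain ⟨Q₀, hQ₀Q, hQ₀, hQ₀P⟩ := exists_le_comap_eq_of_comap_eq P₀ P hP₀P heq Q hQP
    exact (hKI P₀ hP₀ Q₀ hQ₀ (height_eq_one_of_comap_mem_minimalPrimes_map hAB hF hmin Q₀ hQ₀P)
      hQ₀P.ge).trans hQ₀Q
  obtain ⟨c, hc₁, hc₂⟩ := exists_algebraMap_mem_of_fibers hAB hA K₁ K₂ hK fun P hP hPA ↦ by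
    obtain ⟨P₀, hP₀, hP₀P⟩ := Ideal.exists_minimalPrimes_le
      (Ideal.map_le_iff_le_comap.mpr (hFA _ hPA) : F.map (algebraMap A C) ≤ P)
    rw [← hI] at hP₀
    exact hP₀.imp (fun h Q hQ hQP ↦ key hle₁ hK₁ P hP hPA P₀ h hP₀P Q hQ hQP)
      (fun h Q hQ hQP ↦ key hle₂ hK₂ P hP hPA P₀ h hP₀P Q hQ hQP)
  have hinj : Function.Injective (algebraMap C (C ⊗[A] B)) :=
    Algebra.TensorProduct.includeLeft_injective (S := A) hAB.injective
  have mem {I : Set (Ideal C)} {K : Ideal (C ⊗[A] B)}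
      (hIF : I ⊆ (F.map (algebraMap A C)).minimalPrimes)
      (hKI : ∀ P ∈ I, ∀ Q : Ideal (C ⊗[A] B), Q.IsPrime → Q.height = 1 →
        P ≤ Q.comap (algebraMap C (C ⊗[A] B)) → K ≤ Q) (hne : I.Nonempty) (d : C)
      (hd : algebraMap C (C ⊗[A] B) d ∈ K) : d ∈ IsLocalRing.maximalIdeal C := by
    obtain ⟨P, hP⟩ := hne
    have := (hIF hP).1.1
    obtain ⟨Q, -, hQ, hQP⟩ := Ideal.exists_ideal_over_prime_of_isIntegral P (⊥ : Ideal (C ⊗[A] B))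
      (by rw [← RingHom.ker_eq_comap_bot, (RingHom.injective_iff_ker_eq_bot _).mp hinj]
          exact bot_le)
    refine IsLocalRing.le_maximalIdeal this.ne_top ?_
    rw [← hQP]
    exact hKI P hP Q hQ
      (height_eq_one_of_comap_mem_minimalPrimes_map hAB hF (hIF hP) Q hQP) hQP.ge hd
  have h1 := mem hle₁ hK₁ h₁ c hc₁
  have h2 := mem hle₂ hK₂ h₂ (1 - c) (by rwa [map_sub, map_one])
  refine (Ideal.ne_top_iff_one (IsLocalRing.maximalIdeal C)).mp
    (IsLocalRing.maximalIdeal.isMaximal C).ne_top ?_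
  simpa using add_mem h1 h2

end Branches

end DivGluing

/-! ### Finiteness of normalization -/

namespace DivGluing

section FiniteNormalization

/-- Finiteness of the integral closure of a finitely generated algebra over a field of
characteristic zero in the residue field `L` of one of its primes: by Noether normalization this is
the integral closure of a polynomial ring in a finite separable extension of its fraction field. -/
lemma finite_integralClosure_of_finiteType (k : Type*) {A L : Type*} [Field k] [CharZero k]
    [CommRing A] [Algebra k A] [Algebra.FiniteType k A] [Field L] [Algebra A L]
    (hL : ∀ x : L, ∃ s a : A, algebraMap A L s ≠ 0 ∧ algebraMap A L s * x = algebraMap A L a) :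
    Module.Finite A (integralClosure A L) := by
  let _ : Algebra k L := ((algebraMap A L).comp (algebraMap k A)).toAlgebra
  have : IsScalarTower k A L := IsScalarTower.of_algebraMap_eq fun _ ↦ rfl
  let R : Subalgebra k L := (IsScalarTower.toAlgHom k A L).range
  have : Algebra.FiniteType k R :=
    Algebra.FiniteType.of_surjective (IsScalarTower.toAlgHom k A L).rangeRestrict
      (AlgHom.rangeRestrict_surjective _)
  obtain ⟨n, g, hg, hgfin⟩ := exists_finite_inj_algHom_of_fg k R
  let P := MvPolynomial (Fin n) k
  let _ : Algebra P R := g.toRingHom.toAlgebra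
  have : Module.Finite P R := hgfin
  let _ : Algebra P L := ((algebraMap R L).comp (algebraMap P R)).toAlgebra
  have : IsScalarTower P R L := IsScalarTower.of_algebraMap_eq fun _ ↦ rfl
  have hinj : Function.Injective (algebraMap P L) :=
    Subtype.val_injective.comp hg
  let K := FractionRing P
  have hfaith : FaithfulSMul P L := (faithfulSMul_iff_algebraMap_injective P L).mpr hinj
  let _ : Algebra K L := FractionRing.liftAlgebra P L
  have : IsScalarTower P K L := FractionRing.isScalarTower_liftAlgebra P L
  -- `L` is generated over `K` by the elements of `R`
  have hfrac : IsFractionRing R L := by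
    refine IsFractionRing.of_field R L fun z ↦ ?_
    obtain ⟨s, a, hs, hsz⟩ := hL z
    exact ⟨⟨algebraMap A L a, a, rfl⟩, ⟨algebraMap A L s, s, rfl⟩, by
      change z = algebraMap A L a / algebraMap A L s
      rw [← hsz, mul_div_cancel_left₀ _ hs]⟩
  have : Module.Finite K L := by
    obtain ⟨S, hS⟩ := Module.Finite.fg_top (R := P) (M := R)
    let E := IntermediateField.adjoin K ((algebraMap R L) '' (S : Set R))
    have hRE (r : R) : algebraMap R L r ∈ E := by
      have hr : r ∈ Submodule.span P (S : Set R) := hS ▸ Submodule.mem_top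
      induction hr using Submodule.span_induction with
      | mem x hx => exact IntermediateField.subset_adjoin K _ ⟨x, hx, rfl⟩
      | zero => simp
      | add x y _ _ hx hy => rw [map_add]; exact add_mem hx hy
      | smul p x _ hx =>
        rw [Algebra.smul_def, map_mul, ← IsScalarTower.algebraMap_apply P R L,
          IsScalarTower.algebraMap_apply P K L]
        exact mul_mem (E.algebraMap_mem _) hx
    have hE : E = ⊤ := by
      refine eq_top_iff.mpr fun z _ ↦ ?_
      obtain ⟨a, b, -, rfl⟩ := IsFractionRing.div_surjective (A := R) z
      exact div_mem (hRE a) (hRE b)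
    have : FiniteDimensional K E := by
      have : Finite ((algebraMap R L) '' (S : Set R)) := (S.finite_toSet.image _).to_subtype
      refine IntermediateField.finiteDimensional_adjoin ?_
      rintro _ ⟨r, -, rfl⟩
      have hr : IsIntegral P r := Algebra.IsIntegral.isIntegral r
      exact (hr.map (IsScalarTower.toAlgHom P R L)).tower_top
    rw [hE] at this
    exact Module.Finite.equiv (IntermediateField.topEquiv (F := K) (E := L)).toLinearEquiv
  have : Algebra.IsSeparable K L := by
    have : CharZero K := by
      have : CharZero P := inferInstance
      exact charZero_of_injective_algebraMap (IsFractionRing.injective P K)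
    infer_instance
  have : IsIntegrallyClosed P := inferInstance
  have hfin : Module.Finite P (integralClosure P L) := IsIntegralClosure.finite P K L _
  have hAint : ∀ x : L, IsIntegral A x → IsIntegral P x := by
    intro x hx
    have hR : IsIntegral R x := by
      obtain ⟨f, hf, hfx⟩ := hx
      refine ⟨f.map (IsScalarTower.toAlgHom k A L).rangeRestrict.toRingHom, hf.map _, ?_⟩
      rw [Polynomial.eval₂_map]
      exact hfx
    exact isIntegral_trans x hR
  -- `P` and `A` have the same integral closure in `L`, so generators over `P` generate over `A`
  obtain ⟨S, hS⟩ := (Module.Finite.iff_fg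
    (N := Subalgebra.toSubmodule (integralClosure P L))).mp hfin
  refine (Module.Finite.iff_fg
    (N := Subalgebra.toSubmodule (integralClosure A L))).mpr ⟨S, le_antisymm
      (Submodule.span_le.mpr fun x hx ↦ ?_) fun x hx ↦ ?_⟩
  · have hxN : x ∈ Subalgebra.toSubmodule (integralClosure P L) := hS ▸ Submodule.subset_span hx
    obtain ⟨f, hf, hfx⟩ := (show IsIntegral P x from hxN).tower_top (A := R)
    obtain ⟨f', hf', -, hf'm⟩ := Polynomial.lifts_and_natDegree_eq_and_monic
      (f := (IsScalarTower.toAlgHom k A L).rangeRestrict.toRingHom)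
      (by rw [Polynomial.lifts_iff_coeff_lifts]
          exact fun n ↦ AlgHom.rangeRestrict_surjective _ _) hf
    refine ⟨f', hf'm, ?_⟩
    rw [← hf', Polynomial.eval₂_map] at hfx
    exact hfx
  · have hxP : x ∈ Submodule.span P (S : Set L) := by
      rw [hS]; exact hAint x hx
    clear hx
    induction hxP using Submodule.span_induction with
    | mem x hx => exact Submodule.subset_span hx
    | zero => exact zero_mem _
    | add x y _ _ hx hy => exact add_mem hx hy
    | smul p x _ hx =>
      obtain ⟨a, ha⟩ := (g p).2
      have : p • x = a • x := by
        rw [Algebra.smul_def, Algebra.smul_def]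
        exact congrArg (· * x) ha.symm
      rw [this]
      exact Submodule.smul_mem _ a hx

/-- A ring which is integral over a reduced finitely generated algebra over a field of
characteristic zero and embeds over it into the product of its residue fields at the minimal primes
is a finite birational extension. -/
lemma finite_and_isBirationalExtension (k : Type*) {A B : Type*} [Field k] [CharZero k] [CommRing A]
    [IsReduced A] [Algebra k A] [Algebra.FiniteType k A] [CommRing B] [Algebra A B]
    [Algebra.IsIntegral A B] {ι : Type*} [Finite ι] (p : ι → Ideal A) (hp : Function.Injective p)
    (hpmin : Set.range p = minimalPrimes A) (L : ι → Type*) [∀ i, Field (L i)]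
    [∀ i, Algebra A (L i)] (hker : ∀ i, RingHom.ker (algebraMap A (L i)) = p i)
    (hL : ∀ i, ∀ x : L i, ∃ s a : A, algebraMap A (L i) s ≠ 0 ∧
      algebraMap A (L i) s * x = algebraMap A (L i) a)
    (φ : ∀ i, B →ₐ[A] L i) (hφ : ∀ b, (∀ i, φ i b = 0) → b = 0) :
    Module.Finite A B ∧ IsBirationalExtension A B := by
  classical
  have := Fintype.ofFinite ι
  have : IsNoetherianRing A := Algebra.FiniteType.isNoetherianRing k A
  have hmem (i : ι) (a : A) : algebraMap A (L i) a = 0 ↔ a ∈ p i := by rw [← hker]; rfl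
  have hmin (i : ι) : p i ∈ minimalPrimes A := hpmin ▸ ⟨i, rfl⟩
  have hprime (i : ι) : (p i).IsPrime := (hmin i).1.1
  have hzero (a : A) (ha : ∀ i, a ∈ p i) : a = 0 := by
    have : a ∈ nilradical A := by
      rw [nilradical, ← Ideal.sInf_minimalPrimes, Ideal.mem_sInf]
      intro q hq
      obtain ⟨i, rfl⟩ : q ∈ Set.range p := by rw [hpmin]; exact hq
      exact ha i
    rwa [nilradical_eq_zero] at this
  have hnzd (s : A) (hs : ∀ i, s ∉ p i) : s ∈ nonZeroDivisors A := by
    rw [mem_nonZeroDivisors_iff_right]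
    intro x hx
    refine hzero x fun i ↦ ((hprime i).mem_or_mem (hx ▸ zero_mem _ : x * s ∈ p i)).resolve_right
      (hs i)
  have hnot (s : A) (hs : s ∈ nonZeroDivisors A) (i : ι) : s ∉ p i := fun h ↦ by
    have := one_le_height_of_mem_nonZeroDivisors hs h
    rw [(Ideal.height_eq_zero_iff (I := p i)).mpr (hmin i)] at this
    simp at this
  refine ⟨?_, ?_, fun s hs ↦ ?_, fun b ↦ ?_⟩
  · have (i : ι) := finite_integralClosure_of_finiteType k (hL i)
    let Φ : B →ₗ[A] (∀ i, integralClosure A (L i)) := LinearMap.pi fun i ↦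
      ((φ i).codRestrict (integralClosure A (L i))
        fun b ↦ (Algebra.IsIntegral.isIntegral b).map (φ i)).toLinearMap
    refine Module.Finite.of_injective Φ
      ((injective_iff_map_eq_zero Φ).mpr fun b hb ↦ hφ b fun i ↦ ?_)
    exact congrArg Subtype.val (congrFun hb i)
  · rw [injective_iff_map_eq_zero]
    refine fun a ha ↦ hzero a fun i ↦ ?_
    rw [← hmem, ← (φ i).commutes, ha, map_zero]
  · rw [mem_nonZeroDivisors_iff_right]
    refine fun x hx ↦ hφ x fun i ↦ ?_
    have := congrArg (φ i) hx
    rw [map_mul, map_zero, AlgHom.commutes] at this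
    exact (mul_eq_zero.mp this).resolve_right fun h ↦ hnot s hs i ((hmem i s).mp h)
  · choose s a hs hsa using fun i ↦ hL i (φ i b)
    -- elements separating the minimal primes
    have ht (i : ι) : ∃ t, t ∉ p i ∧ ∀ j, j ≠ i → t ∈ p j := by
      have hle : ¬ (Finset.univ.erase i).inf p ≤ p i := by
        intro hle
        obtain ⟨j, hj, hji⟩ := ((hprime i).inf_le').mp hle
        exact (Finset.ne_of_mem_erase hj) (hp (le_antisymm hji ((hmin i).2 ⟨hprime j, bot_le⟩ hji)))
      obtain ⟨t, ht, hti⟩ := SetLike.not_le_iff_exists.mp hle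
      rw [Submodule.mem_finsetInf] at ht
      exact ⟨t, hti, fun j hj ↦ ht j (Finset.mem_erase.mpr ⟨hj, Finset.mem_univ j⟩)⟩
    choose t hti htj using ht
    have hsum (c : ι → A) (i : ι) :
        algebraMap A (L i) (∑ j, t j * c j) = algebraMap A (L i) (t i * c i) := by
      rw [map_sum, Finset.sum_eq_single i (fun j _ hj ↦ ?_) (by simp)]
      rw [hmem]
      exact Ideal.mul_mem_right _ _ (htj j i hj.symm)
    refine ⟨∑ j, t j * s j, hnzd _ fun i hi ↦ ?_, ∑ j, t j * a j, ?_⟩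
    · rw [← hmem, hsum, map_mul, mul_eq_zero, hmem] at hi
      exact hi.elim (hti i) (hs i)
    · rw [← sub_eq_zero]
      refine hφ _ fun i ↦ ?_
      rw [map_sub, map_mul, AlgHom.commutes, AlgHom.commutes, hsum, hsum, map_mul, map_mul,
        mul_assoc, hsa, sub_self]

end FiniteNormalization

end DivGluing

/-! ### Points of affine opens and prime ideals -/

namespace DivGluing

section Dictionary

variable {Z : Scheme.{0}} {U : Z.Opens} (hU : IsAffineOpen U)

lemma mem_primeIdealOf {z : Z} (hz : z ∈ U) (f : Γ(Z, U)) :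
    f ∈ (hU.primeIdealOf ⟨z, hz⟩).asIdeal ↔ ¬ IsUnit (Z.presheaf.germ U z hz f) := by
  let := Z.presheaf.algebra_section_stalk ⟨z, hz⟩
  have := hU.isLocalization_stalk ⟨z, hz⟩
  have h := IsLocalization.AtPrime.isUnit_to_map_iff (Z.presheaf.stalk z)
    (hU.primeIdealOf ⟨z, hz⟩).asIdeal f
  rw [← not_iff_not, not_not]
  exact h.symm

lemma mem_primeIdealOf_iff_notMem_basicOpen {z : Z} (hz : z ∈ U) (f : Γ(Z, U)) :
    f ∈ (hU.primeIdealOf ⟨z, hz⟩).asIdeal ↔ z ∉ Z.basicOpen f := by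
  rw [mem_primeIdealOf, Scheme.mem_basicOpen _ _ _ hz]

lemma exists_primeIdealOf_eq (p : Ideal Γ(Z, U)) [hp : p.IsPrime] :
    ∃ (z : Z) (hz : z ∈ U), (hU.primeIdealOf ⟨z, hz⟩).asIdeal = p := by
  let y : Spec Γ(Z, U) := ⟨p, hp⟩
  have hy : hU.fromSpec y ∈ U := by
    rw [← SetLike.mem_coe, ← hU.range_fromSpec]
    exact ⟨y, rfl⟩
  refine ⟨hU.fromSpec y, hy, ?_⟩
  have h := hU.fromSpec_primeIdealOf ⟨_, hy⟩
  have := hU.fromSpec.isOpenEmbedding.injective h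
  exact congrArg PrimeSpectrum.asIdeal this

lemma primeIdealOf_le_iff {z w : Z} (hz : z ∈ U) (hw : w ∈ U) :
    (hU.primeIdealOf ⟨z, hz⟩).asIdeal ≤ (hU.primeIdealOf ⟨w, hw⟩).asIdeal ↔ z ⤳ w := by
  have h1 := hU.fromSpec_primeIdealOf ⟨z, hz⟩
  have h2 := hU.fromSpec_primeIdealOf ⟨w, hw⟩
  have h3 : z ⤳ w ↔ hU.fromSpec (hU.primeIdealOf ⟨z, hz⟩) ⤳
      hU.fromSpec (hU.primeIdealOf ⟨w, hw⟩) := by rw [h1, h2]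
  rw [h3]
  exact (PrimeSpectrum.le_iff_specializes _ _).trans
    hU.fromSpec.isOpenEmbedding.isInducing.specializes_iff.symm

lemma isCodimOne_iff_height {z : Z} (hz : z ∈ U) :
    IsCodimOne Z z ↔ (hU.primeIdealOf ⟨z, hz⟩).asIdeal.height = 1 := by
  let := Z.presheaf.algebra_section_stalk ⟨z, hz⟩
  have := hU.isLocalization_stalk ⟨z, hz⟩
  rw [IsCodimOne, IsLocalization.AtPrime.ringKrullDim_eq_height
    (hU.primeIdealOf ⟨z, hz⟩).asIdeal (Z.presheaf.stalk z)]
  norm_cast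

lemma mem_support_iff_le_primeIdealOf (I : Z.IdealSheafData) {z : Z} (hz : z ∈ U) :
    z ∈ I.support ↔ I.ideal ⟨U, hU⟩ ≤ (hU.primeIdealOf ⟨z, hz⟩).asIdeal := by
  rw [Scheme.IdealSheafData.mem_support_iff_of_mem (U := ⟨U, hU⟩) hz, Scheme.mem_zeroLocus_iff]
  refine forall₂_congr fun f hf ↦ ?_
  rw [mem_primeIdealOf_iff_notMem_basicOpen]

lemma primeIdealOf_comap {W : Scheme.{0}} (f : W ⟶ Z) {V : W.Opens} (hV : IsAffineOpen V)
    (e : V = f ⁻¹ᵁ U) {w : W} (hw : w ∈ V) (hw' : f w ∈ U) :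
    (hV.primeIdealOf ⟨w, hw⟩).asIdeal.comap (f.appLE U V e.le).hom =
      (hU.primeIdealOf ⟨f w, hw'⟩).asIdeal :=
  congrArg PrimeSpectrum.asIdeal
    (IsAffineOpen.comap_primeIdealOf_appLE (f := f) U hU V hV e.le hw)

lemma hasRegularPairs_of_isS2 (hU : IsAffineOpen U) (h : IsS2 Z) : HasRegularPairs Γ(Z, U) := by
  intro p hp hht
  obtain ⟨z, hz, rfl⟩ := exists_primeIdealOf_eq hU p
  let := Z.presheaf.algebra_section_stalk ⟨z, hz⟩
  have := hU.isLocalization_stalk ⟨z, hz⟩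
  set p := (hU.primeIdealOf ⟨z, hz⟩).asIdeal
  have hdim := IsLocalization.AtPrime.ringKrullDim_eq_height p (Z.presheaf.stalk z)
  obtain ⟨rs, hlen, hmem, hreg⟩ := h z 2 le_rfl (by rw [hdim]; exact WithBot.coe_le_coe.mpr hht)
  obtain ⟨f, g, rfl⟩ := List.length_eq_two.mp hlen
  let e : Z.presheaf.stalk z ≃+* Localization.AtPrime p :=
    (IsLocalization.algEquiv p.primeCompl (Z.presheaf.stalk z) (Localization.AtPrime p)).toRingEquiv
  have hw := hreg.toIsWeaklyRegular
  rw [RingTheory.Sequence.isWeaklyRegular_cons_iff] at hw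
  obtain ⟨hf, hg⟩ := hw
  rw [RingTheory.Sequence.isWeaklyRegular_cons_iff] at hg
  replace hg := hg.1
  have hmax (x) (hx : x ∈ IsLocalRing.maximalIdeal (Z.presheaf.stalk z)) :
      e x ∈ IsLocalRing.maximalIdeal (Localization.AtPrime p) := by
    rw [IsLocalRing.mem_maximalIdeal, mem_nonunits_iff] at hx ⊢
    exact fun hu ↦ hx ((MulEquiv.isUnit_map e).mp hu)
  refine ⟨e f, hmax f (hmem f (by simp)), e g, hmax g (hmem g (by simp)), ?_, fun u v huv ↦ ?_⟩
  · rw [mem_nonZeroDivisors_iff_right]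
    intro x hx
    obtain ⟨x, rfl⟩ := e.surjective x
    rw [← map_mul, map_eq_zero_iff e e.injective, mul_comm] at hx
    have h0 : x = 0 := hf (show f • x = f • 0 by rw [smul_zero]; exact hx)
    rw [h0, map_zero]
  · obtain ⟨u, rfl⟩ := e.surjective u
    obtain ⟨v, rfl⟩ := e.surjective v
    rw [← map_mul, ← map_mul, e.injective.eq_iff] at huv
    refine map_dvd e ?_
    have h0 : (Submodule.Quotient.mk u : QuotSMulTop f (Z.presheaf.stalk z)) = 0 := by
      refine hg ?_
      change g • _ = g • _
      rw [smul_zero, ← Submodule.Quotient.mk_smul, Submodule.Quotient.mk_eq_zero]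
      rw [smul_eq_mul, huv]
      exact Submodule.smul_mem_pointwise_smul v f ⊤ trivial
    rw [Submodule.Quotient.mk_eq_zero] at h0
    obtain ⟨w, -, rfl⟩ := h0
    exact ⟨w, rfl⟩

lemma height_eq_one_of_isDivisor {I : Z.IdealSheafData} (hI : IsDivisor I) :
    ∀ p ∈ (I.ideal ⟨U, hU⟩).minimalPrimes, p.height = 1 := by
  intro p hp
  have := hp.1.1
  obtain ⟨z, hz, rfl⟩ := exists_primeIdealOf_eq hU p
  rw [← isCodimOne_iff_height]
  have hzI := (mem_support_iff_le_primeIdealOf hU I hz).mpr hp.1.2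
  refine hI z hzI fun y hy hyz ↦ ?_
  have hyU : y ∈ U := hyz.mem_open U.2 hz
  have h1 := (primeIdealOf_le_iff hU hyU hz).mpr hyz
  have h2 := hp.2 ⟨inferInstance, (mem_support_iff_le_primeIdealOf hU I hyU).mp hy⟩ h1
  have h3 := (primeIdealOf_le_iff hU hz hyU).mp h2
  exact (hyz.antisymm h3).eq

/-- At the associated primes of a finite birational extension the scheme is not normal. -/
lemma mem_nonNormalLocus_of_mem_associatedPrimes [IsNoetherianRing Γ(Z, U)] {B : Type*} [CommRing B]
    [Algebra Γ(Z, U) B] [Algebra.IsIntegral Γ(Z, U) B] (hB : IsBirationalExtension Γ(Z, U) B)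
    {z : Z} (hz : z ∈ U) (hp : (hU.primeIdealOf ⟨z, hz⟩).asIdeal ∈
      associatedPrimes Γ(Z, U) (ExtensionQuotient Γ(Z, U) B)) : z ∈ nonNormalLocus Z := by
  rintro ⟨hd, hn⟩
  let := Z.presheaf.algebra_section_stalk ⟨z, hz⟩
  have := hU.isLocalization_stalk ⟨z, hz⟩
  set p := (hU.primeIdealOf ⟨z, hz⟩).asIdeal
  let e : Z.presheaf.stalk z ≃+* Localization.AtPrime p :=
    (IsLocalization.algEquiv p.primeCompl (Z.presheaf.stalk z) (Localization.AtPrime p)).toRingEquiv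
  exact not_isIntegrallyClosed_of_mem_associatedPrimes hB hp
    (e.symm.injective.isDomain e.symm.toRingHom)
    (IsIntegrallyClosed.of_equiv e)

end Dictionary

end DivGluing

/-! ### The normalization of a complex variety over an affine open -/

namespace DivGluing

section NormalizationFinite

lemma appLE_eq_of_eq {X Y : Scheme.{0}} {f f' : X ⟶ Y} (h : f = f') {U : Y.Opens} {V : X.Opens}
    (e : V ≤ f ⁻¹ᵁ U) (e' : V ≤ f' ⁻¹ᵁ U) : f.appLE U V e = f'.appLE U V e' := by
  subst h; rfl

lemma fromSpecResidueField_appLE {X : Scheme.{0}} (x : X) (U : X.Opens) (hx : x ∈ U)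
    (e : ⊤ ≤ X.fromSpecResidueField x ⁻¹ᵁ U) :
    (X.fromSpecResidueField x).appLE U ⊤ e ≫ (Scheme.ΓSpecIso _).hom = X.evaluation U x hx := by
  have h1 : (X.fromSpecResidueField x).appLE U ⊤ e =
      X.presheaf.germ U x hx ≫ (Scheme.ΓSpecIso _).inv ≫ (Spec.map (X.residue x)).appTop := by
    refine (Scheme.Hom.comp_appLE (Spec.map (X.residue x)) (X.fromSpecStalk x) U ⊤ e).trans ?_
    rw [Scheme.fromSpecStalk_app hx, Category.assoc, Category.assoc]
    erw [Scheme.Hom.map_appLE]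
    exact congrArg (fun t ↦ X.presheaf.germ U x hx ≫ (Scheme.ΓSpecIso (X.presheaf.stalk x)).inv ≫ t)
      (Scheme.Hom.appLE_eq_app (Spec.map (X.residue x)))
  rw [h1, Category.assoc, Category.assoc, Scheme.ΓSpecIso_naturality, Iso.inv_hom_id_assoc]
  rfl

lemma mem_genericPoints_iff {X : Scheme.{0}} (x : X) :
    x ∈ genericPoints X ↔ ∀ z : X, z ⤳ x → x ⤳ z := by
  constructor
  · intro h z hz
    have hle : closure {x} ⊆ closure {z} := by
      rw [(isClosed_closure).closure_subset_iff]
      exact Set.singleton_subset_iff.mpr (specializes_iff_mem_closure.mp hz)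
    exact specializes_iff_mem_closure.mpr
      (h.2 isIrreducible_singleton.closure hle (subset_closure rfl))
  · intro h
    refine ⟨isIrreducible_singleton.closure, fun T hT hle ↦ ?_⟩
    obtain ⟨w, hw⟩ := QuasiSober.sober hT.closure isClosed_closure
    have hwx : w ⤳ x := by
      rw [specializes_iff_mem_closure, hw.def]
      exact subset_closure (hle (subset_closure rfl))
    have hxw := h w hwx
    refine subset_closure.trans ?_
    rw [← hw.def]
    rw [(isClosed_closure).closure_subset_iff]
    exact Set.singleton_subset_iff.mpr (specializes_iff_mem_closure.mp hxw)

lemma mem_minimalPrimes_iff_mem_genericPoints {X : Scheme.{0}} {U : X.Opens} (hU : IsAffineOpen U)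
    {x : X} (hx : x ∈ U) :
    (hU.primeIdealOf ⟨x, hx⟩).asIdeal ∈ minimalPrimes Γ(X, U) ↔ x ∈ genericPoints X := by
  rw [mem_genericPoints_iff]
  constructor
  · intro h z hz
    have hzU : z ∈ U := hz.mem_open U.2 hx
    exact (primeIdealOf_le_iff hU hx hzU).mp
      (h.2 ⟨inferInstance, bot_le⟩ ((primeIdealOf_le_iff hU hzU hx).mpr hz))
  · refine fun h ↦ ⟨⟨inferInstance, bot_le⟩, fun q hq hle ↦ ?_⟩
    have := hq.1
    obtain ⟨z, hz, rfl⟩ := exists_primeIdealOf_eq hU q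
    exact (primeIdealOf_le_iff hU hx hz).mpr (h z ((primeIdealOf_le_iff hU hz hx).mp hle))

lemma exists_evaluation_mul_eq {X : Scheme.{0}} {U : X.Opens} (hU : IsAffineOpen U)
    {x : X} (hx : x ∈ U) (z : X.residueField x) : ∃ s a : Γ(X, U),
      X.evaluation U x hx s ≠ 0 ∧ X.evaluation U x hx s * z = X.evaluation U x hx a := by
  let := X.presheaf.algebra_section_stalk ⟨x, hx⟩
  have := hU.isLocalization_stalk ⟨x, hx⟩
  obtain ⟨y, rfl⟩ := X.residue_surjective x z
  obtain ⟨⟨a, s⟩, h⟩ := IsLocalization.surj (hU.primeIdealOf ⟨x, hx⟩).asIdeal.primeCompl y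
  refine ⟨s, a, ?_, ?_⟩
  · rw [Scheme.evaluation_ne_zero_iff_mem_basicOpen]
    by_contra hs
    exact s.2 ((mem_primeIdealOf_iff_notMem_basicOpen hU hx _).mpr hs)
  · have := congrArg (X.residue x) h
    rw [map_mul, mul_comm] at this
    exact this

/-- Sections of a relative normalization of `X` in `G` are determined by their pullbacks to an open
cover of `G`. -/
lemma normalization_eq_zero_of_forall {G X : Scheme.{0}} (g : G ⟶ X) [QuasiCompact g]
    [QuasiSeparated g] {U : X.Opens} (hU : IsAffineOpen U)
    (b : Γ(g.normalization, g.fromNormalization ⁻¹ᵁ U)) (𝒰 : G.OpenCover)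
    (h : ∀ i (W : (𝒰.X i).Opens)
      (e : W ≤ (𝒰.f i ≫ g.toNormalization) ⁻¹ᵁ (g.fromNormalization ⁻¹ᵁ U)),
      (𝒰.f i ≫ g.toNormalization).appLE _ W e b = 0) : b = 0 := by
  let := (g.app U).hom.toAlgebra
  have hle : g ⁻¹ᵁ U ≤ g.toNormalization ⁻¹ᵁ (g.fromNormalization ⁻¹ᵁ U) := by
    rw [← Scheme.Hom.comp_preimage, g.toNormalization_fromNormalization]
  have hinj : Function.Injective (g.toNormalization.appLE (g.fromNormalization ⁻¹ᵁ U) _ hle) := by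
    rw [← g.normalizationObjIso_hom_val hU]
    exact Subtype.val_injective.comp (g.normalizationObjIso hU).commRingCatIsoToRingEquiv.injective
  refine (injective_iff_map_eq_zero _).mp hinj b ?_
  refine Scheme.zero_of_zero_cover _ 𝒰 fun i ↦ ?_
  rw [Scheme.Hom.app_eq_appLE]
  refine (congrArg (fun t ↦ t.hom b) (Scheme.Hom.appLE_comp_appLE (𝒰.f i) g.toNormalization
    (g.fromNormalization ⁻¹ᵁ U) (g ⁻¹ᵁ U) (𝒰.f i ⁻¹ᵁ g ⁻¹ᵁ U) hle le_rfl)).trans (h i _ _)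

variable (V : ComplexVariety)

lemma exists_algebra_finiteType {U : V.X.Opens} (hU : IsAffineOpen U) :
    ∃ _ : Algebra ℂ Γ(V.X, U), Algebra.FiniteType ℂ Γ(V.X, U) := by
  have h := V.str.finiteType_appLE (isAffineOpen_top _) hU (le_top : U ≤ V.str ⁻¹ᵁ ⊤)
  have h2 := RingHom.FiniteType.comp h (RingHom.FiniteType.of_surjective
    (Scheme.ΓSpecIso (CommRingCat.of ℂ)).inv.hom
    (Scheme.ΓSpecIso (CommRingCat.of ℂ)).commRingCatIsoToRingEquiv.symm.surjective)
  exact ⟨RingHom.toAlgebra _, h2⟩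

/-- Over an affine open, the normalization of a complex variety is given by a finite birational
extension of rings. -/
theorem normalization_finite_and_isBirationalExtension {U : V.X.Opens} (hU : IsAffineOpen U) :
    letI := ((normalizationMap V.X).app U).hom.toAlgebra
    Module.Finite Γ(V.X, U) Γ(normalization V.X, normalizationMap V.X ⁻¹ᵁ U) ∧
      IsBirationalExtension Γ(V.X, U) Γ(normalization V.X, normalizationMap V.X ⁻¹ᵁ U) := by
  obtain ⟨_, _⟩ := exists_algebra_finiteType V hU
  let g := fromGenericPoints V.X
  let ν := g.fromNormalization
  let ι := {η : genericPoints V.X // η.1 ∈ U}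
  let := (ν.app U).hom.toAlgebra
  have hint : Algebra.IsIntegral Γ(V.X, U) Γ(g.normalization, ν ⁻¹ᵁ U) :=
    ⟨IsIntegralHom.isIntegral_app ν U hU⟩
  let L (i : ι) := V.X.residueField i.1.1
  let (i : ι) : Algebra Γ(V.X, U) (L i) := (V.X.evaluation U i.1.1 i.2).hom.toAlgebra
  let e (η : genericPoints V.X) : Spec (V.X.residueField η.1) ⟶ g.normalization :=
    Sigma.ι (fun η : genericPoints V.X ↦ Spec (V.X.residueField η.1)) η ≫ g.toNormalization
  have heν (η : genericPoints V.X) : e η ≫ ν = V.X.fromSpecResidueField η.1 := by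
    rw [Category.assoc, g.toNormalization_fromNormalization]
    exact Sigma.ι_desc _ _
  have hpre (η : genericPoints V.X) (w : Spec (V.X.residueField η.1)) : ν (e η w) = η.1 := by
    rw [← Scheme.Hom.comp_apply, heν]
    exact Set.mem_singleton_iff.mp (V.X.range_fromSpecResidueField η.1 ▸ Set.mem_range_self w)
  have htop (i : ι) : (⊤ : (Spec (V.X.residueField i.1.1)).Opens) ≤ e i.1 ⁻¹ᵁ (ν ⁻¹ᵁ U) :=
      fun w _ ↦ by
    change ν (e i.1 w) ∈ U
    rw [hpre]; exact i.2
  let φ (i : ι) : Γ(g.normalization, ν ⁻¹ᵁ U) →ₐ[Γ(V.X, U)] L i :=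
    { ((e i.1).appLE (ν ⁻¹ᵁ U) ⊤ (htop i) ≫ (Scheme.ΓSpecIso _).hom).hom with
      commutes' := fun a ↦ by
        have h1 : ν.app U ≫ (e i.1).appLE (ν ⁻¹ᵁ U) ⊤ (htop i) ≫ (Scheme.ΓSpecIso _).hom =
            V.X.evaluation U i.1.1 i.2 := by
          rw [← fromSpecResidueField_appLE i.1.1 U i.2 (fun w _ ↦ by
            have := htop i (Set.mem_univ w : w ∈ (⊤ : (Spec (V.X.residueField i.1.1)).Opens))
            change ν (e i.1 w) ∈ U at this
            change V.X.fromSpecResidueField i.1.1 w ∈ U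
            rwa [← heν]),
            ← Category.assoc]
          congr 1
          exact (Scheme.Hom.comp_appLE (e i.1) ν U ⊤ (htop i)).symm.trans
            (appLE_eq_of_eq (heν i.1) _ _)
        exact congrArg (fun t ↦ t.hom a) h1 }
  refine finite_and_isBirationalExtension ℂ (A := Γ(V.X, U))
    (B := Γ(g.normalization, ν ⁻¹ᵁ U)) (ι := ι)
    (fun i ↦ (hU.primeIdealOf ⟨i.1.1, i.2⟩).asIdeal) ?_ ?_ (fun i ↦ L i) ?_ ?_ φ ?_
  · rintro ⟨⟨x, hx⟩, hxU⟩ ⟨⟨y, hy⟩, hyU⟩ hxy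
    have h1 := (primeIdealOf_le_iff hU hxU hyU).mp hxy.le
    have h2 := (primeIdealOf_le_iff hU hyU hxU).mp hxy.ge
    exact Subtype.ext (Subtype.ext (h1.antisymm h2).eq)
  · ext p
    constructor
    · rintro ⟨i, rfl⟩
      exact (mem_minimalPrimes_iff_mem_genericPoints hU i.2).mpr i.1.2
    · intro hp
      have := hp.1.1
      obtain ⟨z, hz, rfl⟩ := exists_primeIdealOf_eq hU p
      exact ⟨⟨⟨z, (mem_minimalPrimes_iff_mem_genericPoints hU hz).mp hp⟩, hz⟩, rfl⟩
  · intro i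
    ext f
    rw [RingHom.mem_ker, mem_primeIdealOf_iff_notMem_basicOpen,
      ← Scheme.evaluation_eq_zero_iff_notMem_basicOpen _ i.1.1 i.2]
    rfl
  · intro i x
    exact exists_evaluation_mul_eq hU i.2 x
  · intro b hb
    refine normalization_eq_zero_of_forall g hU b (sigmaOpenCover _) fun η W hW ↦ ?_
    change (e η).appLE (ν ⁻¹ᵁ U) W hW b = 0
    by_cases hη : η.1 ∈ U
    · have h1 := hb ⟨η, hη⟩
      change (Scheme.ΓSpecIso _).hom ((e η).appLE (ν ⁻¹ᵁ U) ⊤ (htop ⟨η, hη⟩) b) = 0 at h1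
      have h2 : (e η).appLE (ν ⁻¹ᵁ U) ⊤ (htop ⟨η, hη⟩) b = 0 :=
        (map_eq_zero_iff _ (Scheme.ΓSpecIso _).commRingCatIsoToRingEquiv.injective).mp h1
      have h3 := (e η).appLE_map (htop ⟨η, hη⟩) (homOfLE le_top : W ⟶ ⊤).op
      rw [← h3, CommRingCat.comp_apply, h2, map_zero]
    · have hW' : W = ⊥ := by
        refine eq_bot_iff.mpr fun w hw ↦ hη ?_
        have : ν (e η w) ∈ U := hW hw
        exact (hpre η w) ▸ this
      subst hW'
      exact Subsingleton.elim (α := Γ((sigmaOpenCover _).X η, ⊥)) _ _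

end NormalizationFinite

end DivGluing

/-! ### Divisors and their codimension one preimages -/

namespace DivGluing

section CodimensionOnePart

variable {Z : Scheme.{0}} (I : Z.IdealSheafData)

lemma le_codimOnePart : I ≤ codimOnePart I :=
  Scheme.IdealSheafData.le_ofIdeals_iff.mpr fun _ ↦
    le_iInf fun _ ↦ le_iInf fun _ ↦ le_iInf fun _ ↦ Ideal.le_comap_map

lemma ideal_codimOnePart_le {U : Z.affineOpens} {z : Z} (hz : z ∈ U.1) (hz' : IsCodimOne Z z) :
    (codimOnePart I).ideal U ≤
      ((I.ideal U).map (Z.presheaf.germ U.1 z hz).hom).comap (Z.presheaf.germ U.1 z hz).hom :=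
  (Scheme.IdealSheafData.ideal_ofIdeals_le _ U).trans
    ((iInf_le _ z).trans ((iInf_le _ hz).trans (iInf_le _ hz')))

lemma mem_support_codimOnePart {z : Z} (hz : z ∈ I.support) (hz' : IsCodimOne Z z) :
    z ∈ (codimOnePart I).support := by
  obtain ⟨U, hU, hzU, -⟩ := exists_isAffineOpen_mem_and_subset (x := z) (U := ⊤) trivial
  rw [mem_support_iff_le_primeIdealOf hU _ hzU] at hz ⊢
  refine (ideal_codimOnePart_le I (U := ⟨U, hU⟩) hzU hz').trans fun f hf ↦ ?_
  rw [mem_primeIdealOf]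
  have hle : (I.ideal ⟨U, hU⟩).map (Z.presheaf.germ U z hzU).hom ≤
      IsLocalRing.maximalIdeal (Z.presheaf.stalk z) := by
    rw [Ideal.map_le_iff_le_comap]
    intro g hg
    have := hz hg
    rw [mem_primeIdealOf] at this
    exact this
  exact hle hf

end CodimensionOnePart

instance {X : Scheme.{0}} [IsNoetherian X] : IsIntegralHom (normalizationMap X) :=
  inferInstanceAs (IsIntegralHom (fromGenericPoints X).fromNormalization)

lemma primeIdealOf_comap_app {X Y : Scheme.{0}} (f : Y ⟶ X) [IsAffineHom f] {U : X.Opens}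
    (hU : IsAffineOpen U) {y : Y} (hy : y ∈ f ⁻¹ᵁ U) :
    ((hU.preimage f).primeIdealOf ⟨y, hy⟩).asIdeal.comap (f.app U).hom =
      (hU.primeIdealOf ⟨f y, hy⟩).asIdeal := by
  rw [← primeIdealOf_comap hU f (hU.preimage f) rfl hy hy, Scheme.Hom.appLE_eq_app]

/-- A prime of the sections over `f ⁻¹ U` is the ideal of a point, whose image is given by the
trace of the prime. -/
lemma exists_apply_eq_of_comap_eq {X Y : Scheme.{0}} (f : Y ⟶ X) [IsAffineHom f] {U : X.Opens}
    (hU : IsAffineOpen U) (Q : Ideal Γ(Y, f ⁻¹ᵁ U)) [Q.IsPrime] {x : X} (hx : x ∈ U)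
    (hQ : Q.comap (f.app U).hom = (hU.primeIdealOf ⟨x, hx⟩).asIdeal) :
    ∃ (y : Y) (hy : y ∈ f ⁻¹ᵁ U), f y = x ∧
      ((hU.preimage f).primeIdealOf ⟨y, hy⟩).asIdeal = Q := by
  obtain ⟨y, hy, rfl⟩ := exists_primeIdealOf_eq (hU.preimage f) Q
  refine ⟨y, hy, ?_, rfl⟩
  rw [primeIdealOf_comap_app f hU hy] at hQ
  exact (((primeIdealOf_le_iff hU hy hx).mp hQ.le).antisymm
    ((primeIdealOf_le_iff hU hx hy).mp hQ.ge)).eq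

section Divisors

variable (V : ComplexVariety)

lemma isNoetherianRing_sections {U : V.X.Opens} (hU : IsAffineOpen U) :
    IsNoetherianRing Γ(V.X, U) :=
  IsLocallyNoetherian.component_noetherian ⟨U, hU⟩

/-- Points of the normalization over points of codimension one have codimension one. -/
lemma isCodimOne_of_isCodimOne_normalizationMap {y : normalization V.X}
    (h : IsCodimOne V.X (normalizationMap V.X y)) : IsCodimOne (normalization V.X) y := by
  obtain ⟨U, hU, hy, -⟩ :=
    exists_isAffineOpen_mem_and_subset (x := normalizationMap V.X y) (U := ⊤) trivial
  let := ((normalizationMap V.X).app U).hom.toAlgebra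
  obtain ⟨hfin, hbir⟩ := normalization_finite_and_isBirationalExtension V hU
  have := isNoetherianRing_sections V hU
  have : IsNoetherianRing Γ(normalization V.X, normalizationMap V.X ⁻¹ᵁ U) :=
    IsNoetherianRing.of_finite Γ(V.X, U) _
  have hQ := primeIdealOf_comap_app (normalizationMap V.X) hU hy
  rw [isCodimOne_iff_height hU hy] at h
  rw [isCodimOne_iff_height (hU.preimage (normalizationMap V.X)) hy]
  refine le_antisymm ((height_le_height_comap (R := Γ(V.X, U)) _).trans ?_) ?_
  · exact ((congrArg Ideal.height hQ).trans h).le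
  · obtain ⟨s, hs, hsp⟩ := exists_mem_nonZeroDivisors_of_one_le_height h.ge
    refine one_le_height_of_mem_nonZeroDivisors (hbir.map_mem_nonZeroDivisors s hs) ?_
    rw [← hQ] at hsp
    exact hsp

lemma mem_divPreimage_support {F : V.X.IdealSheafData} {y : normalization V.X}
    (hy : normalizationMap V.X y ∈ F.support) (h : IsCodimOne V.X (normalizationMap V.X y)) :
    y ∈ (divPreimage F).support := by
  refine mem_support_codimOnePart _ ?_ (isCodimOne_of_isCodimOne_normalizationMap V h)
  rw [Scheme.IdealSheafData.support_comap]
  exact hy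

/-- The codimension one preimage of a divisor maps onto it: the generic points of `F` have
codimension one, and specializations lift along the integral map `ν`. -/
lemma exists_mem_divPreimage_support {F : V.X.IdealSheafData} (hF : IsDivisor F) {x : V.X}
    (hx : x ∈ F.support) :
    ∃ y : normalization V.X, y ∈ (divPreimage F).support ∧ normalizationMap V.X y = x := by
  obtain ⟨U, hU, hxU, -⟩ := exists_isAffineOpen_mem_and_subset (x := x) (U := ⊤) trivial
  let := ((normalizationMap V.X).app U).hom.toAlgebra
  obtain ⟨hfin, hbir⟩ := normalization_finite_and_isBirationalExtension V hU
  obtain ⟨p, hp, hpx⟩ := Ideal.exists_minimalPrimes_le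
    ((mem_support_iff_le_primeIdealOf hU F hxU).mp hx)
  have := hp.1.1
  obtain ⟨z, hz, rfl⟩ := exists_primeIdealOf_eq hU p
  obtain ⟨Q, -, hQ, hQp⟩ := Ideal.exists_ideal_over_prime_of_isIntegral
    (hU.primeIdealOf ⟨z, hz⟩).asIdeal (⊥ : Ideal Γ(normalization V.X, normalizationMap V.X ⁻¹ᵁ U))
    (by rw [← RingHom.ker_eq_comap_bot, (RingHom.injective_iff_ker_eq_bot _).mp hbir.injective]
        exact bot_le)
  obtain ⟨Q', hQQ', hQ', hQ'p⟩ := Ideal.exists_ideal_over_prime_of_isIntegral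
    (hU.primeIdealOf ⟨x, hxU⟩).asIdeal Q (hQp.le.trans hpx)
  obtain ⟨y, hy, hyz, rfl⟩ := exists_apply_eq_of_comap_eq (normalizationMap V.X) hU Q hz hQp
  obtain ⟨y', hy', hyx, rfl⟩ := exists_apply_eq_of_comap_eq (normalizationMap V.X) hU Q' hxU hQ'p
  refine ⟨y', ?_, hyx⟩
  have hspec := (primeIdealOf_le_iff (hU.preimage (normalizationMap V.X)) hy hy').mp hQQ'
  refine hspec.mem_closed (divPreimage F).support.isClosed (mem_divPreimage_support V ?_ ?_)
  · rw [hyz, mem_support_iff_le_primeIdealOf hU F hz]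
    exact hp.1.2
  · rw [hyz, isCodimOne_iff_height hU hz]
    exact height_eq_one_of_isDivisor hU hF _ hp

variable {V}

/-- The points of the normalization over an associated prime of `𝒪_{X^ν} / 𝒪_X` that lies in a
divisor `F` belong to the codimension one preimage of `F`. -/
lemma ideal_divPreimage_le_of_mem_associatedPrimes (hS2 : IsS2 V.X) {U : V.X.Opens}
    (hU : IsAffineOpen U) {x : V.X} (hx : x ∈ U) :
    letI := ((normalizationMap V.X).app U).hom.toAlgebra
    (hU.primeIdealOf ⟨x, hx⟩).asIdeal ∈ associatedPrimes Γ(V.X, U) (ExtensionQuotient Γ(V.X, U)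
      Γ(normalization V.X, normalizationMap V.X ⁻¹ᵁ U)) →
    x ∈ nonNormalLocus V.X ∧ ∀ F : V.X.IdealSheafData, x ∈ F.support →
      ∀ Q : Ideal Γ(normalization V.X, normalizationMap V.X ⁻¹ᵁ U), Q.IsPrime →
        Q.comap (algebraMap Γ(V.X, U) _) = (hU.primeIdealOf ⟨x, hx⟩).asIdeal →
        (divPreimage F).ideal ⟨_, hU.preimage (normalizationMap V.X)⟩ ≤ Q := by
  let := ((normalizationMap V.X).app U).hom.toAlgebra
  intro hp
  obtain ⟨hfin, hbir⟩ := normalization_finite_and_isBirationalExtension V hU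
  have := isNoetherianRing_sections V hU
  refine ⟨mem_nonNormalLocus_of_mem_associatedPrimes hU hbir hx hp, fun F hF Q hQ hQp ↦ ?_⟩
  obtain ⟨y, hy, rfl, rfl⟩ := exists_apply_eq_of_comap_eq (normalizationMap V.X) hU Q hx hQp
  refine (mem_support_iff_le_primeIdealOf _ _ hy).mp (mem_divPreimage_support V hF ?_)
  rw [isCodimOne_iff_height hU hx]
  exact height_eq_one_of_mem_associatedPrimes hbir (hasRegularPairs_of_isS2 hU hS2) hp

/-- Two divisors covering the non-normal locus that meet in `X` have codimension one preimages that
meet in the normalization, over the same point. -/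
theorem exists_mem_divPreimage_inter (hS2 : IsS2 V.X) {F₁ F₂ : V.X.IdealSheafData}
    (h₁ : IsDivisor F₁) (h₂ : IsDivisor F₂)
    (h : nonNormalLocus V.X ⊆ (F₁.support : Set V.X) ∪ (F₂.support : Set V.X))
    {x : V.X} (hx₁ : x ∈ F₁.support) (hx₂ : x ∈ F₂.support) :
    ∃ y : normalization V.X, y ∈ (divPreimage F₁).support ∧ y ∈ (divPreimage F₂).support ∧
      normalizationMap V.X y = x := by
  obtain ⟨U, hU, hxU, -⟩ := exists_isAffineOpen_mem_and_subset (x := x) (U := ⊤) trivial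
  let := ((normalizationMap V.X).app U).hom.toAlgebra
  obtain ⟨hfin, hbir⟩ := normalization_finite_and_isBirationalExtension V hU
  have := isNoetherianRing_sections V hU
  have hmem {F : V.X.IdealSheafData} (hF : IsDivisor F) (hx : x ∈ F.support) :
      ∃ Q : Ideal Γ(normalization V.X, normalizationMap V.X ⁻¹ᵁ U), Q.IsPrime ∧
        Q.comap (algebraMap Γ(V.X, U) _) = (hU.primeIdealOf ⟨x, hxU⟩).asIdeal ∧
        (divPreimage F).ideal ⟨_, hU.preimage (normalizationMap V.X)⟩ ≤ Q := by
    obtain ⟨y, hy, rfl⟩ := exists_mem_divPreimage_support V hF hx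
    exact ⟨_, inferInstance, primeIdealOf_comap_app (normalizationMap V.X) hU hxU,
      (mem_support_iff_le_primeIdealOf (hU.preimage (normalizationMap V.X)) _ hxU).mp hy⟩
  obtain ⟨Q, hQ, hQx, hQ₁, hQ₂⟩ := not_exists_primes_of_comaximal hbir
    (hasRegularPairs_of_isS2 hU hS2) _ _ (fun p hp ↦ by
      have := hp.1
      obtain ⟨z, hz, rfl⟩ := exists_primeIdealOf_eq hU p
      obtain ⟨hzn, hz'⟩ := ideal_divPreimage_le_of_mem_associatedPrimes hS2 hU hz hp
      exact (h hzn).imp (hz' F₁) (hz' F₂)) _ (hmem h₁ hx₁) (hmem h₂ hx₂)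
  obtain ⟨y, hy, rfl, rfl⟩ := exists_apply_eq_of_comap_eq (normalizationMap V.X) hU Q hxU hQx
  exact ⟨y, (mem_support_iff_le_primeIdealOf _ _ hy).mpr hQ₁,
    (mem_support_iff_le_primeIdealOf _ _ hy).mpr hQ₂, rfl⟩

end Divisors

end DivGluing

/-! ### Analytic branches -/

namespace DivGluing

open TensorProduct PrimeSpectrum

section AnalyticBranches

/-- The maximal irreducible subsets of a closed subset of a spectrum are given by minimal primes. -/
lemma maximal_isIrreducible_iff {R : Type*} [CommRing R] (I : Ideal R) (B : Set (PrimeSpectrum R)) :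
    Maximal (fun T ↦ IsIrreducible T ∧ T ⊆ zeroLocus (I : Set R)) B ↔
      ∃ P ∈ I.minimalPrimes, B = zeroLocus (P : Set R) := by
  constructor
  · rintro ⟨⟨hB, hBI⟩, hmax⟩
    have hcl : closure B ⊆ B := hmax
      ⟨hB.closure, (isClosed_zeroLocus _).closure_subset_iff.mpr hBI⟩ subset_closure
    have hBP : B = zeroLocus (vanishingIdeal B : Set R) := by
      rw [zeroLocus_vanishingIdeal_eq_closure]
      exact subset_closure.antisymm hcl
    refine ⟨vanishingIdeal B, ⟨⟨isIrreducible_iff_vanishingIdeal_isPrime.mp hB,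
      (subset_zeroLocus_iff_le_vanishingIdeal _ _).mp hBI⟩, fun q hq hle ↦ ?_⟩, hBP⟩
    have := hq.1
    have h1 : zeroLocus (q : Set R) ⊆ B := hmax
      ⟨(isIrreducible_zeroLocus_iff_of_radical q hq.1.isRadical).mpr hq.1,
        zeroLocus_anti_mono hq.2⟩ (hBP.le.trans (zeroLocus_anti_mono hle))
    have h2 := vanishingIdeal_anti_mono h1
    rwa [vanishingIdeal_zeroLocus_eq_radical, hq.1.radical] at h2
  · rintro ⟨P, hP, rfl⟩
    have := hP.1.1
    refine ⟨⟨(isIrreducible_zeroLocus_iff_of_radical P hP.1.1.isRadical).mpr hP.1.1,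
      zeroLocus_anti_mono hP.1.2⟩, fun T hT hle ↦ ?_⟩
    have hTp := isIrreducible_iff_vanishingIdeal_isPrime.mp hT.1
    have h1 : vanishingIdeal T ≤ P := by
      have := vanishingIdeal_anti_mono hle
      rwa [vanishingIdeal_zeroLocus_eq_radical, hP.1.1.radical] at this
    have h2 := hP.2 ⟨hTp, (subset_zeroLocus_iff_le_vanishingIdeal _ _).mp hT.2⟩ h1
    exact (subset_zeroLocus_iff_le_vanishingIdeal _ _).mpr h2

universe u

/-- Algebraic form of the indecomposability of the branches of a divisor. -/
lemma false_of_disjoint_closures {A B : Type u} [CommRing A] [CommRing B] [Algebra A B]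
    {C : Type*} [CommRing C] [Algebra A C] [IsNoetherianRing A] [IsReduced A] [Module.Finite A B]
    [Module.Flat A C] [IsNoetherianRing C] [IsLocalRing C] (hAB : IsBirationalExtension A B)
    (hA : HasRegularPairs A) {F : Ideal A} (hF : ∀ p ∈ F.minimalPrimes, p.height = 1)
    (hFA : ∀ p ∈ associatedPrimes A (ExtensionQuotient A B), F ≤ p)
    (I₁ I₂ : Set (Set (PrimeSpectrum C))) (h₁ : I₁.Nonempty) (h₂ : I₂.Nonempty)
    (hI : I₁ ∪ I₂ = {T | Maximal (fun T ↦ IsIrreducible T ∧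
      T ⊆ zeroLocus (F.map (algebraMap A C) : Set C)) T})
    (hdisj : Disjoint
      (⋃ T ∈ I₁, closure {Q : PrimeSpectrum (C ⊗[A] B) |
        Q.asIdeal.height = 1 ∧ Q.comap (algebraMap C (C ⊗[A] B)) ∈ T})
      (⋃ T ∈ I₂, closure {Q : PrimeSpectrum (C ⊗[A] B) |
        Q.asIdeal.height = 1 ∧ Q.comap (algebraMap C (C ⊗[A] B)) ∈ T})) : False := by
  have hIiff (T) : T ∈ I₁ ∪ I₂ ↔ ∃ P ∈ (F.map (algebraMap A C)).minimalPrimes,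
      T = zeroLocus (P : Set C) := by rw [hI]; exact maximal_isIrreducible_iff _ _
  have hfin : (I₁ ∪ I₂).Finite := by
    refine ((Ideal.finite_minimalPrimes_of_isNoetherianRing C (F.map (algebraMap A C))).image
      (fun P : Ideal C ↦ zeroLocus (P : Set C))).subset fun T hT ↦ ?_
    obtain ⟨P, hP, rfl⟩ := (hIiff T).mp hT
    exact ⟨P, hP, rfl⟩
  -- a finite union of closures is closed
  have hclosed (I : Set (Set (PrimeSpectrum C))) (hI' : I ⊆ I₁ ∪ I₂) :
      IsClosed (⋃ T ∈ I, closure {Q : PrimeSpectrum (C ⊗[A] B) |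
        Q.asIdeal.height = 1 ∧ Q.comap (algebraMap C (C ⊗[A] B)) ∈ T}) :=
    (hfin.subset hI').isClosed_biUnion fun _ _ ↦ isClosed_closure
  have hc₁ := hclosed I₁ Set.subset_union_left
  have hc₂ := hclosed I₂ Set.subset_union_right
  have hmem {I : Set (Set (PrimeSpectrum C))} (P : Ideal C)
      (hP : P ∈ {P | P ∈ (F.map (algebraMap A C)).minimalPrimes ∧ zeroLocus (P : Set C) ∈ I})
      (Q : Ideal (C ⊗[A] B)) (hQ : Q.IsPrime) (hQ1 : Q.height = 1)
      (hPQ : P ≤ Q.comap (algebraMap C (C ⊗[A] B))) :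
      vanishingIdeal (⋃ T ∈ I, closure {Q : PrimeSpectrum (C ⊗[A] B) |
        Q.asIdeal.height = 1 ∧ Q.comap (algebraMap C (C ⊗[A] B)) ∈ T}) ≤ Q :=
    fun f hf ↦ (mem_vanishingIdeal _ _).mp hf ⟨Q, hQ⟩
      (Set.mem_biUnion hP.2 (subset_closure ⟨hQ1, hPQ⟩))
  have hne {I : Set (Set (PrimeSpectrum C))} (hI' : I ⊆ I₁ ∪ I₂) (h : I.Nonempty) :
      {P | P ∈ (F.map (algebraMap A C)).minimalPrimes ∧ zeroLocus (P : Set C) ∈ I}.Nonempty := by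
    obtain ⟨T, hT⟩ := h
    obtain ⟨P, hP, rfl⟩ := (hIiff T).mp (hI' hT)
    exact ⟨P, hP, hT⟩
  refine false_of_separated_minimalPrimes hAB hA hF hFA _ _ (hne Set.subset_union_left h₁)
    (hne Set.subset_union_right h₂) ?_ _ _ ?_ (fun P hP ↦ hmem P hP) (fun P hP ↦ hmem P hP)
  · ext P
    constructor
    · rintro (h | h) <;> exact h.1
    · intro hP
      exact ((hIiff _).mpr ⟨P, hP, rfl⟩).imp (fun h ↦ ⟨hP, h⟩) (fun h ↦ ⟨hP, h⟩)
  · rw [← zeroLocus_empty_iff_eq_top, zeroLocus_sup, zeroLocus_vanishingIdeal_eq_closure,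
      zeroLocus_vanishingIdeal_eq_closure, hc₁.closure_eq, hc₂.closure_eq]
    exact hdisj.inter_eq

lemma isCodimOne_iff_of_iso {X Y : Scheme.{0}} (e : X ≅ Y) (x : X) :
    IsCodimOne Y (e.hom x) ↔ IsCodimOne X x := by
  rw [IsCodimOne, IsCodimOne,
    ringKrullDim_eq_of_ringEquiv (asIso (e.hom.stalkMap x)).commRingCatIsoToRingEquiv]

lemma isCodimOne_Spec_iff {R : CommRingCat.{0}} (Q : Spec R) :
    IsCodimOne (Spec R) Q ↔ Q.asIdeal.height = 1 := by
  have := Q.isPrime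
  let : Algebra R ((Spec R).presheaf.stalk Q) := StructureSheaf.stalkAlgebra R Q
  have : IsLocalization.AtPrime ((Spec R).presheaf.stalk Q) Q.asIdeal :=
    StructureSheaf.IsLocalization.to_stalk R Q
  have h := IsLocalization.AtPrime.ringKrullDim_eq_height Q.asIdeal ((Spec R).presheaf.stalk Q)
  rw [IsCodimOne, h]
  norm_cast

lemma preimage_support_fromSpec {X : Scheme.{0}} {U : X.Opens} (hU : IsAffineOpen U)
    (I : X.IdealSheafData) {C : CommRingCat.{0}} (φ : Γ(X, U) ⟶ C) :
    (Spec.map φ ≫ hU.fromSpec) ⁻¹' (I.support : Set X) =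
      zeroLocus ((I.ideal ⟨U, hU⟩).map φ.hom : Set C) := by
  ext q
  have hy : hU.fromSpec (Spec.map φ q) ∈ U := by
    rw [← SetLike.mem_coe, ← hU.range_fromSpec]
    exact ⟨_, rfl⟩
  have h : hU.primeIdealOf ⟨_, hy⟩ = Spec.map φ q :=
    hU.fromSpec.isOpenEmbedding.injective (hU.fromSpec_primeIdealOf ⟨_, hy⟩)
  rw [Set.mem_preimage, Scheme.Hom.comp_apply, SetLike.mem_coe,
    mem_support_iff_le_primeIdealOf hU I hy, h]
  exact Ideal.map_le_iff_le_comap.symm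

variable {V : ComplexVariety}

/-- The pullback of an affine morphism along `Spec C ⟶ Spec Γ(X, U) ⟶ X` is affine. -/
lemma isPullback_fromSpec_tensorProduct {X Y : Scheme.{0}} (f : Y ⟶ X) [IsAffineHom f] {U : X.Opens}
    (hU : IsAffineOpen U) {C : Type} [CommRing C] [Algebra Γ(X, U) C] :
    letI := (f.app U).hom.toAlgebra
    IsPullback (Spec.map (CommRingCat.ofHom
        (Algebra.TensorProduct.includeRight : Γ(Y, f ⁻¹ᵁ U) →ₐ[Γ(X, U)] _ ).toRingHom) ≫
        (hU.preimage f).fromSpec)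
      (Spec.map (CommRingCat.ofHom (algebraMap C (C ⊗[Γ(X, U)] Γ(Y, f ⁻¹ᵁ U)))))
      f (Spec.map (CommRingCat.ofHom (algebraMap Γ(X, U) C)) ≫ hU.fromSpec) := by
  let := (f.app U).hom.toAlgebra
  have h1 : IsPullback (hU.preimage f).fromSpec (Spec.map (f.app U)) f hU.fromSpec := by
    refine (IsOpenImmersion.isPullback _ _ _ _ ?_ ?_).flip
    · rw [Scheme.Hom.app_eq_appLE]
      exact (IsAffineOpen.SpecMap_appLE_fromSpec f hU (hU.preimage f) le_rfl).symm
    · rw [hU.opensRange_fromSpec, (hU.preimage f).opensRange_fromSpec]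
  have h2 := isPullback_SpecMap_of_isPushout _ _ _ _
    (CommRingCat.isPushout_tensorProduct Γ(X, U) C Γ(Y, f ⁻¹ᵁ U))
  exact (h2.flip).paste_horiz h1

lemma preimage_closure_codimOne_of_isPullback {X Y : Scheme.{0}} {R T : CommRingCat.{0}}
    {f : Y ⟶ X} {g : Spec R ⟶ X} {p : Spec T ⟶ Y} {q : R ⟶ T}
    (h : IsPullback p (Spec.map q) f g) (B : Set (Spec R)) :
    h.isoPullback.hom ⁻¹' closure {y : (pullback f g : Scheme.{0}) |
        IsCodimOne (pullback f g) y ∧ pullback.snd f g y ∈ B} =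
      closure {Q : PrimeSpectrum T | Q.asIdeal.height = 1 ∧ Q.comap q.hom ∈ B} := by
  refine ((Scheme.homeoOfIso h.isoPullback).preimage_closure _).trans (congrArg closure ?_)
  ext Q
  refine and_congr ((isCodimOne_iff_of_iso h.isoPullback Q).trans (isCodimOne_Spec_iff Q)) ?_
  have : pullback.snd f g (h.isoPullback.hom Q) = Spec.map q Q := by
    rw [← Scheme.Hom.comp_apply, h.isoPullback_hom_snd]
  exact iff_of_eq (congrArg (· ∈ B) this)

/-- The branches of a divisor containing the non-normal locus are not separated by their codimension
one preimages. -/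
theorem not_exists_partition_branches (hS2 : IsS2 V.X) {F : V.X.IdealSheafData} (hF : IsDivisor F)
    (hn : nonNormalLocus V.X ⊆ (F.support : Set V.X)) (x : V.X) :
    ¬ ∃ I₁ I₂ : Set (Set (formalGerm V.X x)),
      I₁ ∪ I₂ = branches x F ∧ Disjoint I₁ I₂ ∧ I₁.Nonempty ∧ I₂.Nonempty ∧
      Disjoint (⋃ B ∈ I₁, codimOnePreimage x B) (⋃ B ∈ I₂, codimOnePreimage x B) := by
  rintro ⟨I₁, I₂, hI, -, h₁, h₂, hdisj⟩
  obtain ⟨U, hU, hxU, -⟩ := exists_isAffineOpen_mem_and_subset (x := x) (U := ⊤) trivial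
  let := ((normalizationMap V.X).app U).hom.toAlgebra
  obtain ⟨hfin, hbir⟩ := normalization_finite_and_isBirationalExtension V hU
  have := isNoetherianRing_sections V hU
  let S := V.X.presheaf.stalk x
  let C := AdicCompletion (IsLocalRing.maximalIdeal S) S
  let := V.X.presheaf.algebra_section_stalk ⟨x, hxU⟩
  have hloc := hU.isLocalization_stalk ⟨x, hxU⟩
  let : Algebra Γ(V.X, U) C := ((algebraMap S C).comp (algebraMap Γ(V.X, U) S)).toAlgebra
  have : IsScalarTower Γ(V.X, U) S C := IsScalarTower.of_algebraMap_eq fun _ ↦ rfl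
  have : Module.Flat Γ(V.X, U) S :=
    IsLocalization.flat S (hU.primeIdealOf ⟨x, hxU⟩).asIdeal.primeCompl
  have : Module.Flat S C := AdicCompletion.flat_of_isNoetherian _
  have : Module.Flat Γ(V.X, U) C := Module.Flat.trans Γ(V.X, U) S C
  have hgerm : formalGermMap V.X x =
      Spec.map (CommRingCat.ofHom (algebraMap Γ(V.X, U) C)) ≫ hU.fromSpec := by
    rw [formalGermMap, ← hU.fromSpecStalk_eq_fromSpecStalk hxU, IsAffineOpen.fromSpecStalk]
    exact (Category.assoc _ _ _).symm.trans
      (congrArg (· ≫ hU.fromSpec) (Spec.map_comp _ _).symm)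
  have hpb := isPullback_fromSpec_tensorProduct (normalizationMap V.X) hU (C := C)
  rw [← hgerm] at hpb
  have hbr : branches x F = {T : Set (PrimeSpectrum C) | Maximal (fun T ↦ IsIrreducible T ∧
      T ⊆ zeroLocus ((F.ideal ⟨U, hU⟩).map (algebraMap Γ(V.X, U) C) : Set C)) T} := by
    have : formalGermMap V.X x ⁻¹' (F.support : Set V.X) =
        zeroLocus ((F.ideal ⟨U, hU⟩).map (algebraMap Γ(V.X, U) C) : Set C) := by
      rw [hgerm]
      exact preimage_support_fromSpec hU F _
    rw [branches, this]
    rfl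
  have hC : IsNoetherianRing C := isNoetherianRing_adicCompletion S _
  refine @false_of_disjoint_closures _ _ _ _ _ C _ _ _ _ _ ‹_› hC inferInstance hbir
    (hasRegularPairs_of_isS2 hU hS2) _ (height_eq_one_of_isDivisor hU hF) ?_ I₁ I₂ h₁ h₂
    (hI.trans hbr) ?_
  · intro p hp
    have := hp.1
    obtain ⟨z, hz, rfl⟩ := exists_primeIdealOf_eq hU p
    exact (mem_support_iff_le_primeIdealOf hU F hz).mp
      (hn (ideal_divPreimage_le_of_mem_associatedPrimes hS2 hU hz hp).1)
  · refine (hdisj.preimage hpb.isoPullback.hom).mono ?_ ?_ <;>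
    exact Set.iUnion₂_subset fun T hT ↦
      (preimage_closure_codimOne_of_isPullback hpb T).ge.trans
        (Set.preimage_mono (Set.subset_biUnion_of_mem (u := codimOnePreimage x) hT))

end AnalyticBranches

end DivGluing

/-! ### Relative spectra -/

namespace DivGluing

section RelativeSpec

open Scheme Scheme.AffineZariskiSite Opposite

variable {X : Scheme.{0}} {E : X.Opensᵒᵖ ⥤ CommRingCat.{0}} {α : X.presheaf ⟶ E}
  (H : ((toOpensFunctor X).op.whiskerLeft α).Coequifibered)

/-- The gluing datum for the spectrum of a quasi-coherent `𝒪_X`-algebra `α : 𝒪_X ⟶ E`.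
Quasi-coherence is encoded by the hypothesis `H`: on affine opens, `E` is compatible with
localization at a function. -/
noncomputable def relativeSpecData : (directedCover X).RelativeGluingData := relativeGluingData H

instance : ((relativeSpecData H).functor ⋙ Scheme.forget).IsLocallyDirected :=
  Cover.RelativeGluingData.instIsLocallyDirectedI₀CompFunctorForgetOfIsThin ..

instance {U V : X.AffineZariskiSite} (i : U ⟶ V) :
    IsOpenImmersion ((relativeSpecData H).functor.map i) :=
  Cover.RelativeGluingData.instIsOpenImmersionMapI₀Functor ..

/-- The relative spectrum of a quasi-coherent `𝒪_X`-algebra `E`. -/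
noncomputable def relativeSpec : Scheme.{0} := (relativeSpecData H).glued

/-- The structure map of the relative spectrum. -/
noncomputable def relativeSpecMap : relativeSpec H ⟶ X := (relativeSpecData H).toBase

/-- The affine chart of the relative spectrum over an affine open `U`. -/
noncomputable def relativeSpecι (U : X.AffineZariskiSite) :
    Spec (E.obj (op U.toOpens)) ⟶ relativeSpec H := colimit.ι (relativeSpecData H).functor U

instance (U : X.AffineZariskiSite) : IsOpenImmersion (relativeSpecι H U) :=
  (relativeSpecData H).cover.map_prop U

lemma relativeSpecι_relativeSpecMap (U : X.AffineZariskiSite) :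
    relativeSpecι H U ≫ relativeSpecMap H = Spec.map (α.app (op U.toOpens)) ≫ U.2.fromSpec :=
  colimit.ι_desc _ _

lemma map_relativeSpecι {U V : X.AffineZariskiSite} (i : U ⟶ V) :
    Spec.map (E.map (homOfLE (toOpens_mono i.le)).op) ≫ relativeSpecι H V = relativeSpecι H U :=
  colimit.w (relativeSpecData H).functor i

lemma relativeSpecMap_preimage (U : X.AffineZariskiSite) :
    relativeSpecMap H ⁻¹ᵁ U.toOpens = (relativeSpecι H U).opensRange := by
  have h := (relativeSpecData H).toBase_preimage_eq_opensRange_ι U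
  have h2 : ((directedCover X).f U).opensRange = U.toOpens := U.1.opensRange_ι
  exact (congrArg (relativeSpecMap H ⁻¹ᵁ ·) h2.symm).trans h

variable {Y : Scheme.{0}} (g : Y ⟶ X) (γ : ∀ U : X.Opens, E.obj (op U) ⟶ Γ(Y, g ⁻¹ᵁ U))

lemma homOfLE_toSpecΓ_relativeSpecι
    (hγ : ∀ U V (i : U ≤ V), E.map (homOfLE i).op ≫ γ U =
      γ V ≫ Y.presheaf.map (homOfLE (g.preimage_mono i)).op)
    {U V : X.AffineZariskiSite} (i : U ⟶ V) :
    Y.homOfLE (g.preimage_mono (toOpens_mono i.le)) ≫ (g ⁻¹ᵁ V.toOpens).toSpecΓ ≫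
      Spec.map (γ V.toOpens) ≫ relativeSpecι H V =
    (g ⁻¹ᵁ U.toOpens).toSpecΓ ≫ Spec.map (γ U.toOpens) ≫ relativeSpecι H U := by
  rw [← map_relativeSpecι H i, ← Scheme.Opens.toSpecΓ_SpecMap_presheaf_map_assoc,
    ← Spec.map_comp_assoc, ← Spec.map_comp_assoc, hγ]

lemma pullbackMap_pullbackRestrictIsoRestrict {X Y : Scheme.{0}} (g : Y ⟶ X) {U V : X.Opens}
    (h : U ≤ V) :
    pullback.map g U.ι g V.ι (𝟙 _) (X.homOfLE h) (𝟙 _) (by simp) (by simp) ≫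
      (pullbackRestrictIsoRestrict g V).hom =
    (pullbackRestrictIsoRestrict g U).hom ≫ Y.homOfLE (g.preimage_mono h) := by
  rw [← cancel_mono (Scheme.Opens.ι _)]
  simp only [Category.assoc, pullbackRestrictIsoRestrict_hom_ι, Scheme.homOfLE_ι]
  exact (pullback.lift_fst _ _ _).trans (Category.comp_id _)

lemma trans_toSpecΓ_relativeSpecι
    (hγ : ∀ U V (i : U ≤ V), E.map (homOfLE i).op ≫ γ U =
      γ V ≫ Y.presheaf.map (homOfLE (g.preimage_mono i)).op)
    {U V : X.AffineZariskiSite} (i : U ⟶ V) :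
    Cover.trans ((directedCover X).pullback₁ g) i ≫ (pullbackRestrictIsoRestrict g V.toOpens).hom ≫
      (g ⁻¹ᵁ V.toOpens).toSpecΓ ≫ Spec.map (γ V.toOpens) ≫ relativeSpecι H V =
    (pullbackRestrictIsoRestrict g U.toOpens).hom ≫
      (g ⁻¹ᵁ U.toOpens).toSpecΓ ≫ Spec.map (γ U.toOpens) ≫ relativeSpecι H U := by
  rw [← homOfLE_toSpecΓ_relativeSpecι H g γ hγ i]
  have : Cover.trans ((directedCover X).pullback₁ g) i ≫ (pullbackRestrictIsoRestrict g V.1).hom =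
      (pullbackRestrictIsoRestrict g U.1).hom ≫
        Y.homOfLE (g.preimage_mono (toOpens_mono i.le)) :=
    pullbackMap_pullbackRestrictIsoRestrict g (toOpens_mono i.le)
  exact (Category.assoc _ _ _).symm.trans
    ((congrArg (· ≫ (g ⁻¹ᵁ V.1).toSpecΓ ≫ Spec.map (γ V.1) ≫ relativeSpecι H V) this).trans
      (Category.assoc _ _ _))

/-- A map of `𝒪_X`-algebras `γ : E ⟶ g_* 𝒪_Y` defines a morphism to the relative spectrum. -/
theorem exists_relativeSpecLift
    (hγ : ∀ U V (i : U ≤ V), E.map (homOfLE i).op ≫ γ U =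
      γ V ≫ Y.presheaf.map (homOfLE (g.preimage_mono i)).op) :
    ∃ l : Y ⟶ relativeSpec H, ∀ U : X.AffineZariskiSite, (g ⁻¹ᵁ U.toOpens).ι ≫ l =
      (g ⁻¹ᵁ U.toOpens).toSpecΓ ≫ Spec.map (γ U.toOpens) ≫ relativeSpecι H U := by
  refine ⟨Scheme.OpenCover.glueMorphismsOfLocallyDirected ((directedCover X).pullback₁ g)
    (fun U ↦ (pullbackRestrictIsoRestrict g U.toOpens).hom ≫
      (g ⁻¹ᵁ U.toOpens).toSpecΓ ≫ Spec.map (γ U.toOpens) ≫ relativeSpecι H U)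
    (fun i ↦ trans_toSpecΓ_relativeSpecι H g γ hγ i), fun U ↦ ?_⟩
  rw [← cancel_epi (pullbackRestrictIsoRestrict g U.toOpens).hom, ← Category.assoc,
    pullbackRestrictIsoRestrict_hom_ι]
  exact Scheme.OpenCover.map_glueMorphismsOfLocallyDirected _ _
    (fun i ↦ trans_toSpecΓ_relativeSpecι H g γ hγ i) U

lemma le_relativeSpecι_preimage (U : X.AffineZariskiSite) :
    ⊤ ≤ relativeSpecι H U ⁻¹ᵁ relativeSpecMap H ⁻¹ᵁ U.toOpens := by
  rw [relativeSpecMap_preimage, Scheme.Hom.preimage_opensRange]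

/-- The identification of the sections of the relative spectrum over the preimage of an affine open
`U` with the sections of `E` over `U`. -/
noncomputable def relativeSpecSections (U : X.AffineZariskiSite) :
    Γ(relativeSpec H, relativeSpecMap H ⁻¹ᵁ U.toOpens) ⟶ E.obj (op U.toOpens) :=
  (relativeSpecι H U).appLE _ ⊤ (le_relativeSpecι_preimage H U) ≫ (Scheme.ΓSpecIso _).hom

instance (U : X.AffineZariskiSite) : IsIso (relativeSpecSections H U) := by
  have : IsIso ((relativeSpecι H U).app (relativeSpecMap H ⁻¹ᵁ U.toOpens)) :=
    Scheme.Hom.isIso_app _ _ (relativeSpecMap_preimage H U).le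
  have h2 := top_le_iff.mp (le_relativeSpecι_preimage H U)
  have h3 : IsIso ((Spec (E.obj (op U.toOpens))).presheaf.map
      (homOfLE (le_relativeSpecι_preimage H U)).op) := by
    have : homOfLE (le_relativeSpecι_preimage H U) = eqToHom h2.symm := rfl
    rw [this]
    infer_instance
  exact IsIso.comp_isIso' (IsIso.comp_isIso' this h3) inferInstance

instance : IsAffineHom (relativeSpecMap H) where
  isAffine_preimage U hU := by
    let U' : X.AffineZariskiSite := ⟨U, hU⟩
    exact (relativeSpecMap_preimage H U') ▸ isAffineOpen_opensRange (relativeSpecι H U')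

lemma comp_appLE_eq {X Y Z : Scheme.{0}} (f : X ⟶ Y) (g : Y ⟶ Z) {U : Z.Opens} {V : Y.Opens}
    {W : X.Opens} (h₁ : W ≤ f ⁻¹ᵁ V) (h₂ : V ≤ g ⁻¹ᵁ U) (h : W ≤ (f ≫ g) ⁻¹ᵁ U) :
    (f ≫ g).appLE U W h = g.appLE U V h₂ ≫ f.appLE V W h₁ :=
  (Scheme.Hom.appLE_comp_appLE ..).symm

lemma appLE_eq_of_comp_relativeSpecι (l : Y ⟶ relativeSpec H) (U : X.AffineZariskiSite)
    (hl : (g ⁻¹ᵁ U.toOpens).ι ≫ l =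
      (g ⁻¹ᵁ U.toOpens).toSpecΓ ≫ Spec.map (γ U.toOpens) ≫ relativeSpecι H U)
    (h : g ⁻¹ᵁ U.toOpens ≤ l ⁻¹ᵁ relativeSpecMap H ⁻¹ᵁ U.toOpens) :
    l.appLE _ _ h = relativeSpecSections H U ≫ γ U.toOpens := by
  have h1 : ⊤ ≤ (g ⁻¹ᵁ U.toOpens).ι ⁻¹ᵁ (g ⁻¹ᵁ U.toOpens) := by simp
  have h2 : ⊤ ≤ (g ⁻¹ᵁ U.toOpens).toSpecΓ ⁻¹ᵁ ⊤ := le_rfl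
  have h3 : ⊤ ≤ Spec.map (γ U.toOpens) ⁻¹ᵁ ⊤ := le_rfl
  have h4 : ⊤ ≤ (Spec.map (γ U.toOpens) ≫ relativeSpecι H U) ⁻¹ᵁ
      relativeSpecMap H ⁻¹ᵁ U.toOpens :=
    h3.trans (Scheme.Hom.preimage_mono _ (le_relativeSpecι_preimage H U))
  have h5 : ⊤ ≤ ((g ⁻¹ᵁ U.toOpens).toSpecΓ ≫ Spec.map (γ U.toOpens) ≫ relativeSpecι H U) ⁻¹ᵁ
      relativeSpecMap H ⁻¹ᵁ U.toOpens :=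
    h2.trans (Scheme.Hom.preimage_mono _ h4)
  have h6 : ⊤ ≤ ((g ⁻¹ᵁ U.toOpens).ι ≫ l) ⁻¹ᵁ relativeSpecMap H ⁻¹ᵁ U.toOpens :=
    h1.trans ((g ⁻¹ᵁ U.toOpens).ι.preimage_mono h)
  have key := appLE_eq_of_eq hl h6 h5
  have e1 : (g ⁻¹ᵁ U.toOpens).ι.appLE _ ⊤ h1 = (g ⁻¹ᵁ U.toOpens).topIso.inv := by
    rw [Scheme.Opens.ι_appLE, Scheme.Opens.topIso_inv]
    rfl
  have e2 : (Spec.map (γ U.toOpens)).appLE ⊤ ⊤ h3 =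
      (Scheme.ΓSpecIso _).hom ≫ γ U.toOpens ≫ (Scheme.ΓSpecIso _).inv := by
    rw [← Scheme.ΓSpecIso_naturality_assoc, Iso.hom_inv_id, Category.comp_id]
    exact Scheme.Hom.appLE_eq_app _
  have e3 : (g ⁻¹ᵁ U.toOpens).toSpecΓ.appLE ⊤ ⊤ h2 =
      (Scheme.ΓSpecIso _).hom ≫ (g ⁻¹ᵁ U.toOpens).topIso.inv :=
    (Scheme.Hom.appLE_eq_app _).trans (Scheme.Opens.toSpecΓ_appTop _)
  rw [comp_appLE_eq _ _ h1 h, comp_appLE_eq _ _ h2 h4,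
    comp_appLE_eq _ _ h3 (le_relativeSpecι_preimage H U), e1, e2, e3] at key
  rw [← cancel_mono (g ⁻¹ᵁ U.toOpens).topIso.inv, key]
  simp only [relativeSpecSections, Category.assoc, Iso.inv_hom_id_assoc]

lemma hom_ext_of_affineOpens {T : Scheme.{0}} {f f' : Y ⟶ T}
    (h : ∀ U : X.AffineZariskiSite, (g ⁻¹ᵁ U.toOpens).ι ≫ f = (g ⁻¹ᵁ U.toOpens).ι ≫ f') : f = f' :=
  Scheme.Cover.hom_ext (Y.openCoverOfIsOpenCover _
    (.comap (iSup_affineOpens_eq_top X) g.base.hom)) _ _ h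

lemma comp_relativeSpecMap (hα : ∀ U, α.app (op U) ≫ γ U = g.app U) (l : Y ⟶ relativeSpec H)
    (hl : ∀ U : X.AffineZariskiSite, (g ⁻¹ᵁ U.toOpens).ι ≫ l =
      (g ⁻¹ᵁ U.toOpens).toSpecΓ ≫ Spec.map (γ U.toOpens) ≫ relativeSpecι H U) :
    l ≫ relativeSpecMap H = g := by
  refine hom_ext_of_affineOpens g fun U ↦ ?_
  have h := congrArg (· ≫ relativeSpecMap H) (hl U)
  simp only [Category.assoc, relativeSpecι_relativeSpecMap] at h
  rw [h, ← Spec.map_comp_assoc, hα]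
  simp

end RelativeSpec

end DivGluing

/-! ### Fibre products of structure sheaves -/

namespace DivGluing

section FibreProduct

/-- Elements of a fibre product of rings over a principal localization come from elements of the
fibre product after multiplication by a power. -/
lemma exists_mem_fibreProduct_of_away {B C M B' C' M' : Type*} [CommRing B] [CommRing C]
    [CommRing M] [CommRing B'] [CommRing C'] [CommRing M'] {f : B →+* M} {g : C →+* M}
    {f' : B' →+* M'} {g' : C' →+* M'} {ρB : B →+* B'} {ρC : C →+* C'} {ρM : M →+* M'}
    (hf : ∀ s, f' (ρB s) = ρM (f s)) (hg : ∀ t, g' (ρC t) = ρM (g t)) {β : B} {γ : C}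
    (hβγ : f β = g γ) (hB : ∀ s, ∃ n s', ρB s' = ρB β ^ n * s)
    (hC : ∀ t, ∃ n t', ρC t' = ρC γ ^ n * t) (hM : ∀ m, ρM m = 0 → ∃ n, f β ^ n * m = 0)
    {s : B'} {t : C'} (hst : f' s = g' t) :
    ∃ n s' t', f s' = g t' ∧ ρB s' = ρB β ^ n * s ∧ ρC t' = ρC γ ^ n * t := by
  obtain ⟨n, s', hs⟩ := hB s
  obtain ⟨m, t', ht⟩ := hC t
  have h0 : ρM (f (β ^ m * s') - g (γ ^ n * t')) = 0 := by
    rw [map_sub, ← hf, ← hg, map_mul, map_mul, map_mul, map_mul, hs, ht, sub_eq_zero]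
    simp only [map_mul, map_pow, hf, hg, hst, hβγ]
    ring
  obtain ⟨k, hk⟩ := hM _ h0
  refine ⟨k + m + n, β ^ (k + m) * s', γ ^ (k + n) * t', ?_, ?_, ?_⟩
  · rw [mul_sub, sub_eq_zero] at hk
    simp only [map_mul, map_pow, pow_add, mul_assoc] at hk ⊢
    rw [hk, hβγ]
  · rw [map_mul, hs, map_pow]; ring
  · rw [map_mul, ht, map_pow]; ring

lemma exists_map_eq_pow_mul {Y : Scheme.{0}} {V V' : Y.Opens} (hV : IsAffineOpen V) (f : Γ(Y, V))
    (h : V' = Y.basicOpen f) (i : V' ≤ V) (s : Γ(Y, V')) :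
    ∃ (n : ℕ) (s' : Γ(Y, V)), (Y.presheaf.map (homOfLE i).op).hom s' =
      (Y.presheaf.map (homOfLE i).op).hom f ^ n * s := by
  subst h
  have := hV.isLocalization_basicOpen f
  obtain ⟨n, s', h⟩ := IsLocalization.Away.surj f s
  exact ⟨n, s', (mul_comm _ _).trans h |>.symm⟩

lemma exists_pow_mul_eq_zero {Y : Scheme.{0}} {V V' : Y.Opens} (hV : IsAffineOpen V) (f : Γ(Y, V))
    (h : V' = Y.basicOpen f) (i : V' ≤ V) (s : Γ(Y, V))
    (hs : (Y.presheaf.map (homOfLE i).op).hom s = 0) : ∃ n : ℕ, f ^ n * s = 0 := by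
  subst h
  have := hV.isLocalization_basicOpen f
  obtain ⟨⟨_, n, rfl⟩, h⟩ := IsLocalization.exists_of_eq (M := .powers f)
    (S := Γ(Y, Y.basicOpen f))
    (show algebraMap Γ(Y, V) _ s = algebraMap Γ(Y, V) _ 0 from hs.trans (map_zero _).symm)
  exact ⟨n, by simpa using h⟩

open Scheme Scheme.AffineZariskiSite Opposite

variable {X Y W Z : Scheme.{0}} (a : Z ⟶ Y) (b : Z ⟶ W) (y : Y ⟶ X) (w : W ⟶ X)

lemma preimage_le_preimage_of_comp_eq (h : a ≫ y = b ≫ w) (U : X.Opens) :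
    (a ≫ y) ⁻¹ᵁ U ≤ b ⁻¹ᵁ w ⁻¹ᵁ U :=
  (congrArg (· ⁻¹ᵁ U) h).le

/-- The ring of pairs of functions on `Y` and `W`, over `U`, that agree on `Z`. -/
def fibreProduct (h : a ≫ y = b ≫ w) (U : X.Opens) : Subring (Γ(Y, y ⁻¹ᵁ U) × Γ(W, w ⁻¹ᵁ U)) :=
  RingHom.eqLocus ((a.appLE (y ⁻¹ᵁ U) ((a ≫ y) ⁻¹ᵁ U)
    (preimage_le_preimage_of_comp_eq a a y y rfl U)).hom.comp (RingHom.fst _ _))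
    ((b.appLE (w ⁻¹ᵁ U) ((a ≫ y) ⁻¹ᵁ U) (preimage_le_preimage_of_comp_eq a b y w h U)).hom.comp
      (RingHom.snd _ _))

lemma appLE_presheaf_map_apply {Y Z : Scheme.{0}} (a : Z ⟶ Y) {V V' : Y.Opens} {T T' : Z.Opens}
    (i : V' ≤ V) (j : T' ≤ T) (e : T ≤ a ⁻¹ᵁ V) (e' : T' ≤ a ⁻¹ᵁ V') (s : Γ(Y, V)) :
    (a.appLE V' T' e').hom ((Y.presheaf.map (homOfLE i).op).hom s) =
      (Z.presheaf.map (homOfLE j).op).hom ((a.appLE V T e).hom s) := by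
  have : Y.presheaf.map (homOfLE i).op ≫ a.appLE V' T' e' =
      a.appLE V T e ≫ Z.presheaf.map (homOfLE j).op := by
    rw [Scheme.Hom.map_appLE, Scheme.Hom.appLE_map]
  exact congrArg (fun t ↦ t.hom s) this

lemma map_mem_fibreProduct (h : a ≫ y = b ≫ w) {U V : X.Opens} (i : U ≤ V)
    (e : Γ(Y, y ⁻¹ᵁ V) × Γ(W, w ⁻¹ᵁ V)) (he : e ∈ fibreProduct a b y w h V) :
    ((Y.presheaf.map (homOfLE (y.preimage_mono i)).op).hom.prodMap
      (W.presheaf.map (homOfLE (w.preimage_mono i)).op).hom) e ∈ fibreProduct a b y w h U :=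
  ((appLE_presheaf_map_apply a (y.preimage_mono i) ((a ≫ y).preimage_mono i) _ _ e.1).trans
    (congrArg (Z.presheaf.map (homOfLE ((a ≫ y).preimage_mono i)).op).hom he)).trans
    (appLE_presheaf_map_apply b (w.preimage_mono i) ((a ≫ y).preimage_mono i) _ _ e.2).symm

/-- The presheaf of rings `y_* 𝒪_Y ×_{z_* 𝒪_Z} w_* 𝒪_W` on `X`. -/
def fibreProductPresheaf (h : a ≫ y = b ≫ w) : X.Opensᵒᵖ ⥤ CommRingCat.{0} where
  obj U := .of (fibreProduct a b y w h U.unop)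
  map i := CommRingCat.ofHom (((Y.presheaf.map (homOfLE (y.preimage_mono i.unop.le)).op).hom.prodMap
      (W.presheaf.map (homOfLE (w.preimage_mono i.unop.le)).op).hom).restrict _ _
      (map_mem_fibreProduct a b y w h i.unop.le))
  map_id U := by
    ext e
    · exact congrArg (fun t ↦ t.hom e.1.1) (Y.presheaf.map_id _)
    · exact congrArg (fun t ↦ t.hom e.1.2) (W.presheaf.map_id _)
  map_comp {U V T} i j := by
    ext e
    · exact congrArg (fun t ↦ t.hom e.1.1) (Y.presheaf.map_comp
        (homOfLE (y.preimage_mono i.unop.le)).op (homOfLE (y.preimage_mono j.unop.le)).op)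
    · exact congrArg (fun t ↦ t.hom e.1.2) (W.presheaf.map_comp
        (homOfLE (w.preimage_mono i.unop.le)).op (homOfLE (w.preimage_mono j.unop.le)).op)

lemma app_prod_mem_fibreProduct (h : a ≫ y = b ≫ w) (U : X.Opens) (r : Γ(X, U)) :
    ((y.app U).hom.prod (w.app U).hom) r ∈ fibreProduct a b y w h U := by
  have h1 : y.app U ≫ a.appLE (y ⁻¹ᵁ U) ((a ≫ y) ⁻¹ᵁ U)
      (preimage_le_preimage_of_comp_eq a a y y rfl U) = w.app U ≫ b.appLE (w ⁻¹ᵁ U)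
      ((a ≫ y) ⁻¹ᵁ U) (preimage_le_preimage_of_comp_eq a b y w h U) := by
    rw [Scheme.Hom.app_eq_appLE, Scheme.Hom.app_eq_appLE, Scheme.Hom.appLE_comp_appLE,
      Scheme.Hom.appLE_comp_appLE]
    exact appLE_eq_of_eq h _ _
  exact congrArg (fun t ↦ t.hom r) h1

/-- The structure map of `y_* 𝒪_Y ×_{z_* 𝒪_Z} w_* 𝒪_W` as an `𝒪_X`-algebra. -/
def toFibreProductPresheaf (h : a ≫ y = b ≫ w) : X.presheaf ⟶ fibreProductPresheaf a b y w h where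
  app U := CommRingCat.ofHom (((y.app U.unop).hom.prod (w.app U.unop).hom).codRestrict _
    (app_prod_mem_fibreProduct a b y w h U.unop))
  naturality U V i := by
    ext r
    refine Subtype.ext (Prod.ext ?_ ?_)
    · exact congrArg (fun t ↦ t.hom r) (y.naturality i)
    · exact congrArg (fun t ↦ t.hom r) (w.naturality i)

/-- The `𝒪_X`-algebra `y_* 𝒪_Y ×_{z_* 𝒪_Z} w_* 𝒪_W` is quasi-coherent. -/
lemma coequifibered_toFibreProductPresheaf [IsAffineHom y] [IsAffineHom w] [IsAffineHom a]
    (h : a ≫ y = b ≫ w) :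
    ((toOpensFunctor X).op.whiskerLeft (toFibreProductPresheaf a b y w h)).Coequifibered := by
  refine coequifibered_iff_forall_isLocalizationAway.mpr fun U r ↦ ?_
  let α := toFibreProductPresheaf a b y w h
  let : Algebra (fibreProduct a b y w h U.1) (fibreProduct a b y w h (U.basicOpen r).1) :=
    ((fibreProductPresheaf a b y w h).map (homOfLE (X.basicOpen_le r)).op).hom.toAlgebra
  let x : fibreProduct a b y w h U.1 := (α.app (op U.1)).hom r
  change IsLocalization.Away x (fibreProduct a b y w h (U.basicOpen r).1)
  have hyr : (y ⁻¹ᵁ (U.basicOpen r).1) = Y.basicOpen ((y.app U.1).hom r) := y.preimage_basicOpen r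
  have hwr : (w ⁻¹ᵁ (U.basicOpen r).1) = W.basicOpen ((w.app U.1).hom r) := w.preimage_basicOpen r
  have hzr : ((a ≫ y) ⁻¹ᵁ (U.basicOpen r).1) = Z.basicOpen (((a ≫ y).app U.1).hom r) :=
    (a ≫ y).preimage_basicOpen r
  have hzm : ((a ≫ y).app U.1).hom r = (a.appLE (y ⁻¹ᵁ U.1) ((a ≫ y) ⁻¹ᵁ U.1)
      (preimage_le_preimage_of_comp_eq a a y y rfl U.1)).hom ((y.app U.1).hom r) := by
    have := congrArg (y.app U.1 ≫ ·) (a.appLE_eq_app (U := y ⁻¹ᵁ U.1))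
    exact congrArg (fun t ↦ t.hom r) ((a.comp_app y U.1).trans this.symm)
  have hU : IsAffineOpen U.1 := U.2
  have hr : IsUnit ((X.presheaf.map (homOfLE (X.basicOpen_le r)).op).hom r) :=
    RingedSpace.isUnit_res_basicOpen _ r
  constructor
  constructor
  · rintro ⟨_, n, rfl⟩
    rw [map_pow]
    refine IsUnit.pow n ?_
    have := congrArg (fun t ↦ t.hom r) (α.naturality (homOfLE (X.basicOpen_le r)).op)
    exact this ▸ hr.map (α.app (op (U.basicOpen r).1)).hom
  · rintro ⟨⟨s, t⟩, hst⟩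
    obtain ⟨n, s', t', h1, h2, h3⟩ := exists_mem_fibreProduct_of_away
      (β := (y.app U.1).hom r) (γ := (w.app U.1).hom r)
      (fun s ↦ appLE_presheaf_map_apply a (y.preimage_mono (X.basicOpen_le r))
        ((a ≫ y).preimage_mono (X.basicOpen_le r)) (preimage_le_preimage_of_comp_eq a a y y rfl _)
        (preimage_le_preimage_of_comp_eq a a y y rfl _) s)
      (fun t ↦ appLE_presheaf_map_apply b (w.preimage_mono (X.basicOpen_le r))
        ((a ≫ y).preimage_mono (X.basicOpen_le r))
        (preimage_le_preimage_of_comp_eq a b y w h _)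
        (preimage_le_preimage_of_comp_eq a b y w h _) t)
      (app_prod_mem_fibreProduct a b y w h U.1 r)
      (exists_map_eq_pow_mul (hU.preimage y) _ hyr _)
      (exists_map_eq_pow_mul (hU.preimage w) _ hwr _)
      (fun m hm ↦ hzm ▸ exists_pow_mul_eq_zero (hU.preimage (a ≫ y)) _ hzr
        ((a ≫ y).preimage_mono (X.basicOpen_le r)) m hm) hst
    refine ⟨⟨⟨(s', t'), h1⟩, ⟨_, n, rfl⟩⟩, ?_⟩
    refine Subtype.ext (Prod.ext ?_ ?_)
    · refine ((mul_comm _ _).trans (congrArg (· * s) ?_)).trans h2.symm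
      exact map_pow ((RingHom.fst _ _).comp ((Subring.subtype _).comp (algebraMap
        (fibreProduct a b y w h U.1) (fibreProduct a b y w h (U.basicOpen r).1)))) x n
    · refine ((mul_comm _ _).trans (congrArg (· * t) ?_)).trans h3.symm
      exact map_pow ((RingHom.snd _ _).comp ((Subring.subtype _).comp (algebraMap
        (fibreProduct a b y w h U.1) (fibreProduct a b y w h (U.basicOpen r).1)))) x n
  · rintro ⟨⟨s, t⟩, hst⟩ ⟨⟨s', t'⟩, hst'⟩ he
    have he1 := congrArg (fun e ↦ e.1.1) he
    have he2 := congrArg (fun e ↦ e.1.2) he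
    obtain ⟨n, hn⟩ := exists_pow_mul_eq_zero (hU.preimage y) _ hyr
      (y.preimage_mono (X.basicOpen_le r)) (s - s') (by rw [map_sub, sub_eq_zero]; exact he1)
    obtain ⟨m, hm⟩ := exists_pow_mul_eq_zero (hU.preimage w) _ hwr
      (w.preimage_mono (X.basicOpen_le r)) (t - t') (by rw [map_sub, sub_eq_zero]; exact he2)
    rw [mul_sub, sub_eq_zero] at hn hm
    refine ⟨⟨_, n + m, rfl⟩, Subtype.ext (Prod.ext ?_ ?_)⟩
    · change ((y.app U.1).hom r) ^ (n + m) * s = ((y.app U.1).hom r) ^ (n + m) * s'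
      rw [add_comm, pow_add, mul_assoc, hn, mul_assoc]
    · change ((w.app U.1).hom r) ^ (n + m) * t = ((w.app U.1).hom r) ^ (n + m) * t'
      rw [pow_add, mul_assoc, hm, mul_assoc]

end FibreProduct

end DivGluing

namespace DivGluing

section RelativePushout

open Scheme Scheme.AffineZariskiSite Opposite

variable {X Y W Z : Scheme.{0}} (a : Z ⟶ Y) (b : Z ⟶ W) (y : Y ⟶ X) (w : W ⟶ X)

lemma ι_comp_comp_eq {P : Scheme.{0}} {U : X.Opens} {T : CommRingCat} (i : Y ⟶ P)
    (φ : T ⟶ Γ(Y, y ⁻¹ᵁ U))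
    (ι : Spec T ⟶ P) (hi : (y ⁻¹ᵁ U).ι ≫ i = (y ⁻¹ᵁ U).toSpecΓ ≫ Spec.map φ ≫ ι) {V : Z.Opens}
    (hV : V ≤ a ⁻¹ᵁ y ⁻¹ᵁ U) :
    V.ι ≫ a ≫ i = V.toSpecΓ ≫ Spec.map (φ ≫ a.appLE _ _ hV) ≫ ι := by
  rw [← Scheme.Hom.resLE_comp_ι_assoc a hV, hi, Spec.map_comp_assoc,
    Scheme.Opens.toSpecΓ_SpecMap_appLE_assoc]

/-- The affine morphism to `X` with structure sheaf `y_* 𝒪_Y ×_{z_* 𝒪_Z} w_* 𝒪_W`. -/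
theorem exists_relativeSpec_fibreProduct [IsAffineHom y] [IsAffineHom w] [IsAffineHom a]
    (h : a ≫ y = b ≫ w) :
    ∃ (P : Scheme.{0}) (π : P ⟶ X) (i : Y ⟶ P) (j : W ⟶ P) (hi : i ≫ π = y) (hj : j ≫ π = w),
      IsAffineHom π ∧ a ≫ i = b ≫ j ∧
      ∀ U, IsAffineOpen U → ∃ σ : Γ(P, π ⁻¹ᵁ U) ≃+* fibreProduct a b y w h U, ∀ r,
        (σ r).1.1 = (i.appLE _ (y ⁻¹ᵁ U) (preimage_le_preimage_of_comp_eq _ _ _ _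
          ((Category.id_comp _).trans hi.symm : 𝟙 _ ≫ y = i ≫ π) U)).hom r ∧
        (σ r).1.2 = (j.appLE _ (w ⁻¹ᵁ U) (preimage_le_preimage_of_comp_eq _ _ _ _
          ((Category.id_comp _).trans hj.symm : 𝟙 _ ≫ w = j ≫ π) U)).hom r := by
  let H := coequifibered_toFibreProductPresheaf a b y w h
  let γY (U : X.Opens) : (fibreProductPresheaf a b y w h).obj (op U) ⟶ Γ(Y, y ⁻¹ᵁ U) :=
    CommRingCat.ofHom ((RingHom.fst _ _).comp (Subring.subtype _))
  let γW (U : X.Opens) : (fibreProductPresheaf a b y w h).obj (op U) ⟶ Γ(W, w ⁻¹ᵁ U) :=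
    CommRingCat.ofHom ((RingHom.snd _ _).comp (Subring.subtype _))
  obtain ⟨i, hi⟩ := exists_relativeSpecLift H y γY (fun U V i ↦ rfl)
  obtain ⟨j, hj⟩ := exists_relativeSpecLift H w γW (fun U V i ↦ rfl)
  refine ⟨relativeSpec H, relativeSpecMap H, i, j, comp_relativeSpecMap H y γY (fun U ↦ rfl) i hi,
    comp_relativeSpecMap H w γW (fun U ↦ rfl) j hj, inferInstance, ?_, fun U hU ↦ ?_⟩
  · refine hom_ext_of_affineOpens (a ≫ y) fun U ↦ ?_
    rw [ι_comp_comp_eq a y i _ _ (hi U) (preimage_le_preimage_of_comp_eq a a y y rfl _),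
      ι_comp_comp_eq b w j _ _ (hj U) (preimage_le_preimage_of_comp_eq a b y w h _)]
    refine congrArg (fun t ↦ _ ≫ Spec.map t ≫ _) ?_
    ext e
    exact e.2
  · let U' : X.AffineZariskiSite := ⟨U, hU⟩
    refine ⟨(asIso (relativeSpecSections H U')).commRingCatIsoToRingEquiv, fun r ↦ ⟨?_, ?_⟩⟩
    · exact (congrArg (fun t ↦ t.hom r) (appLE_eq_of_comp_relativeSpecι H y γY i U' (hi U') _)).symm
    · exact (congrArg (fun t ↦ t.hom r) (appLE_eq_of_comp_relativeSpecι H w γW j U' (hj U') _)).symm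

end RelativePushout

end DivGluing

/-! ### Descent of morphisms -/

namespace DivGluing

section Descent

open Opposite

/-- Descent of a morphism `Y ⟶ T` along `i : Y ⟶ P`, given the continuous map `φ : P ⟶ T`; the
morphism is spelled out as `⟨i.base ≫ φ, fc⟩` so that its pullback of functions has values in
`(i.base ≫ φ)_* 𝒪_Y` on the nose. -/
lemma exists_comp_eq_of_forall_exists_app_eq {Y P T : Scheme.{0}} (i : Y ⟶ P)
    (hinj : ∀ Ω : P.Opens, Function.Injective (i.app Ω)) (hi : Function.Surjective i)
    (φ : (P.toPresheafedSpace : TopCat) ⟶ (T.toPresheafedSpace : TopCat))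
    (fc : T.presheaf ⟶ (i.base ≫ φ) _* Y.presheaf)
    (hloc : ∀ x, IsLocalHom (PresheafedSpace.Hom.stalkMap
      (⟨i.base ≫ φ, fc⟩ : Y.toPresheafedSpace.Hom T.toPresheafedSpace) x).hom)
    (hr : ∀ (V : T.Opens) (r : Γ(T, V)), ∃ p : Γ(P, (TopologicalSpace.Opens.map φ).obj V),
      (i.app _).hom p = (fc.app (op V)).hom r) :
    ∃ g : P ⟶ T, i ≫ g = ⟨⟨⟨i.base ≫ φ, fc⟩, hloc⟩⟩ := by
  choose l hl using hr
  have hl' (V : T.Opens) (r : Γ(T, V)) (p : Γ(P, (TopologicalSpace.Opens.map φ).obj V))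
      (h : (i.app _).hom p = (fc.app (op V)).hom r) : l V r = p :=
    hinj _ ((hl V r).trans h.symm)
  let c : T.presheaf ⟶ φ _* P.presheaf :=
    { app V := CommRingCat.ofHom
        { toFun := l V.unop
          map_one' := hl' _ _ _ ((map_one _).trans (map_one _).symm)
          map_zero' := hl' _ _ _ ((map_zero _).trans (map_zero _).symm)
          map_mul' r s := hl' _ _ _ (by rw [map_mul, map_mul]; exact congrArg₂ _ (hl _ _) (hl _ _))
          map_add' r s := hl' _ _ _ (by
            rw [map_add, map_add]; exact congrArg₂ _ (hl _ _) (hl _ _)) }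
      naturality U V j := by
        ext r
        refine hl' _ _ _ ?_
        have h1 := congrArg (fun t ↦ t.hom (l U.unop r))
          (i.naturality ((TopologicalSpace.Opens.map φ).map j.unop).op)
        have h2 := congrArg (fun t ↦ t.hom r) (fc.naturality j)
        refine h1.trans (Eq.trans ?_ h2.symm)
        exact congrArg (((i.base ≫ φ) _* Y.presheaf).map j).hom (hl U.unop r) }
  let G : P.toPresheafedSpace ⟶ T.toPresheafedSpace := ⟨φ, c⟩
  have hG : i.toHom ≫ G = (⟨i.base ≫ φ, fc⟩ : Y.toPresheafedSpace.Hom T.toPresheafedSpace) := by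
    have hd : (i.toHom ≫ G).c = fc := by
      ext V r
      exact hl V r
    exact congrArg (PresheafedSpace.Hom.mk _) hd
  refine ⟨⟨⟨G, fun x ↦ ?_⟩⟩, ?_⟩
  · obtain ⟨x, rfl⟩ := hi x
    have h1 := PresheafedSpace.stalkMap.comp i.toHom G x
    have h2 := hloc x
    rw [← hG] at h2
    have h3 := congrArg CommRingCat.Hom.hom h1 ▸ h2
    have : IsLocalHom ((i.toHom.stalkMap x).hom.comp (G.stalkMap (i x)).hom) := h3
    exact isLocalHom_of_comp _ (i.toHom.stalkMap x).hom
  · exact Scheme.Hom.ext' (LocallyRingedSpace.Hom.ext' hG)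

/-- A morphism descends along a scheme-theoretically dominant quotient map as soon as it is constant
on the fibres and pulls back functions to functions coming from the target. -/
lemma exists_comp_eq_of_isQuotientMap {Y P T : Scheme.{0}} (i : Y ⟶ P)
    [IsSchemeTheoreticallyDominant i] [QuasiCompact i] (hi : Topology.IsQuotientMap i) (f : Y ⟶ T)
    (hf : ∀ y y', i y = i y' → f y = f y')
    (hr : ∀ (V : T.Opens) (Ω : P.Opens) (e : i ⁻¹ᵁ Ω ≤ f ⁻¹ᵁ V) (r : Γ(T, V)),
      ∃ p, (i.app Ω).hom p = (f.appLE V _ e).hom r) : ∃ g : P ⟶ T, i ≫ g = f := by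
  obtain ⟨φ, hφ⟩ : ∃ φ : (P.toPresheafedSpace : TopCat) ⟶ (T.toPresheafedSpace : TopCat),
      i.base ≫ φ = f.base := by
    refine ⟨TopCat.ofHom (hi.lift f.base.hom hf), ?_⟩
    ext x
    exact congrArg (fun t ↦ t x) (hi.lift_comp f.base.hom hf)
  replace hr (V : T.Opens) (r : Γ(T, V)) :
    ∃ p : Γ(P, (TopologicalSpace.Opens.map φ).obj V), (i.app _).hom p = (f.appLE V
      ((TopologicalSpace.Opens.map (i.base ≫ φ)).obj V) (hφ ▸ le_rfl)).hom r := hr V _ _ r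
  obtain ⟨⟨⟨fb, fc⟩, hloc⟩⟩ := f
  change i.base ≫ φ = fb at hφ
  subst hφ
  refine exists_comp_eq_of_forall_exists_app_eq i i.app_injective hi.surjective φ fc hloc
    fun V r ↦ ?_
  obtain ⟨p, hp⟩ := hr V r
  let f : Y ⟶ T := ⟨⟨⟨i.base ≫ φ, fc⟩, hloc⟩⟩
  exact ⟨p, hp.trans (congrArg (fun t ↦ t.hom r) (f.appLE_eq_app (U := V)))⟩

lemma hom_ext_of_surjective {Y P T : Scheme.{0}} (i : Y ⟶ P)
    [IsSchemeTheoreticallyDominant i] [QuasiCompact i] [Surjective i] {g g' : P ⟶ T}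
    (h : i ≫ g = i ≫ g') : g = g' := by
  have hb : g.base = g'.base := by
    ext x
    obtain ⟨x, rfl⟩ := i.surjective x
    exact congrArg (fun t : Y ⟶ T ↦ t x) h
  refine Scheme.Hom.ext hb fun U ↦ ?_
  have hU : g' ⁻¹ᵁ U ≤ g ⁻¹ᵁ U := by
    rintro x hx
    exact (congrArg (fun t ↦ t x ∈ U) hb).mpr hx
  have key : g.appLE U (g' ⁻¹ᵁ U) hU ≫ i.appLE _ (i ⁻¹ᵁ g' ⁻¹ᵁ U) le_rfl =
      g'.appLE U (g' ⁻¹ᵁ U) le_rfl ≫ i.appLE _ (i ⁻¹ᵁ g' ⁻¹ᵁ U) le_rfl :=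
    (comp_appLE_eq i g le_rfl hU (i.preimage_mono hU)).symm.trans
      ((appLE_eq_of_eq h _ _).trans (comp_appLE_eq i g' le_rfl le_rfl le_rfl))
  rw [Scheme.Hom.appLE_eq_app, Scheme.Hom.appLE_eq_app] at key
  ext r
  exact i.app_injective _ (congrArg (fun t ↦ t.hom r) key)

end Descent

end DivGluing

/-! ### A criterion for pushouts of schemes -/

namespace DivGluing

section PushoutCriterion

open Opposite

variable {P Y W Z T : Scheme.{0}} {a : Z ⟶ Y} {b : Z ⟶ W} {i : Y ⟶ P} {j : W ⟶ P}

/-- The functions on the open `U` of `P` include all pairs of functions on its preimages in `Y`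
and `W` that agree on `Z`. -/
def HasGluedSections (h : a ≫ i = b ≫ j) (U : P.Opens) : Prop :=
  ∀ (s : Γ(Y, i ⁻¹ᵁ U)) (t : Γ(W, j ⁻¹ᵁ U)),
    (a.appLE _ _ (preimage_le_preimage_of_comp_eq a a i i rfl U)).hom s =
      (b.appLE _ _ (preimage_le_preimage_of_comp_eq a b i j h U)).hom t →
    ∃ r : Γ(P, U), (i.app U).hom r = s ∧ (j.app U).hom r = t

lemma app_presheaf_map_apply {Y Z : Scheme.{0}} (a : Z ⟶ Y) {V V' : Y.Opens}
    (e : V' ≤ V) (s : Γ(Y, V)) :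
    (a.app V').hom ((Y.presheaf.map (homOfLE e).op).hom s) =
      (Z.presheaf.map (homOfLE (a.preimage_mono e)).op).hom ((a.app V).hom s) :=
  congrArg (fun t ↦ t.hom s) (a.naturality (homOfLE e).op)

/-- Gluing of functions over an affine open passes to its principal opens. -/
lemma exists_app_eq_basicOpen [IsAffineHom a] [IsAffineHom i] [IsAffineHom j] (h : a ≫ i = b ≫ j)
    {U : P.Opens} (hU : IsAffineOpen U) (hg : HasGluedSections h U) (f : Γ(P, U))
    (s : Γ(Y, i ⁻¹ᵁ P.basicOpen f)) (t : Γ(W, j ⁻¹ᵁ P.basicOpen f))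
    (hst : (a.appLE _ _ (preimage_le_preimage_of_comp_eq a a i i rfl (P.basicOpen f))).hom s =
      (b.appLE _ _ (preimage_le_preimage_of_comp_eq a b i j h (P.basicOpen f))).hom t) :
    ∃ p, (i.app (P.basicOpen f)).hom p = s := by
  have hf : IsUnit ((P.presheaf.map (homOfLE (P.basicOpen_le f)).op).hom f) :=
    RingedSpace.isUnit_res_basicOpen _ f
  have h1 : i.app U ≫ a.appLE (i ⁻¹ᵁ U) ((a ≫ i) ⁻¹ᵁ U)
      (preimage_le_preimage_of_comp_eq a a i i rfl U) = (a ≫ i).app U := by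
    have := congrArg (i.app U ≫ ·) (a.appLE_eq_app (U := i ⁻¹ᵁ U))
    exact this.trans (a.comp_app i U).symm
  have h2 : i.app U ≫ a.appLE (i ⁻¹ᵁ U) ((a ≫ i) ⁻¹ᵁ U)
      (preimage_le_preimage_of_comp_eq a a i i rfl U) = j.app U ≫ b.appLE (j ⁻¹ᵁ U)
      ((a ≫ i) ⁻¹ᵁ U) (preimage_le_preimage_of_comp_eq a b i j h U) := by
    rw [h1, Scheme.Hom.app_eq_appLE, Scheme.Hom.app_eq_appLE, Scheme.Hom.appLE_comp_appLE]
    exact appLE_eq_of_eq h _ _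
  have hM (m) (hm : (Z.presheaf.map (homOfLE ((a ≫ i).preimage_mono (P.basicOpen_le f))).op).hom m
      = 0) := exists_pow_mul_eq_zero (hU.preimage (a ≫ i)) (((a ≫ i).app U).hom f)
        ((a ≫ i).preimage_basicOpen f) ((a ≫ i).preimage_mono (P.basicOpen_le f)) m hm
  rw [← h1] at hM
  obtain ⟨n, s', t', h3, h4, -⟩ := exists_mem_fibreProduct_of_away
      (β := (i.app U).hom f) (γ := (j.app U).hom f)
      (fun s ↦ appLE_presheaf_map_apply a (i.preimage_mono (P.basicOpen_le f))
        ((a ≫ i).preimage_mono (P.basicOpen_le f))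
        (preimage_le_preimage_of_comp_eq a a i i rfl _)
        (preimage_le_preimage_of_comp_eq a a i i rfl _) s)
      (fun t ↦ appLE_presheaf_map_apply b (j.preimage_mono (P.basicOpen_le f))
        ((a ≫ i).preimage_mono (P.basicOpen_le f))
        (preimage_le_preimage_of_comp_eq a b i j h _)
        (preimage_le_preimage_of_comp_eq a b i j h _) t)
      (congrArg (fun t ↦ t.hom f) h2)
      (exists_map_eq_pow_mul (hU.preimage i) _ (i.preimage_basicOpen f) _)
      (exists_map_eq_pow_mul (hU.preimage j) _ (j.preimage_basicOpen f) _) hM hst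
  obtain ⟨r, hr, -⟩ := hg s' t' h3
  obtain ⟨v, hv⟩ := hf.exists_left_inv
  refine ⟨v ^ n * (P.presheaf.map (homOfLE (P.basicOpen_le f)).op).hom r, ?_⟩
  rw [map_mul, app_presheaf_map_apply, hr, h4, ← app_presheaf_map_apply i (P.basicOpen_le f) f,
    ← mul_assoc, ← map_pow,
    ← map_mul, ← mul_pow, hv, one_pow, map_one, one_mul]

/-- Gluing of functions on `Y` and `W` over an arbitrary open of `P`. -/
lemma exists_app_eq_of_hasGluedSections [IsAffineHom a] [IsAffineHom i] [IsAffineHom j]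
    [IsSchemeTheoreticallyDominant i] (h : a ≫ i = b ≫ j)
    (hg : ∀ p : P, ∃ U : P.Opens, p ∈ U ∧ IsAffineOpen U ∧ HasGluedSections h U)
    (Ω : P.Opens) (s : Γ(Y, i ⁻¹ᵁ Ω)) (t : Γ(W, j ⁻¹ᵁ Ω))
    (hst : (a.appLE _ _ (preimage_le_preimage_of_comp_eq a a i i rfl Ω)).hom s =
      (b.appLE _ _ (preimage_le_preimage_of_comp_eq a b i j h Ω)).hom t) :
    ∃ p, (i.app Ω).hom p = s := by
  have hloc (x : Ω) : ∃ D : P.Opens, x.1 ∈ D ∧ ∃ (e : D ≤ Ω) (p : Γ(P, D)), (i.app D).hom p =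
      (Y.presheaf.map (homOfLE (i.preimage_mono e)).op).hom s := by
    obtain ⟨U, hxU, hU, hg⟩ := hg x.1
    obtain ⟨f, hf, hxf⟩ := hU.exists_basicOpen_le x hxU
    refine ⟨P.basicOpen f, hxf, hf, exists_app_eq_basicOpen h hU hg f _
      ((W.presheaf.map (homOfLE (j.preimage_mono hf)).op).hom t) ?_⟩
    rw [appLE_presheaf_map_apply a (i.preimage_mono hf) ((a ≫ i).preimage_mono hf)
      (preimage_le_preimage_of_comp_eq a a i i rfl _),
      appLE_presheaf_map_apply b (j.preimage_mono hf) ((a ≫ i).preimage_mono hf)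
      (preimage_le_preimage_of_comp_eq a b i j h _), hst]
  choose D hxD hD p hp using hloc
  have hp' (x : Ω) (D' : P.Opens) (e : D' ≤ D x) :
      (i.app D').hom ((P.presheaf.map (homOfLE e).op).hom (p x)) =
        (Y.presheaf.map (homOfLE (i.preimage_mono (e.trans (hD x)))).op).hom s := by
    rw [app_presheaf_map_apply, hp]
    exact congrArg (fun t ↦ t.hom s) (Y.presheaf.map_comp
      (homOfLE (i.preimage_mono (hD x))).op (homOfLE (i.preimage_mono e)).op).symm
  have hc : Ω ≤ iSup D := fun x hx ↦ TopologicalSpace.Opens.mem_iSup.mpr ⟨⟨x, hx⟩, hxD ⟨x, hx⟩⟩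
  obtain ⟨q, hq, -⟩ := P.sheaf.existsUnique_gluing' D Ω (fun x ↦ homOfLE (hD x)) hc p
    fun x x' ↦ i.app_injective _
      ((hp' x (D x ⊓ D x') inf_le_left).trans (hp' x' (D x ⊓ D x') inf_le_right).symm)
  refine ⟨q, ?_⟩
  refine Y.sheaf.eq_of_locally_eq' (fun x ↦ i ⁻¹ᵁ D x) (i ⁻¹ᵁ Ω)
    (fun x ↦ homOfLE (i.preimage_mono (hD x))) ?_ _ _ fun x ↦ ?_
  · intro y hy
    obtain ⟨x, hx⟩ := TopologicalSpace.Opens.mem_iSup.mp (hc hy)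
    exact TopologicalSpace.Opens.mem_iSup.mpr ⟨x, hx⟩
  · exact (app_presheaf_map_apply i (hD x) q).symm.trans ((congrArg _ (hq x)).trans (hp x))

lemma eq_of_primeIdealOf_eq {U : P.Opens} (hU : IsAffineOpen U) {z z' : P} (hz : z ∈ U)
    (hz' : z' ∈ U)
    (h : (hU.primeIdealOf ⟨z, hz⟩).asIdeal = (hU.primeIdealOf ⟨z', hz'⟩).asIdeal) : z = z' :=
  (((primeIdealOf_le_iff hU hz hz').mp h.le).antisymm
    ((primeIdealOf_le_iff hU hz' hz).mp h.ge)).eq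

lemma app_mem_primeIdealOf_iff [IsAffineHom j] {U : P.Opens} (hU : IsAffineOpen U) {w : W}
    (hw : w ∈ j ⁻¹ᵁ U) (r : Γ(P, U)) :
    (j.app U).hom r ∈ ((hU.preimage j).primeIdealOf ⟨w, hw⟩).asIdeal ↔ j w ∉ P.basicOpen r := by
  rw [← mem_primeIdealOf_iff_notMem_basicOpen hU hw, ← primeIdealOf_comap_app j hU hw]
  rfl

lemma eq_of_apply_eq_of_surjective {U : P.Opens} (hU : IsAffineOpen U) [IsAffineHom j]
    (hs : Function.Surjective (j.app U).hom) {w w' : W} (hw : j w ∈ U) (hww' : j w = j w') :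
    w = w' := by
  have hw' : j w' ∈ U := hww' ▸ hw
  refine eq_of_primeIdealOf_eq (hU.preimage j) hw hw' ?_
  ext t
  obtain ⟨r, rfl⟩ := hs t
  rw [app_mem_primeIdealOf_iff hU hw, app_mem_primeIdealOf_iff hU hw', hww']

lemma HasGluedSections.surjective_app [IsClosedImmersion a] [IsAffineHom i] {h : a ≫ i = b ≫ j}
    {U : P.Opens} (hU : IsAffineOpen U) (hg : HasGluedSections h U) :
    Function.Surjective (j.app U).hom := by
  intro t
  obtain ⟨s, hs⟩ := a.app_surjective (i ⁻¹ᵁ U) (hU.preimage i)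
    ((b.appLE _ _ (preimage_le_preimage_of_comp_eq a b i j h U)).hom t)
  rw [← Scheme.Hom.appLE_eq_app] at hs
  obtain ⟨r, -, hr⟩ := hg s t hs
  exact ⟨r, hr⟩

/-- Two points of `Y` have the same image in the glued scheme only if they are equal or glued. -/
lemma eq_or_exists_of_apply_eq [IsClosedImmersion a] [IsAffineHom i] [IsAffineHom j]
    (h : a ≫ i = b ≫ j) {U : P.Opens} (hU : IsAffineOpen U) (hg : HasGluedSections h U)
    {y y' : Y} (hy : i y ∈ U) (hyy' : i y = i y') :
    y = y' ∨ ∃ z z', a z = y ∧ a z' = y' ∧ b z = b z' := by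
  have hy' : i y' ∈ U := hyy' ▸ hy
  set Q := ((hU.preimage i).primeIdealOf ⟨y, hy⟩).asIdeal with hQ
  set Q' := ((hU.preimage i).primeIdealOf ⟨y', hy'⟩).asIdeal with hQ'
  have hQQ' (r : Γ(P, U)) : (i.app U).hom r ∈ Q ↔ (i.app U).hom r ∈ Q' := by
    rw [app_mem_primeIdealOf_iff hU hy, app_mem_primeIdealOf_iff hU hy', hyy']
  have hker (s) (hs : s ∈ RingHom.ker (a.app (i ⁻¹ᵁ U)).hom) : s ∈ Q ↔ s ∈ Q' := by
    obtain ⟨r, rfl, -⟩ := hg s 0 (by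
      rw [map_zero]
      have h0 : (a.app (i ⁻¹ᵁ U)).hom s = 0 := hs
      exact (congrArg (fun t ↦ t.hom s) (a.appLE_eq_app (U := i ⁻¹ᵁ U))).trans h0)
    exact hQQ' r
  by_cases hI : RingHom.ker (a.app (i ⁻¹ᵁ U)).hom ≤ Q
  · right
    have key (y : Y) (hy : i y ∈ U) (hI : RingHom.ker (a.app (i ⁻¹ᵁ U)).hom ≤
        ((hU.preimage i).primeIdealOf ⟨y, hy⟩).asIdeal) : ∃ z, a z = y := by
      have hs := a.app_surjective (i ⁻¹ᵁ U) (hU.preimage i)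
      have := Ideal.map_isPrime_of_surjective hs hI
      obtain ⟨z, -, hz, -⟩ := exists_apply_eq_of_comap_eq a (hU.preimage i) _ hy
        ((Ideal.comap_map_of_surjective _ hs _).trans (sup_eq_left.mpr hI))
      exact ⟨z, hz⟩
    obtain ⟨z, rfl⟩ := key y hy hI
    obtain ⟨z', rfl⟩ := key y' hy' fun s hs ↦ (hker s hs).mp (hI hs)
    have hab (z : Z) : i (a z) = j (b z) := congrArg (fun t : Z ⟶ P ↦ t z) h
    refine ⟨z, z', rfl, rfl, eq_of_apply_eq_of_surjective hU (hg.surjective_app hU) ?_ ?_⟩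
    · rw [← hab]
      exact hy
    · rw [← hab, ← hab, hyy']
  · left
    obtain ⟨f, hf, hfQ⟩ := SetLike.not_le_iff_exists.mp hI
    have hfQ' : f ∉ Q' := fun h ↦ hfQ ((hker f hf).mpr h)
    refine eq_of_primeIdealOf_eq (hU.preimage i) hy hy' ?_
    ext s
    have h1 := hker (f * s) (Ideal.mul_mem_right _ _ hf)
    constructor
    · intro hs
      exact (Ideal.IsPrime.mem_or_mem inferInstance
        (h1.mp (Ideal.mul_mem_left _ _ hs))).resolve_left
        hfQ'
    · intro hs
      exact (Ideal.IsPrime.mem_or_mem inferInstance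
        (h1.mpr (Ideal.mul_mem_left _ _ hs))).resolve_left hfQ

/-- A commutative square of schemes is a pushout if functions glue: locally on `P`, the functions
are the pairs of functions on `Y` and `W` that agree on `Z`. As `i` is integral and dominant, `P`
carries the quotient topology of `Y`, and by gluing of functions the points of `Y` that `i`
identifies are identified by the gluing along `Z`. -/
theorem isPushout_of_hasGluedSections [IsClosedImmersion a] [IsIntegralHom i] [IsAffineHom j]
    [IsSchemeTheoreticallyDominant i] [IsSchemeTheoreticallyDominant b] [QuasiCompact b]
    [Surjective b] (h : a ≫ i = b ≫ j)
    (hg : ∀ p : P, ∃ U : P.Opens, p ∈ U ∧ IsAffineOpen U ∧ HasGluedSections h U) :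
    IsPushout a b i j := by
  have hq : Topology.IsQuotientMap i := i.isClosedMap.isQuotientMap i.continuous i.surjective
  have hdesc (s : PushoutCocone a b) : ∃ d : P ⟶ s.pt, i ≫ d = s.inl := by
    have hab (z : Z) : s.inl (a z) = s.inr (b z) := congrArg (fun t : Z ⟶ s.pt ↦ t z) s.condition
    refine exists_comp_eq_of_isQuotientMap i hq s.inl (fun y y' hyy' ↦ ?_) fun V Ω e r ↦ ?_
    · obtain ⟨U, hyU, hU, hg⟩ := hg (i y)
      obtain rfl | ⟨z, z', rfl, rfl, hz⟩ := eq_or_exists_of_apply_eq h hU hg hyU hyy'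
      · rfl
      · rw [hab, hab, hz]
    · have e' : j ⁻¹ᵁ Ω ≤ s.inr ⁻¹ᵁ V := by
        intro w hw
        obtain ⟨z, rfl⟩ := b.surjective w
        change s.inr (b z) ∈ V
        rw [← hab]
        refine e (?_ : i (a z) ∈ Ω)
        rw [show i (a z) = j (b z) from congrArg (fun t : Z ⟶ P ↦ t z) h]
        exact hw
      refine exists_app_eq_of_hasGluedSections h hg Ω _ ((s.inr.appLE V _ e').hom r) ?_
      have := (comp_appLE_eq a s.inl (preimage_le_preimage_of_comp_eq a a i i rfl Ω) e
        ((preimage_le_preimage_of_comp_eq a a i i rfl Ω).trans (a.preimage_mono e))).symm.trans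
        ((appLE_eq_of_eq s.condition _ _).trans (comp_appLE_eq b s.inr
          (preimage_le_preimage_of_comp_eq a b i j h Ω) e'
          ((preimage_le_preimage_of_comp_eq a b i j h Ω).trans (b.preimage_mono e'))))
      exact congrArg (fun t ↦ t.hom r) this
  choose d hd using hdesc
  refine ⟨⟨h⟩, ⟨PushoutCocone.IsColimit.mk h d hd (fun s ↦ ?_) fun s m hm _ ↦ ?_⟩⟩
  · refine hom_ext_of_surjective b ?_
    rw [← Category.assoc, ← h, Category.assoc, hd, s.condition]
  · exact hom_ext_of_surjective i (hm.trans (hd s).symm)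

end PushoutCriterion

end DivGluing

/-! ### Existence of pushouts -/

namespace DivGluing

section RelativePushoutExistence

lemma appLE_injective_of_eq {Z W : Scheme.{0}} (b : Z ⟶ W) [IsSchemeTheoreticallyDominant b]
    [QuasiCompact b] {V : W.Opens} {T : Z.Opens} (e : T ≤ b ⁻¹ᵁ V) (hT : T = b ⁻¹ᵁ V) :
    Function.Injective (b.appLE V T e).hom := by
  subst hT
  rw [Scheme.Hom.appLE_eq_app]
  exact b.app_injective V

variable {X Y W Z : Scheme.{0}} {a : Z ⟶ Y} {b : Z ⟶ W} {y : Y ⟶ X} {w : W ⟶ X}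

/-- Existence of the pushout of a closed immersion `a : Z ⟶ Y` and a surjective,
scheme-theoretically dominant `b : Z ⟶ W` over a base to which `Y` is integral and `W` is affine. -/
theorem exists_isPushout_over [IsClosedImmersion a] [IsIntegralHom y] [IsAffineHom w]
    [IsSchemeTheoreticallyDominant b] [QuasiCompact b] [Surjective b] (h : a ≫ y = b ≫ w) :
    ∃ (P : Scheme.{0}) (π : P ⟶ X) (i : Y ⟶ P) (j : W ⟶ P), IsPushout a b i j ∧ i ≫ π = y ∧
      j ≫ π = w ∧ IsAffineHom π ∧ IsSchemeTheoreticallyDominant i ∧ IsAffineHom i := by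
  obtain ⟨P, π, i, j, rfl, rfl, hπ, hab, hσ⟩ := exists_relativeSpec_fibreProduct a b y w h
  have hi : IsIntegralHom i := .of_comp i π
  have hj : IsAffineHom j :=
    MorphismProperty.of_postcomp (W := @IsAffineHom) (W' := @IsSeparated) _ π inferInstance
      inferInstance
  have hcov := TopologicalSpace.IsOpenCover.comap (iSup_affineOpens_eq_top X) π.base.hom
  have hg (U : X.Opens) (hU : IsAffineOpen U) : HasGluedSections hab (π ⁻¹ᵁ U) := by
    intro s t hst
    obtain ⟨σ, hσ⟩ := hσ U hU
    obtain ⟨r, hr⟩ := σ.surjective ⟨(s, t), hst⟩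
    refine ⟨r, ?_, ?_⟩
    · have h1 := (hσ r).1
      rw [hr] at h1
      exact (h1.trans (congrArg (fun t ↦ t.hom r) (i.appLE_eq_app (U := π ⁻¹ᵁ U)))).symm
    · have h1 := (hσ r).2
      rw [hr] at h1
      exact (h1.trans (congrArg (fun t ↦ t.hom r) (j.appLE_eq_app (U := π ⁻¹ᵁ U)))).symm
  have hinj (U : X.Opens) (hU : IsAffineOpen U) : Function.Injective (i.app (π ⁻¹ᵁ U)).hom := by
    rw [injective_iff_map_eq_zero]
    intro r hr
    obtain ⟨σ, hσ⟩ := hσ U hU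
    have h1 : (σ r).1.1 = 0 := ((hσ r).1.trans
      (congrArg (fun t ↦ t.hom r) (i.appLE_eq_app (U := π ⁻¹ᵁ U)))).trans hr
    have h2 : (a.appLE _ _ (preimage_le_preimage_of_comp_eq a a (i ≫ π) (i ≫ π) rfl U)).hom
        (σ r).1.1 = (b.appLE _ _ (preimage_le_preimage_of_comp_eq a b (i ≫ π) (j ≫ π) h U)).hom
        (σ r).1.2 := (σ r).2
    have h3 : (σ r).1.2 = 0 := by
      refine appLE_injective_of_eq b (preimage_le_preimage_of_comp_eq a b (i ≫ π) (j ≫ π) h U)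
        ?_ (h2.symm.trans ((congrArg _ h1).trans ((map_zero _).trans (map_zero _).symm)))
      rw [h]
      rfl
    exact (map_eq_zero_iff σ σ.injective).mp (Subtype.ext (Prod.ext h1 h3))
  have hdom : IsSchemeTheoreticallyDominant i := by
    refine ⟨Scheme.IdealSheafData.ext_of_iSup_eq_top
      (fun U : X.affineOpens ↦ ⟨π ⁻¹ᵁ U.1, U.2.preimage π⟩) hcov fun U ↦ ?_⟩
    rw [Scheme.Hom.ker_apply, Scheme.IdealSheafData.ideal_bot, Pi.bot_apply,
      ← RingHom.injective_iff_ker_eq_bot]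
    exact hinj U.1 U.2
  refine ⟨P, π, i, j, isPushout_of_hasGluedSections hab fun p ↦ ?_, rfl, rfl, hπ, hdom,
    inferInstance⟩
  obtain ⟨U, hU, hpU, -⟩ := exists_isAffineOpen_mem_and_subset (x := π p) (U := ⊤) trivial
  exact ⟨π ⁻¹ᵁ U, hpU, hU.preimage π, hg U hU⟩

/-- The structure map of a pushout over `X` is an isomorphism when, locally on `X`, the only
functions on `Y` that descend to the pushout are those coming from `X`. -/
lemma isIso_of_forall_mem_range {P : Scheme.{0}} {π : P ⟶ X} {i : Y ⟶ P} {j : W ⟶ P}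
    [IsAffineHom π] [IsSchemeTheoreticallyDominant i] [QuasiCompact i] (hab : a ≫ i = b ≫ j)
    (hi : i ≫ π = y) (hj : j ≫ π = w) (h : a ≫ y = b ≫ w)
    (hX : ∀ x : X, ∃ U : X.Opens, x ∈ U ∧ IsAffineOpen U ∧ Function.Injective (y.app U).hom ∧
      ∀ (s : Γ(Y, y ⁻¹ᵁ U)) (t : Γ(W, w ⁻¹ᵁ U)),
        (a.appLE _ _ (preimage_le_preimage_of_comp_eq a a y y rfl U)).hom s =
          (b.appLE _ _ (preimage_le_preimage_of_comp_eq a b y w h U)).hom t →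
        s ∈ (y.app U).hom.range) : IsIso π := by
  subst hi hj
  choose U hxU hU hinj hR using hX
  have hbij (x) : Function.Bijective (π.app (U x)).hom := by
    constructor
    · intro r r' hr
      refine hinj x ?_
      rw [Scheme.Hom.comp_app]
      exact congrArg (i.app (π ⁻¹ᵁ U x)).hom hr
    · intro r
      obtain ⟨r', hr'⟩ := hR x ((i.app (π ⁻¹ᵁ U x)).hom r) ((j.app (π ⁻¹ᵁ U x)).hom r) (by
        have := (comp_appLE_eq a i (V := i ⁻¹ᵁ π ⁻¹ᵁ U x) (U := π ⁻¹ᵁ U x)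
          (preimage_le_preimage_of_comp_eq a a (i ≫ π) (i ≫ π) rfl (U x))
          le_rfl (preimage_le_preimage_of_comp_eq a a (i ≫ π) (i ≫ π) rfl (U x))).symm.trans
          ((appLE_eq_of_eq hab _ _).trans (comp_appLE_eq b j (V := j ⁻¹ᵁ π ⁻¹ᵁ U x) (U := π ⁻¹ᵁ U x)
            (preimage_le_preimage_of_comp_eq a b (i ≫ π) (j ≫ π) h (U x)) le_rfl
            (preimage_le_preimage_of_comp_eq a b (i ≫ π) (j ≫ π) h (U x))))
        rw [Scheme.Hom.appLE_eq_app, Scheme.Hom.appLE_eq_app] at this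
        exact congrArg (fun t ↦ t.hom r) this)
      exact ⟨r', i.app_injective _ hr'⟩
  have hsup : iSup U = ⊤ := top_le_iff.mp fun x _ ↦
    TopologicalSpace.Opens.mem_iSup.mpr ⟨x, hxU x⟩
  refine (IsZariskiLocalAtTarget.iff_of_iSup_eq_top (P := MorphismProperty.isomorphisms Scheme)
    U hsup).mpr fun x ↦ (isIso_morphismRestrict_iff_isIso_app π (hU x)).mpr ?_
  exact (ConcreteCategory.isIso_iff_bijective _).mpr (hbij x)

end RelativePushoutExistence

end DivGluing

/-! ### Disjoint unions of closed subschemes -/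

namespace DivGluing

section DisjointUnions

variable {ι : Type} {Z W : ι → Scheme.{0}} {X : Scheme.{0}}

lemma sigmaι_apply_desc (f : ∀ i, Z i ⟶ X) (i : ι) (z : Z i) :
    Sigma.desc f (Sigma.ι Z i z) = f i z :=
  congrArg (fun t : Z i ⟶ X ↦ t z) (Sigma.ι_desc f i)

lemma exists_sigmaι_apply_eq (z : (∐ Z : Scheme.{0})) : ∃ i x, Sigma.ι Z i x = z :=
  (sigmaOpenCover Z).exists_eq z

lemma isAffineHom_sigmaDesc [Finite ι] (f : ∀ i, Z i ⟶ X) [∀ i, IsAffineHom (f i)] :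
    IsAffineHom (Sigma.desc f) := by
  refine ⟨fun U hU ↦ ?_⟩
  have h : Sigma.desc f ⁻¹ᵁ U = ⨆ i, (Sigma.ι Z i) ''ᵁ (f i ⁻¹ᵁ U) := by
    ext z
    obtain ⟨i, x, rfl⟩ := exists_sigmaι_apply_eq z
    constructor
    · intro hz
      refine TopologicalSpace.Opens.mem_iSup.mpr ⟨i, x, ?_, rfl⟩
      change f i x ∈ U
      rw [← sigmaι_apply_desc f i x]
      exact hz
    · intro hz
      obtain ⟨j, x', hx', hxx'⟩ := TopologicalSpace.Opens.mem_iSup.mp hz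
      change Sigma.desc f _ ∈ U
      rw [← hxx']
      change Sigma.desc f (Sigma.ι Z j x') ∈ U
      rw [sigmaι_apply_desc]
      exact hx'
  rw [h]
  refine IsAffineOpen.iSup_of_disjoint (fun i ↦ (hU.preimage (f i)).image_of_isOpenImmersion _)
    fun i j hij ↦ (disjoint_opensRange_sigmaι Z i j hij).mono ?_ ?_
  · exact Set.image_subset_range _ _
  · exact Set.image_subset_range _ _

lemma isClosedImmersion_sigmaDesc [Finite ι] (f : ∀ i, Z i ⟶ X) [∀ i, IsClosedImmersion (f i)]
    (h : ∀ i j, i ≠ j → Disjoint (Set.range (f i)) (Set.range (f j))) :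
    IsClosedImmersion (Sigma.desc f) := by
  have hs : SurjectiveOnStalks (Sigma.desc f) :=
    IsZariskiLocalAtSource.sigmaDesc (P := @SurjectiveOnStalks) fun i ↦ inferInstance
  refine ⟨.of_continuous_injective_isClosedMap (Sigma.desc f).continuous ?_ ?_⟩
  · intro z z' hzz'
    obtain ⟨i, x, rfl⟩ := exists_sigmaι_apply_eq z
    obtain ⟨j, x', rfl⟩ := exists_sigmaι_apply_eq z'
    rw [sigmaι_apply_desc, sigmaι_apply_desc] at hzz'
    obtain rfl : i = j := by
      by_contra hij
      exact Set.disjoint_left.mp (h i j hij) ⟨x, hzz'⟩ ⟨x', rfl⟩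
    rw [(f i).isClosedEmbedding.injective hzz']
  · intro C hC
    have : Sigma.desc f '' C = ⋃ i, f i '' (Sigma.ι Z i ⁻¹' C) := by
      ext x
      simp only [Set.mem_image, Set.mem_iUnion, Set.mem_preimage]
      constructor
      · rintro ⟨z, hz, rfl⟩
        obtain ⟨i, x, rfl⟩ := exists_sigmaι_apply_eq z
        exact ⟨i, x, hz, (sigmaι_apply_desc f i x).symm⟩
      · rintro ⟨i, x, hx, rfl⟩
        exact ⟨_, hx, sigmaι_apply_desc f i x⟩
    rw [this]
    exact isClosed_iUnion_of_finite fun i ↦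
      (f i).isClosedEmbedding.isClosedMap _ (hC.preimage (Sigma.ι Z i).continuous)

lemma isSchemeTheoreticallyDominant_sigmaMap (f : ∀ i, Z i ⟶ W i)
    [∀ i, IsSchemeTheoreticallyDominant (f i)] [∀ i, QuasiCompact (f i)]
    [QuasiCompact (Limits.Sigma.map f)] : IsSchemeTheoreticallyDominant (Limits.Sigma.map f) := by
  refine ⟨Scheme.IdealSheafData.ext ?_⟩
  ext U r
  rw [Scheme.Hom.ker_apply, Scheme.IdealSheafData.ideal_bot, Pi.bot_apply, RingHom.mem_ker,
    Ideal.mem_bot]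
  refine ⟨fun hr ↦ Scheme.zero_of_zero_cover r (sigmaOpenCover W) fun (i : ι) ↦ ?_,
    fun hr ↦ hr ▸ map_zero _⟩
  have h1 : f i ≫ Sigma.ι W i = Sigma.ι Z i ≫ Limits.Sigma.map f := (Sigma.ι_map f i).symm
  have e : Sigma.ι Z i ⁻¹ᵁ Limits.Sigma.map f ⁻¹ᵁ U.1 ≤ f i ⁻¹ᵁ Sigma.ι W i ⁻¹ᵁ U.1 :=
    preimage_le_preimage_of_comp_eq _ _ _ _ h1.symm U.1
  have e' : Sigma.ι Z i ⁻¹ᵁ Limits.Sigma.map f ⁻¹ᵁ U.1 = f i ⁻¹ᵁ Sigma.ι W i ⁻¹ᵁ U.1 := by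
    change (Sigma.ι Z i ≫ Limits.Sigma.map f) ⁻¹ᵁ U.1 = _
    rw [← h1]
    rfl
  refine appLE_injective_of_eq (f i) e e' ?_
  have := (comp_appLE_eq (f i) (Sigma.ι W i) e le_rfl e).symm.trans
    ((appLE_eq_of_eq h1 _ _).trans (comp_appLE_eq (Sigma.ι Z i) (Limits.Sigma.map f)
      (V := Limits.Sigma.map f ⁻¹ᵁ U.1) le_rfl le_rfl le_rfl))
  rw [Scheme.Hom.appLE_eq_app, Scheme.Hom.appLE_eq_app, Scheme.Hom.appLE_eq_app] at this
  refine (congrArg (fun t ↦ t.hom r) this).trans ?_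
  exact (congrArg ((Sigma.ι Z i).app _).hom hr).trans ((map_zero _).trans (map_zero _).symm)

/-- A morphism onto the scheme-theoretic image is scheme-theoretically dominant. -/
lemma isSchemeTheoreticallyDominant_of_ker_comp_le {Z W X : Scheme.{0}} (f : Z ⟶ W) (c : W ⟶ X)
    [IsClosedImmersion c] [QuasiCompact f] (h : (f ≫ c).ker ≤ c.ker) :
    IsSchemeTheoreticallyDominant f := by
  refine ⟨Scheme.IdealSheafData.ext_of_iSup_eq_top
    (fun U : X.affineOpens ↦ ⟨c ⁻¹ᵁ U.1, U.2.preimage c⟩)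
    (TopologicalSpace.IsOpenCover.comap (iSup_affineOpens_eq_top X) c.base.hom) fun U ↦ ?_⟩
  rw [Scheme.Hom.ker_apply, Scheme.IdealSheafData.ideal_bot, Pi.bot_apply, eq_bot_iff]
  intro r hr
  obtain ⟨s, rfl⟩ := c.app_surjective U.1 U.2 r
  have hs : s ∈ (f ≫ c).ker.ideal U := by
    rw [Scheme.Hom.ker_apply, RingHom.mem_ker, Scheme.Hom.comp_app]
    exact hr
  have := h U hs
  rwa [Scheme.Hom.ker_apply] at this

end DisjointUnions

end DivGluing

/-! ### The pushouts `X_k` -/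

namespace DivGluing

section MultiplesOfDivisors

variable {X : Scheme.{0}} [IsNoetherian X] {ℓ : ℕ} (F : Fin ℓ → X.IdealSheafData) (k : ℕ)

lemma kDTokF_subschemeι (G : X.IdealSheafData) :
    kDTokF G k ≫ (kF G k).subschemeι = (kD G k).subschemeι ≫ normalizationMap X :=
  Scheme.IdealSheafData.subschemeMap_subschemeι _ _ _ _

lemma sigmaKDTo_comp_normalizationMap :
    sigmaKDTo F k ≫ normalizationMap X = sigmaKDToKF F k ≫ sigmaKFTo F k := by
  refine Sigma.hom_ext _ _ fun i ↦ ?_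
  have h₁ : Sigma.ι _ i ≫ sigmaKDTo F k = (kD (F i) k).subschemeι := Sigma.ι_desc _ i
  have h₂ : Sigma.ι _ i ≫ sigmaKDToKF F k =
      kDTokF (F i) k ≫ Sigma.ι (fun i ↦ (kF (F i) k).subscheme) i :=
    Sigma.ι_map (fun i ↦ kDTokF (F i) k) i
  have h₃ : Sigma.ι _ i ≫ sigmaKFTo F k = (kF (F i) k).subschemeι := Sigma.ι_desc _ i
  rw [reassoc_of% h₁, reassoc_of% h₂, h₃]
  exact (kDTokF_subschemeι k (F i)).symm

lemma pow_ideal_divPreimage_le (G : X.IdealSheafData) (U : (normalization X).affineOpens) :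
    (divPreimage G).ideal U ^ k ≤ (kD G k).ideal U :=
  le_codimOnePart (divPreimage G ^ k) U

lemma support_kD_le (G : X.IdealSheafData) :
    ((kD G k).support : Set (normalization X)) ⊆ (divPreimage G).support := by
  intro z hz
  obtain ⟨U, hU, hzU, -⟩ := exists_isAffineOpen_mem_and_subset (x := z) (U := ⊤) trivial
  rw [SetLike.mem_coe, mem_support_iff_le_primeIdealOf hU _ hzU] at hz ⊢
  exact Ideal.IsPrime.le_of_pow_le ((pow_ideal_divPreimage_le k G ⟨U, hU⟩).trans hz)

lemma isClosedImmersion_sigmaKDTo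
    (h : ∀ i j, i ≠ j → Disjoint ((divPreimage (F i)).support : Set (normalization X))
      ((divPreimage (F j)).support : Set (normalization X))) :
    IsClosedImmersion (sigmaKDTo F k) := by
  refine isClosedImmersion_sigmaDesc _ fun i j hij ↦ ?_
  rw [Scheme.IdealSheafData.range_subschemeι, Scheme.IdealSheafData.range_subschemeι]
  exact (h i j hij).mono (support_kD_le k _) (support_kD_le k _)

instance : IsAffineHom (sigmaKFTo F k) := isAffineHom_sigmaDesc _

lemma isIntegralHom_kDTokF (G : X.IdealSheafData) : IsIntegralHom (kDTokF G k) := by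
  have : IsIntegralHom (kDTokF G k ≫ (kF G k).subschemeι) := by
    rw [kDTokF_subschemeι]
    infer_instance
  exact .of_comp _ (kF G k).subschemeι

lemma isSchemeTheoreticallyDominant_kDTokF (G : X.IdealSheafData) :
    IsSchemeTheoreticallyDominant (kDTokF G k) := by
  have := isIntegralHom_kDTokF k G
  refine isSchemeTheoreticallyDominant_of_ker_comp_le _ (kF G k).subschemeι ?_
  rw [kDTokF_subschemeι, Scheme.IdealSheafData.ker_subschemeι]
  exact le_rfl

lemma isIntegralHom_sigmaKDToKF (h : IsClosedImmersion (sigmaKDTo F k)) :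
    IsIntegralHom (sigmaKDToKF F k) := by
  have : IsIntegralHom (sigmaKDToKF F k ≫ sigmaKFTo F k) := by
    rw [← sigmaKDTo_comp_normalizationMap]
    infer_instance
  exact .of_comp _ (sigmaKFTo F k)

lemma isSchemeTheoreticallyDominant_sigmaKDToKF (h : IsClosedImmersion (sigmaKDTo F k)) :
    IsSchemeTheoreticallyDominant (sigmaKDToKF F k) := by
  have := isIntegralHom_sigmaKDToKF F k h
  have (i : Fin ℓ) := isIntegralHom_kDTokF k (F i)
  have (i : Fin ℓ) := isSchemeTheoreticallyDominant_kDTokF k (F i)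
  have : QuasiCompact (Limits.Sigma.map fun i ↦ kDTokF (F i) k) :=
    inferInstanceAs (QuasiCompact (sigmaKDToKF F k))
  exact isSchemeTheoreticallyDominant_sigmaMap _

/-- The pushout `X_k` of `X^ν ← kD → kF₁ ⊔ ⋯ ⊔ kF_ℓ` exists, and it maps to `X`. -/
theorem exists_isPushout_sigmaKDTo
    (h : ∀ i j, i ≠ j → Disjoint ((divPreimage (F i)).support : Set (normalization X))
      ((divPreimage (F j)).support : Set (normalization X))) :
    ∃ (P : Scheme.{0}) (π : P ⟶ X) (i : normalization X ⟶ P) (j : _ ⟶ P),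
      IsPushout (sigmaKDTo F k) (sigmaKDToKF F k) i j ∧ i ≫ π = normalizationMap X ∧
      j ≫ π = sigmaKFTo F k ∧ IsAffineHom π ∧ IsSchemeTheoreticallyDominant i ∧
      IsAffineHom i := by
  have ha := isClosedImmersion_sigmaKDTo F k h
  have := isIntegralHom_sigmaKDToKF F k ha
  have := isSchemeTheoreticallyDominant_sigmaKDToKF F k ha
  exact exists_isPushout_over (sigmaKDTo_comp_normalizationMap F k)

end MultiplesOfDivisors

end DivGluing

/-! ### Large multiples -/

namespace DivGluing

section LargeMultiples

/-- Functions on `Y` and `W` over `U` that agree on `Z` become equal on a piece of `Z` whose image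
in `W` lies in a piece of `W` on which the given function on `W` comes from `X`. -/
lemma appLE_eq_of_glued {X Y W Z Z' W' : Scheme.{0}} {a : Z ⟶ Y} {b : Z ⟶ W} {y : Y ⟶ X}
    {w : W ⟶ X} (h : a ≫ y = b ≫ w) (z : Z' ⟶ Z) (q : Z' ⟶ W') (u : W' ⟶ W)
    (hq : z ≫ b = q ≫ u) {p : Z' ⟶ Y} (hp : z ≫ a = p) {c : W' ⟶ X} (hc : u ≫ w = c) (U : X.Opens)
    (s : Γ(Y, y ⁻¹ᵁ U)) (t : Γ(W, w ⁻¹ᵁ U))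
    (hst : (a.appLE _ _ (preimage_le_preimage_of_comp_eq a a y y rfl U)).hom s =
      (b.appLE _ _ (preimage_le_preimage_of_comp_eq a b y w h U)).hom t)
    (e : c ⁻¹ᵁ U ≤ u ⁻¹ᵁ w ⁻¹ᵁ U)
    (r : Γ(X, U)) (hr : (c.app U).hom r = (u.appLE _ _ e).hom t) :
    (p.app (y ⁻¹ᵁ U)).hom s = (p.app (y ⁻¹ᵁ U)).hom ((y.app U).hom r) := by
  subst hp hc
  have e₁ : (z ≫ a) ⁻¹ᵁ y ⁻¹ᵁ U ≤ z ⁻¹ᵁ (a ≫ y) ⁻¹ᵁ U := le_rfl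
  have e₂ : (z ≫ a) ⁻¹ᵁ y ⁻¹ᵁ U ≤ q ⁻¹ᵁ (u ≫ w) ⁻¹ᵁ U :=
    preimage_le_preimage_of_comp_eq z q (a ≫ y) (u ≫ w)
      (by rw [h, ← Category.assoc, hq, Category.assoc]) U
  have e₃ : (z ≫ a) ⁻¹ᵁ y ⁻¹ᵁ U ≤ (z ≫ b) ⁻¹ᵁ w ⁻¹ᵁ U :=
    preimage_le_preimage_of_comp_eq (z ≫ a) (z ≫ b) y w
      (by rw [Category.assoc, h, ← Category.assoc]) U
  have e₄ : (z ≫ a) ⁻¹ᵁ y ⁻¹ᵁ U ≤ (q ≫ u) ⁻¹ᵁ w ⁻¹ᵁ U := hq ▸ e₃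
  have h₁ := comp_appLE_eq z a e₁ (preimage_le_preimage_of_comp_eq a a y y rfl U)
    (le_refl ((z ≫ a) ⁻¹ᵁ y ⁻¹ᵁ U))
  have h₂ := comp_appLE_eq z b e₁ (preimage_le_preimage_of_comp_eq a b y w h U) e₃
  have h₃ := comp_appLE_eq q u e₂ e e₄
  have h₄ := comp_appLE_eq q (u ≫ w) (U := U) e₂ le_rfl e₄
  have h₅ := comp_appLE_eq (z ≫ a) y (U := U) (le_refl ((z ≫ a) ⁻¹ᵁ y ⁻¹ᵁ U)) le_rfl le_rfl
  have h₆ : (q ≫ u ≫ w).appLE U ((z ≫ a) ⁻¹ᵁ y ⁻¹ᵁ U) e₄ =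
      ((z ≫ a) ≫ y).appLE U ((z ≫ a) ⁻¹ᵁ y ⁻¹ᵁ U) le_rfl :=
    appLE_eq_of_eq (by rw [← Category.assoc, ← hq, Category.assoc, Category.assoc, h]) _ _
  have h₇ := appLE_eq_of_eq hq e₃ e₄
  rw [Scheme.Hom.appLE_eq_app] at h₁ h₄ h₅
  rw [Scheme.Hom.appLE_eq_app] at h₅
  have g₁ := (congrArg (fun t ↦ t.hom s) h₁).trans (congrArg (z.appLE _ _ e₁).hom hst)
  have g₂ := g₁.trans ((congrArg (fun f ↦ f.hom t) (h₂.symm.trans (h₇.trans h₃))).trans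
    (congrArg (q.appLE _ _ e₂).hom hr).symm)
  exact g₂.trans (congrArg (fun f ↦ f.hom r) (h₄.symm.trans (h₆.trans h₅)))

/-- A section of the codimension one part of an ideal sheaf `I` over an affine open lies in `I`
up to a function that does not vanish at a given point of codimension one. -/
lemma exists_mul_mem_ideal_of_mem_codimOnePart {Z : Scheme.{0}} (I : Z.IdealSheafData)
    {U : Z.Opens} (hU : IsAffineOpen U) {z : Z} (hz : z ∈ U) (hz' : IsCodimOne Z z) {f : Γ(Z, U)}
    (hf : f ∈ (codimOnePart I).ideal ⟨U, hU⟩) :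
    ∃ u ∉ (hU.primeIdealOf ⟨z, hz⟩).asIdeal, u * f ∈ I.ideal ⟨U, hU⟩ := by
  let := Z.presheaf.algebra_section_stalk ⟨z, hz⟩
  have := hU.isLocalization_stalk ⟨z, hz⟩
  have h := ideal_codimOnePart_le I (U := ⟨U, hU⟩) hz hz' hf
  obtain ⟨u, hu, huf⟩ := (IsLocalization.algebraMap_mem_map_algebraMap_iff
    (hU.primeIdealOf ⟨z, hz⟩).asIdeal.primeCompl (Z.presheaf.stalk z) (I.ideal ⟨U, hU⟩) f).mp h
  exact ⟨u, hu, huf⟩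

variable {V : ComplexVariety} {ℓ : ℕ} (F : Fin ℓ → V.X.IdealSheafData)

/-- Over an affine open and for large `k`, the functions on the normalization that descend to the
pushout `X_k` come from `X`. -/
lemma exists_forall_mem_range_of_glued (hS2 : IsS2 V.X)
    (hF : nonNormalLocus V.X ⊆ ⋃ i, ((F i).support : Set V.X)) {U : V.X.Opens}
    (hU : IsAffineOpen U) : ∃ k₀ : ℕ, ∀ k, k₀ ≤ k → ∀ s t,
      ((sigmaKDTo F k).appLE _ _ (preimage_le_preimage_of_comp_eq _ _ (normalizationMap V.X)
        (normalizationMap V.X) rfl U)).hom s = ((sigmaKDToKF F k).appLE _ _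
          (preimage_le_preimage_of_comp_eq _ _ (normalizationMap V.X) (sigmaKFTo F k)
            (sigmaKDTo_comp_normalizationMap F k) U)).hom t →
      s ∈ ((normalizationMap V.X).app U).hom.range := by
  let := ((normalizationMap V.X).app U).hom.toAlgebra
  obtain ⟨hfin, hbir⟩ := normalization_finite_and_isBirationalExtension V hU
  have := isNoetherianRing_sections V hU
  have hU' := hU.preimage (normalizationMap V.X)
  have hA := hasRegularPairs_of_isS2 hU hS2
  obtain ⟨k₀, hk₀⟩ := exists_forall_mem_range_of_congruent hbir hA
    (fun i ↦ (divPreimage (F i)).ideal ⟨_, hU'⟩) fun p hp ↦ by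
      have := hp.1
      obtain ⟨x, hx, rfl⟩ := exists_primeIdealOf_eq hU p
      obtain ⟨hxn, hx'⟩ := ideal_divPreimage_le_of_mem_associatedPrimes hS2 hU hx hp
      obtain ⟨i, hi⟩ := Set.mem_iUnion.mp (hF hxn)
      exact ⟨i, hx' (F i) hi⟩
  refine ⟨k₀, fun k hk s t hst ↦ hk₀ k hk s fun i ↦ ?_⟩
  have hc : Sigma.ι (fun i ↦ (kF (F i) k).subscheme) i ≫ sigmaKFTo F k = (kF (F i) k).subschemeι :=
    Sigma.ι_desc _ i
  have e : (kF (F i) k).subschemeι ⁻¹ᵁ U ≤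
      Sigma.ι (fun i ↦ (kF (F i) k).subscheme) i ⁻¹ᵁ sigmaKFTo F k ⁻¹ᵁ U := by
    rw [← hc]
    exact le_rfl
  obtain ⟨r, hr⟩ := (kF (F i) k).subschemeι_app_surjective ⟨U, hU⟩
    (((Sigma.ι (fun i ↦ (kF (F i) k).subscheme) i).appLE _ _ e).hom t)
  -- `r` is a function on `X` which restricts to the `i`-th component of `t`
  have hmem : s - ((normalizationMap V.X).app U).hom r ∈ (kD (F i) k).ideal ⟨_, hU'⟩ := by
    rw [← (kD (F i) k).ker_subschemeι, Scheme.Hom.ker_apply, RingHom.mem_ker, map_sub, sub_eq_zero]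
    exact appLE_eq_of_glued (sigmaKDTo_comp_normalizationMap F k) _ (kDTokF (F i) k) _
      (Sigma.ι_map (fun i ↦ kDTokF (F i) k) i)
      (Sigma.ι_desc (fun i ↦ (kD (F i) k).subschemeι) i) hc U s t hst e r hr
  refine ⟨r, fun p hp Q hQ hQp ↦ ?_⟩
  have := hp.1
  obtain ⟨x, hx, rfl⟩ := exists_primeIdealOf_eq hU p
  obtain ⟨y, hy, rfl, rfl⟩ := exists_apply_eq_of_comap_eq (normalizationMap V.X) hU Q hx hQp
  refine exists_mul_mem_ideal_of_mem_codimOnePart (divPreimage (F i) ^ k) hU' hy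
    (isCodimOne_of_isCodimOne_normalizationMap V ?_) hmem
  rw [isCodimOne_iff_height hU hx]
  exact height_eq_one_of_mem_associatedPrimes hbir hA hp

/-- Divisorial gluing: the pushouts `X_k` exist and map to `X`, isomorphically for large `k`. -/
theorem exists_isPushout_and_isIso (hS2 : IsS2 V.X)
    (hF : nonNormalLocus V.X ⊆ ⋃ i, ((F i).support : Set V.X))
    (hD : ∀ i j, i ≠ j → Disjoint ((divPreimage (F i)).support : Set (normalization V.X))
      ((divPreimage (F j)).support : Set (normalization V.X))) :
    ∃ (Xk : ℕ → Scheme.{0}) (inl : ∀ k, normalization V.X ⟶ Xk k)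
      (inr : ∀ k, (∐ fun i => (kF (F i) k).subscheme) ⟶ Xk k) (νk : ∀ k, Xk k ⟶ V.X),
      (∀ k, 0 < k →
        IsPushout (sigmaKDTo F k) (sigmaKDToKF F k) (inl k) (inr k) ∧
        inl k ≫ νk k = normalizationMap V.X ∧ inr k ≫ νk k = sigmaKFTo F k) ∧
      ∃ k₀ : ℕ, 0 < k₀ ∧ ∀ k, k₀ ≤ k → IsIso (νk k) := by
  choose P π i j hP hi hj hπ hdom haff using fun k ↦ exists_isPushout_sigmaKDTo F k hD
  refine ⟨P, i, j, π, fun k _ ↦ ⟨hP k, hi k, hj k⟩, ?_⟩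
  choose k₀ hk₀ using fun U : V.X.affineOpens ↦ exists_forall_mem_range_of_glued F hS2 hF U.2
  -- a common bound for the members of a finite affine cover of `X`
  let 𝒰 := V.X.affineCover.finiteSubcover
  let U (n : 𝒰.I₀) : V.X.affineOpens := ⟨(𝒰.f n).opensRange, isAffineOpen_opensRange _⟩
  obtain ⟨K, hK⟩ := (Set.finite_range fun n ↦ k₀ (U n)).bddAbove
  refine ⟨K + 1, K.succ_pos, fun k hk ↦ ?_⟩
  refine isIso_of_forall_mem_range (hP k).w (hi k) (hj k) (sigmaKDTo_comp_normalizationMap F k)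
    fun x ↦ ?_
  obtain ⟨n, z, rfl⟩ := 𝒰.exists_eq x
  refine ⟨U n, ⟨z, rfl⟩, (U n).2, ?_, hk₀ (U n) k ((hK ⟨n, rfl⟩).trans (by omega))⟩
  let := ((normalizationMap V.X).app (U n)).hom.toAlgebra
  exact (normalization_finite_and_isBirationalExtension V (U n).2).2.injective

end LargeMultiples

end DivGluing

/-! ### Divisorial gluing -/

theorem mainTheorem8 (V : ComplexVariety) (hS2 : IsS2 V.X) :
    -- divisorial gluing
    (∀ (ℓ : ℕ) (F : Fin ℓ → V.X.IdealSheafData),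
      (∀ i, IsDivisor (F i)) →
      (nonNormalLocus V.X ⊆ ⋃ i, ((F i).support : Set V.X)) →
      (∀ i j, i ≠ j → Disjoint ((divPreimage (F i)).support : Set (normalization V.X))
        ((divPreimage (F j)).support : Set (normalization V.X))) →
      ∃ (Xk : ℕ → Scheme.{0})
        (inl : ∀ k, normalization V.X ⟶ Xk k)
        (inr : ∀ k, (∐ fun i => (kF (F i) k).subscheme) ⟶ Xk k)
        (νk : ∀ k, Xk k ⟶ V.X),
        (∀ k, 0 < k →
          IsPushout (sigmaKDTo F k) (sigmaKDToKF F k) (inl k) (inr k) ∧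
          inl k ≫ νk k = normalizationMap V.X ∧
          inr k ≫ νk k = sigmaKFTo F k) ∧
        ∃ k₀ : ℕ, 0 < k₀ ∧ ∀ k, k₀ ≤ k → IsIso (νk k)) ∧
    -- divisors meeting in `X` have codimension one preimages meeting over the same point
    (∀ F₁ F₂ : V.X.IdealSheafData, IsDivisor F₁ → IsDivisor F₂ →
      (nonNormalLocus V.X ⊆ (F₁.support : Set V.X) ∪ (F₂.support : Set V.X)) →
      ∀ x : V.X, x ∈ F₁.support → x ∈ F₂.support →
        ∃ y : normalization V.X, y ∈ (divPreimage F₁).support ∧ y ∈ (divPreimage F₂).support ∧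
          normalizationMap V.X y = x) ∧
    -- analytic branches
    (∀ F : V.X.IdealSheafData, IsDivisor F →
      (nonNormalLocus V.X ⊆ (F.support : Set V.X)) →
      ∀ x : V.X, x ∈ F.support →
        ¬ ∃ I₁ I₂ : Set (Set (formalGerm V.X x)),
          I₁ ∪ I₂ = branches x F ∧ Disjoint I₁ I₂ ∧ I₁.Nonempty ∧ I₂.Nonempty ∧
          Disjoint (⋃ B ∈ I₁, codimOnePreimage x B) (⋃ B ∈ I₂, codimOnePreimage x B)) := by
  exact ⟨fun _ F _ hF hD ↦ exists_isPushout_and_isIso F hS2 hF hD,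
    fun _ _ h₁ h₂ h _ hx₁ hx₂ ↦ exists_mem_divPreimage_inter hS2 h₁ h₂ h hx₁ hx₂,
    fun _ hF hn x _ ↦ not_exists_partition_branches hS2 hF hn x⟩
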